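/- Let $u^1,u^2$ be coordinates on a domain $M=I\times J$, where $I,J\subseteq\mathbb R$ are open intervals and $0\notin I$; all coefficients are smooth on $M$. Write $d_x=\frac{d}{dx}$. A differential polynomial is a polynomial in the $x$-derivatives of $u^1,u^2$ with coefficients smooth in $(u^1,u^2)$; the degree is given by $\deg f(u)=0$ and $\deg\partial_x^k u^i=k$. A bivector of degree $d$ is a skew-adjoint $2\times2$ matrix operator $\sum_{m\le d}A_m\,d_x^{m}$ in which the entries of $A_m$ are homogeneous differential polynomials of degree $d-m$; $[\cdot,\cdot]$ is the Schouten bracket. Let $$P^{(2)}_0=\begin{pmatrix} d_x & -\frac{u^2_x}{u^1}\\ \frac{u^2_x}{u^1} & 0\end{pmatrix}.$$ A deformation of order $k$ of $P^{(2)}_0$ is a formal series $P_\epsilon=P^{(2)}_0+\sum_{n\ge1}\epsilon^nP_n$, with $P_n$ a bivector of degree $n+1$, such that the coefficients of $\epsilon^0,\dots,\epsilon^k$ in $[P_\epsilon,P_\epsilon]$ vanish. Infinitesimal Miura transformations act on such series by $P_\epsilon\mapsto\sum_{m\ge0}\frac1{m!}\mathrm{Lie}_\xi^m P_\epsilon$,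 where $\xi=\sum_{n\ge1}\epsilon^n\xi_n$ and $\xi_n$ is an evolutionary vector field whose components are homogeneous differential polynomials of degree $n$. Below, $'$ denotes the derivative with respect to $u^2$. (1) Every first-order deformation of $P^{(2)}_0$ can be reduced by an infinitesimal Miura transformation to $P^{(2)}_0+\epsilon P_1+\mathcal O(\epsilon^2)$ with $$P_1=\begin{pmatrix}0&0\\0&\frac{r}{(u^1)^3}u^2_x\end{pmatrix}d_x+\begin{pmatrix}0&-\frac{s}{(u^1)^3}(u^2_x)^2\\ \frac{s}{(u^1)^3}(u^2_x)^2&\frac12\left(\frac{r}{(u^1)^3}u^2_x\right)_x\end{pmatrix}$$ for some functions $r,s$ of $u^2$; conversely, for arbitrary smooth functions $r,s$ of $u^2$, $P^{(2)}_0+\epsilon P_1$ is a first-order deformation. (2) Every second-order deformation of $P^{(2)}_0$ can be reduced by an infinitesimal Miura transformation to $P^{(2)}_0+\epsilon P_1+\epsilon^2P_2+\mathcal O(\epsilon^3)$, where $P_1$ is as in (1) and $$P_2=\begin{pmatrix}0&0\\0&\alpha^{22}\end{pmatrix}d_x^3+\begin{pmatrix}0&0\\0&\beta^{22}\end{pmatrix}d_x^2+\begin{pmatrix}0&\gamma^{12}\\\gamma^{12}&\gamma^{22}\end{pmatrix}d_x+\begin{pmatrix}0&\eta^{12}\\\eta^{21}&\eta^{22}\end{pmatrix}$$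 with $$\alpha^{22}=\frac{r^2}{2(u^1)^4},\qquad \beta^{22}=\frac{3rr'}{2(u^1)^4}u^2_x-\frac{3r^2}{(u^1)^5}u^1_x,\qquad \gamma^{12}=\frac{19sr}{6(u^1)^5}\left(u^1u^2_{xx}-u^1_xu^2_x\right),$$ $$\gamma^{22}=\frac{15r^2}{2(u^1)^6}(u^1_x)^2-\frac{2r^2}{(u^1)^5}u^1_{xx}-\frac1{(u^1)^5}\left(\frac{9rr'}2+p\right)u^1_xu^2_x+\frac p{(u^1)^4}u^2_{xx},$$ $$\begin{aligned}\eta^{12}={}&\frac{5sr}{2(u^1)^4}u^2_{xxx}-\frac{5sr}{2(u^1)^5}u^1_{xx}u^2_x-\frac{32sr}{3(u^1)^5}u^1_xu^2_{xx}+\frac{3sr'+s'r}{(u^1)^4}u^2_xu^2_{xx}\\&+\frac{32sr}{3(u^1)^6}(u^1_x)^2u^2_x-\frac{3sr'+s'r}{(u^1)^5}u^1_x(u^2_x)^2-\frac{2s^2}{(u^1)^5}(u^2_x)^3,\end{aligned}$$ $$\begin{aligned}\eta^{21}={}&\frac{2sr}{3(u^1)^4}u^2_{xxx}-\frac{2sr}{3(u^1)^5}u^1_{xx}u^2_x-\frac{31sr}{6(u^1)^5}u^1_xu^2_{xx}+\frac{13s'r+sr'}{6(u^1)^4}u^2_xu^2_{xx}\\&+\frac{31sr}{6(u^1)^6}(u^1_x)^2u^2_x-\frac{13s'r+sr'}{6(u^1)^5}u^1_x(u^2_x)^2+\frac{2s^2}{(u^1)^5}(u^2_x)^3,\end{aligned}$$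 $$\begin{aligned}\eta^{22}={}&\frac1{2(u^1)^5}\left(\frac{3rr'}2-5p\right)u^1_xu^2_{xx}-\frac{15r^2}{2(u^1)^7}(u^1_x)^3-\frac1{2(u^1)^5}\left(\frac{5rr'}2+p\right)u^1_{xx}u^2_x\\&+\frac1{2(u^1)^4}\left(p'-\frac32\left((r')^2+rr''\right)\right)u^2_xu^2_{xx}+\frac5{2(u^1)^6}\left(\frac{3rr'}2+p\right)(u^1_x)^2u^2_x\\&+\frac1{2(u^1)^4}\left(p-\frac{rr'}2\right)u^2_{xxx}-\frac{r^2}{2(u^1)^5}u^1_{xxx}-\frac1{4(u^1)^4}\left(3r'r''+rr'''\right)(u^2_x)^3\\&+\frac{5r^2}{(u^1)^6}u^1_xu^1_{xx}-\frac1{2(u^1)^5}\left(p'-\frac32\left((r')^2+rr''\right)\right)u^1_x(u^2_x)^2\end{aligned}$$ for some functions $r,s,p$ of $u^2$; conversely, for arbitrary smooth functions $r,s,p$ of $u^2$, $P^{(2)}_0+\epsilon P_1+\epsilon^2P_2$ is a second-order deformation. -/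

import Mathlib

open scoped ContDiff

noncomputable section

namespace DegPoisson

/-! Coordinates are indexed by `Fin 2`: the index `0` stands for `u¹`, the index `1` for `u²`. -/

/-- A coordinate domain `{(u¹, u²) : u¹ ∈ I, u² ∈ J}` with `I`, `J` open intervals
(bounded or not) and `0 ∉ I`. -/
structure CoordBox where
  I : Set ℝ
  J : Set ℝ
  isOpen_I : IsOpen I
  isOpen_J : IsOpen J
  ordConnected_I : I.OrdConnected
  ordConnected_J : J.OrdConnected
  zero_notMem : (0 : ℝ) ∉ I

/-- The points of the coordinate domain. -/
def CoordBox.carrier (M : CoordBox) : Set (Fin 2 → ℝ) := {x | x 0 ∈ M.I ∧ x 1 ∈ M.J}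

theorem CoordBox.isOpen_carrier (M : CoordBox) : IsOpen M.carrier :=
  (M.isOpen_I.preimage (continuous_apply 0)).inter (M.isOpen_J.preimage (continuous_apply 1))

/-- The algebra `C^∞(M)` of smooth real functions on the coordinate domain. -/
def smoothFun (M : CoordBox) : Subalgebra ℝ (M.carrier → ℝ) where
  carrier := {f | ∃ g : (Fin 2 → ℝ) → ℝ, ContDiffOn ℝ ∞ g M.carrier ∧
    ∀ x : M.carrier, g x = f x}
  mul_mem' := by
    rintro a b ⟨g, hg, hga⟩ ⟨h, hh, hhb⟩
    exact ⟨fun x => g x * h x, hg.mul hh, fun x => by simp [hga, hhb]⟩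
  add_mem' := by
    rintro a b ⟨g, hg, hga⟩ ⟨h, hh, hhb⟩
    exact ⟨fun x => g x + h x, hg.add hh, fun x => by simp [hga, hhb]⟩
  algebraMap_mem' := fun c => ⟨fun _ => c, contDiffOn_const, fun _ => rfl⟩

/-- The coefficient ring of the differential polynomials. -/
def Coeff (M : CoordBox) : Type := smoothFun M

instance (M : CoordBox) : CommRing (Coeff M) := inferInstanceAs (CommRing (smoothFun M))

instance (M : CoordBox) : Algebra ℝ (Coeff M) := inferInstanceAs (Algebra ℝ (smoothFun M))

open Classical in
/-- A function on the domain, extended by zero to the whole plane (its derivatives at the points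
of the open domain do not depend on the extension). -/
def extendZero {M : CoordBox} (f : M.carrier → ℝ) (x : Fin 2 → ℝ) : ℝ :=
  if h : x ∈ M.carrier then f ⟨x, h⟩ else 0

theorem contDiffOn_extendZero {M : CoordBox} (f : Coeff M) :
    ContDiffOn ℝ ∞ (extendZero f.1) M.carrier := by
  obtain ⟨g, hg, hgf⟩ := f.2
  refine hg.congr fun x hx => ?_
  simp only [extendZero, hx, dif_pos]
  exact (hgf ⟨x, hx⟩).symm

/-- The partial derivative `∂f/∂uⁱ` of a smooth function on the domain. -/
def pderivCoeff {M : CoordBox} (i : Fin 2) (f : Coeff M) : Coeff M :=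
  ⟨fun x => fderiv ℝ (extendZero f.1) x (Pi.single i 1),
    fun x => fderiv ℝ (extendZero f.1) x (Pi.single i 1),
    ((contDiffOn_extendZero f).fderiv_of_isOpen M.isOpen_carrier
      (by simp)).clm_apply contDiffOn_const,
    fun _ => rfl⟩

/-- The function `1 / u¹` on the domain. -/
def invU1 (M : CoordBox) : Coeff M :=
  ⟨fun x => (x.1 0)⁻¹, fun x => (x 0)⁻¹,
    ContDiffOn.inv (contDiff_apply ℝ ℝ (0 : Fin 2)).contDiffOn
      (fun _ hx h0 => M.zero_notMem (h0 ▸ hx.1)),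
    fun _ => rfl⟩

/-- `f` is a function of the variable `u²` only. -/
def IsFunOfU2 {M : CoordBox} (f : Coeff M) : Prop :=
  ∃ φ : ℝ → ℝ, ∀ x : M.carrier, f.1 x = φ (x.1 1)

/-- Differential polynomials: polynomials in the jet variables with smooth coefficients on the
domain. The variable indexed by `(i, k)` is the `(k+1)`-st `x`-derivative of `uⁱ`; the variables
`uⁱ` themselves enter through the coefficients. -/
abbrev DiffPoly (M : CoordBox) : Type := MvPolynomial (Fin 2 × ℕ) (Coeff M)

/-- Homogeneity of a differential polynomial of degree `d`, where `deg f(u) = 0` and the `k`-th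
`x`-derivative of `uⁱ` has degree `k`. -/
def IsHomogeneousDP {M : CoordBox} (d : ℕ) (F : DiffPoly M) : Prop :=
  MvPolynomial.IsWeightedHomogeneous (fun v : Fin 2 × ℕ => v.2 + 1) F d

/-- The partial derivative of a differential polynomial with respect to `uⁱ` (no `x`-derivative):
it acts on the coefficients. -/
def pderivU {M : CoordBox} (i : Fin 2) (F : DiffPoly M) : DiffPoly M :=
  ∑ m ∈ F.support, MvPolynomial.monomial m (pderivCoeff i (F.coeff m))

/-- `∑ l, ∑ s, (∂F/∂uˡ₍ₛ₎) • w l s`, where `uˡ₍ₛ₎` is the `s`-th `x`-derivative of `uˡ`. The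
summands with `s ≥ 1` are collected in the derivation sending `uˡ₍ₛ₎` to `w l s`. -/
def jetDer {M : CoordBox} {N : Type*} [AddCommGroup N] [Module (DiffPoly M) N]
    [Module (Coeff M) N] [IsScalarTower (Coeff M) (DiffPoly M) N]
    (w : Fin 2 → ℕ → N) (F : DiffPoly M) : N :=
  ∑ l : Fin 2, pderivU l F • w l 0 +
    MvPolynomial.mkDerivation (Coeff M) (fun v : Fin 2 × ℕ => w v.1 (v.2 + 1)) F

/-- The total `x`-derivative of a differential polynomial. -/
def totalD {M : CoordBox} (F : DiffPoly M) : DiffPoly M :=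
  jetDer (fun l s => MvPolynomial.X (l, s)) F

/-- Scalar differential operators `∑ aₘ (d/dx)ᵐ`, stored as polynomials in the symbol `X = d/dx`
(coefficients written to the left). The same polynomial stores the distribution
`∑ aₘ(x) δ⁽ᵐ⁾(x - y)`. -/
abbrev DiffOp (M : CoordBox) : Type := Polynomial (DiffPoly M)

/-- Composition `(d/dx) ∘ p`; in terms of distributions, the `x`-derivative of
`∑ aₘ(x) δ⁽ᵐ⁾(x - y)`. -/
def dxOp {M : CoordBox} (p : DiffOp M) : DiffOp M :=
  (p.sum fun m a => Polynomial.monomial m (totalD a)) + Polynomial.X * p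

/-- Composition of differential operators. -/
def compOp {M : CoordBox} (p q : DiffOp M) : DiffOp M :=
  p.sum fun m a => Polynomial.C a * dxOp^[m] q

/-- Formal adjoint: `(∑ aₘ (d/dx)ᵐ)* = ∑ (-d/dx)ᵐ ∘ aₘ`. -/
def adjOp {M : CoordBox} (p : DiffOp M) : DiffOp M :=
  p.sum fun m a => (-1 : DiffOp M) ^ m * dxOp^[m] (Polynomial.C a)

/-- Matrix differential operators `P^{ij}`. -/
abbrev MatOp (M : CoordBox) : Type := Fin 2 → Fin 2 → DiffOp M

/-- Skew-symmetry `P* = -P`, that is, `P^{ij}_{x,y} = -P^{ji}_{y,x}`. -/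
def IsSkew {M : CoordBox} (P : MatOp M) : Prop := ∀ i j, adjOp (P j i) = -P i j

/-- `P` has degree `d`: its entries are sums of `A (d/dx)ᵐ`, `m ≤ d`, with `A` a differential
polynomial of degree `d - m`. -/
def HasDegree {M : CoordBox} (d : ℕ) (P : MatOp M) : Prop :=
  ∀ i j m, (m ≤ d → IsHomogeneousDP (d - m) ((P i j).coeff m)) ∧
    (d < m → (P i j).coeff m = 0)

/-- Trivector components `∑ f(x) δ⁽ᵐ⁾(x - y) δ⁽ⁿ⁾(x - z)`, stored as polynomials
`∑ f λᵐ μⁿ` in two symbols `λ = X 0` and `μ = X 1`. -/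
abbrev TriDist (M : CoordBox) : Type := MvPolynomial (Fin 2) (DiffPoly M)

/-- The `x`-derivative of `∑ f(x) δ⁽ᵐ⁾(x - y) δ⁽ⁿ⁾(x - z)`. -/
def dxTri {M : CoordBox} (T : TriDist M) : TriDist M :=
  (∑ d ∈ T.support, MvPolynomial.monomial d (totalD (T.coeff d))) +
    (MvPolynomial.X 0 + MvPolynomial.X 1) * T

/-- `∑ₗₛ (∂P^{ij}_{x,y} / ∂uˡ₍ₛ₎(x)) ∂ₓˢ Q^{lk}_{x,z}`. -/
def schoutenTerm {M : CoordBox} (P Q : MatOp M) (i j k : Fin 2) : TriDist M :=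
  (P i j).sum fun m a => MvPolynomial.X 0 ^ m *
    Polynomial.aeval (MvPolynomial.X 1 : TriDist M) (jetDer (fun l s => dxOp^[s] (Q l k)) a)

/-- If `T` stores `∑ f(z) δ⁽ᵐ⁾(z - x) δ⁽ⁿ⁾(z - y)`, then `fromZ T` stores the same distribution
with base point `x`:
`f(z) δ⁽ᵐ⁾(z - x) δ⁽ⁿ⁾(z - y) = (-1)ᵐ ∂ₓᵐ (f(x) δ⁽ⁿ⁾(x - y) δ(x - z))`. -/
def fromZ {M : CoordBox} (T : TriDist M) : TriDist M :=
  ∑ d ∈ T.support, (-1) ^ (d 0) *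
    dxTri^[d 0] (MvPolynomial.C (T.coeff d) * MvPolynomial.X 0 ^ (d 1))

/-- If `T` stores `∑ f(y) δ⁽ᵐ⁾(y - z) δ⁽ⁿ⁾(y - x)`, then `fromY T` stores the same distribution
with base point `x`:
`f(y) δ⁽ᵐ⁾(y - z) δ⁽ⁿ⁾(y - x) = (-1)ⁿ ∂ₓⁿ (f(x) δ(x - y) δ⁽ᵐ⁾(x - z))`. -/
def fromY {M : CoordBox} (T : TriDist M) : TriDist M :=
  ∑ d ∈ T.support, (-1) ^ (d 1) *
    dxTri^[d 1] (MvPolynomial.C (T.coeff d) * MvPolynomial.X 1 ^ (d 0))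

/-- The Schouten bracket `[P, Q]^{ijk}_{x,y,z}` of two bivectors whose coefficients are evaluated
at the first of the two points. -/
def schouten {M : CoordBox} (P Q : MatOp M) (i j k : Fin 2) : TriDist M :=
  schoutenTerm P Q i j k + schoutenTerm Q P i j k
    + fromZ (schoutenTerm P Q k i j) + fromZ (schoutenTerm Q P k i j)
    + fromY (schoutenTerm P Q j k i) + fromY (schoutenTerm Q P j k i)

/-- Evolutionary vector fields, given by their two components. -/
abbrev VecField (M : CoordBox) : Type := Fin 2 → DiffPoly M

/-- Action of the vector field `∑ (∂ₓˢ ξˡ) ∂/∂uˡ₍ₛ₎` on differential polynomials. -/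
def evol {M : CoordBox} (ξ : VecField M) (F : DiffPoly M) : DiffPoly M :=
  jetDer (fun l s => totalD^[s] (ξ l)) F

/-- The operator `∑ₛ (∂F/∂uᵏ₍ₛ₎) (d/dx)ˢ`. -/
def frechet {M : CoordBox} (F : DiffPoly M) (k : Fin 2) : DiffOp M :=
  jetDer (fun l s => if l = k then (Polynomial.X ^ s : DiffOp M) else 0) F

/-- The Lie derivative of a bivector along an evolutionary vector field,
`(Lie_ξ P)^{ij} = ξ(P^{ij}) - ∑ₖₛ (∂ξⁱ/∂uᵏ₍ₛ₎)(x) ∂ₓˢ P^{kj}_{x,y}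
  - ∑ₖₛ (∂ξʲ/∂uᵏ₍ₛ₎)(y) ∂_yˢ P^{ik}_{x,y}`. -/
def lieDer {M : CoordBox} (ξ : VecField M) (P : MatOp M) : MatOp M := fun i j =>
  ((P i j).sum fun m a => Polynomial.monomial m (evol ξ a))
    - ∑ k, compOp (frechet (ξ i) k) (P k j)
    - ∑ k, compOp (P i k) (adjOp (frechet (ξ j) k))

/-- Lie derivative of a formal series `∑ εⁿ Pₙ` along a formal series `∑ εⁿ ξₙ`. -/
def lieSeries {M : CoordBox} (ξ : ℕ → VecField M) (P : ℕ → MatOp M) : ℕ → MatOp M := fun n =>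
  ∑ a ∈ Finset.HasAntidiagonal.antidiagonal n, lieDer (ξ a.1) (P a.2)

/-- The action `∑ₘ (1/m!) (Lie_ξ)ᵐ P` of the Miura transformation generated by
`ξ = ∑ εⁿ ξₙ` with `ξ₀ = 0` (only the terms with `m ≤ n` contribute to the coefficient
of `εⁿ`). -/
def miura {M : CoordBox} (ξ : ℕ → VecField M) (P : ℕ → MatOp M) : ℕ → MatOp M := fun n =>
  ∑ m ∈ Finset.range (n + 1), ((m.factorial : ℝ)⁻¹) • ((lieSeries ξ)^[m] P n)

/-- Generators of Miura transformations close to the identity: `ξ = ∑_{n ≥ 1} εⁿ ξₙ` with `ξₙ`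
homogeneous of degree `n`. -/
def IsMiuraGenerator {M : CoordBox} (ξ : ℕ → VecField M) : Prop :=
  ξ 0 = 0 ∧ ∀ n i, IsHomogeneousDP n (ξ n i)

/-- `u¹_x, u¹_xx, …`: the `(k+1)`-st derivative of `u¹`. -/
def u1 (M : CoordBox) (k : ℕ) : DiffPoly M := MvPolynomial.X (0, k)

/-- `u²_x, u²_xx, …`: the `(k+1)`-st derivative of `u²`. -/
def u2 (M : CoordBox) (k : ℕ) : DiffPoly M := MvPolynomial.X (1, k)

/-- The undeformed structure, with rows `(d_x, -u²_x/u¹)` and `(u²_x/u¹, 0)`. -/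
def poisson0 (M : CoordBox) : MatOp M :=
  let v : DiffPoly M := MvPolynomial.C (invU1 M)
  ![![Polynomial.X, Polynomial.C (-(v * u2 M 0))],
    ![Polynomial.C (v * u2 M 0), 0]]

/-- `P_ε = ∑ εⁿ Pₙ` is a homogeneous deformation of order `k` of the undeformed structure:
each `Pₙ` is a bivector of degree `n + 1`, and the coefficients of `ε⁰, …, εᵏ` in
`[P_ε, P_ε]` vanish. -/
structure IsDeformation {M : CoordBox} (k : ℕ) (P : ℕ → MatOp M) : Prop where
  zero : P 0 = poisson0 M
  hasDegree : ∀ n, HasDegree (n + 1) (P n)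
  isSkew : ∀ n, IsSkew (P n)
  jacobi : ∀ n ≤ k, ∀ i j l, ∑ a ∈ Finset.HasAntidiagonal.antidiagonal n, schouten (P a.1) (P a.2) i j l = 0

/-- The normal form `P₁` with functional parameters `r`, `s`. -/
def normalForm1 {M : CoordBox} (r s : Coeff M) : MatOp M :=
  let v : DiffPoly M := MvPolynomial.C (invU1 M)
  let R : DiffPoly M := MvPolynomial.C r
  let S : DiffPoly M := MvPolynomial.C s
  let b : DiffPoly M := R * v ^ 3 * u2 M 0
  let c : DiffPoly M := S * v ^ 3 * u2 M 0 ^ 2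
  ![![0, Polynomial.C (-c)],
    ![Polynomial.C c,
      Polynomial.C b * Polynomial.X + Polynomial.C ((1 / 2 : ℝ) • totalD b)]]

/-- The normal form `P₂` with functional parameters `r`, `s`, `p`. In the formulas `v = 1/u¹`,
`a1, a2, a3` are the derivatives `u¹_x, u¹_xx, u¹_xxx`, and `b1, b2, b3` those of `u²`. -/
def normalForm2 {M : CoordBox} (r s p : Coeff M) : MatOp M :=
  let D : Coeff M → Coeff M := pderivCoeff 1
  let v : DiffPoly M := MvPolynomial.C (invU1 M)
  let R : DiffPoly M := MvPolynomial.C r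
  let R' : DiffPoly M := MvPolynomial.C (D r)
  let R'' : DiffPoly M := MvPolynomial.C (D (D r))
  let R''' : DiffPoly M := MvPolynomial.C (D (D (D r)))
  let S : DiffPoly M := MvPolynomial.C s
  let S' : DiffPoly M := MvPolynomial.C (D s)
  let p0 : DiffPoly M := MvPolynomial.C p
  let p' : DiffPoly M := MvPolynomial.C (D p)
  let a1 := u1 M 0
  let a2 := u1 M 1
  let a3 := u1 M 2
  let b1 := u2 M 0
  let b2 := u2 M 1
  let b3 := u2 M 2
  let α22 : DiffPoly M := (1 / 2 : ℝ) • (R ^ 2 * v ^ 4)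
  let β22 : DiffPoly M := (3 / 2 : ℝ) • (R * R' * v ^ 4 * b1) - (3 : ℝ) • (R ^ 2 * v ^ 5 * a1)
  let γ12 : DiffPoly M := (19 / 6 : ℝ) • (S * R * (v ^ 4 * b2 - v ^ 5 * a1 * b1))
  let γ22 : DiffPoly M :=
    (15 / 2 : ℝ) • (R ^ 2 * v ^ 6 * a1 ^ 2) - (2 : ℝ) • (R ^ 2 * v ^ 5 * a2)
      - v ^ 5 * ((9 / 2 : ℝ) • (R * R') + p0) * a1 * b1 + p0 * v ^ 4 * b2
  let η12 : DiffPoly M :=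
    (5 / 2 : ℝ) • (S * R * v ^ 4 * b3) - (5 / 2 : ℝ) • (S * R * v ^ 5 * a2 * b1)
      - (32 / 3 : ℝ) • (S * R * v ^ 5 * a1 * b2)
      + ((3 : ℝ) • (S * R') + S' * R) * v ^ 4 * b1 * b2
      + (32 / 3 : ℝ) • (S * R * v ^ 6 * a1 ^ 2 * b1)
      - ((3 : ℝ) • (S * R') + S' * R) * v ^ 5 * a1 * b1 ^ 2
      - (2 : ℝ) • (S ^ 2 * v ^ 5 * b1 ^ 3)
  let η21 : DiffPoly M :=
    (2 / 3 : ℝ) • (S * R * v ^ 4 * b3) - (2 / 3 : ℝ) • (S * R * v ^ 5 * a2 * b1)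
      - (31 / 6 : ℝ) • (S * R * v ^ 5 * a1 * b2)
      + (1 / 6 : ℝ) • (((13 : ℝ) • (S' * R) + S * R') * v ^ 4 * b1 * b2)
      + (31 / 6 : ℝ) • (S * R * v ^ 6 * a1 ^ 2 * b1)
      - (1 / 6 : ℝ) • (((13 : ℝ) • (S' * R) + S * R') * v ^ 5 * a1 * b1 ^ 2)
      + (2 : ℝ) • (S ^ 2 * v ^ 5 * b1 ^ 3)
  let η22 : DiffPoly M :=
    (1 / 2 : ℝ) • (v ^ 5 * ((3 / 2 : ℝ) • (R * R') - (5 : ℝ) • p0) * a1 * b2)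
      - (15 / 2 : ℝ) • (R ^ 2 * v ^ 7 * a1 ^ 3)
      - (1 / 2 : ℝ) • (v ^ 5 * ((5 / 2 : ℝ) • (R * R') + p0) * a2 * b1)
      + (1 / 2 : ℝ) • (v ^ 4 * (p' - (3 / 2 : ℝ) • (R' ^ 2 + R * R'')) * b1 * b2)
      + (5 / 2 : ℝ) • (v ^ 6 * ((3 / 2 : ℝ) • (R * R') + p0) * a1 ^ 2 * b1)
      + (1 / 2 : ℝ) • (v ^ 4 * (p0 - (1 / 2 : ℝ) • (R * R')) * b3)
      - (1 / 2 : ℝ) • (R ^ 2 * v ^ 5 * a3)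
      - (1 / 4 : ℝ) • (v ^ 4 * ((3 : ℝ) • (R' * R'') + R * R''') * b1 ^ 3)
      + (5 : ℝ) • (R ^ 2 * v ^ 6 * a1 * a2)
      - (1 / 2 : ℝ) • (v ^ 5 * (p' - (3 / 2 : ℝ) • (R' ^ 2 + R * R'')) * a1 * b1 ^ 2)
  ![![0, Polynomial.C γ12 * Polynomial.X + Polynomial.C η12],
    ![Polynomial.C γ12 * Polynomial.X + Polynomial.C η21,
      Polynomial.C α22 * Polynomial.X ^ 3 + Polynomial.C β22 * Polynomial.X ^ 2
        + Polynomial.C γ22 * Polynomial.X + Polynomial.C η22]]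

/-- The series `P₀ + ε P₁ + ε² P₂`. -/
def series {M : CoordBox} (P₀ P₁ P₂ : MatOp M) : ℕ → MatOp M
  | 0 => P₀
  | 1 => P₁
  | 2 => P₂
  | _ => 0

end DegPoisson

end

/-!
# Deformations of the degenerate Poisson structure up to second order

**Brackets.** A trivector component `∑ f δ⁽ᵐ⁾(x - y) δ⁽ⁿ⁾(x - z)` is determined by the bidifferential
operator `(b, c) ↦ ∑ f ∂ᵐ b ∂ⁿ c`, and that operator is determined by the trilinear form
`∫ a (∑ f ∂ᵐ b ∂ⁿ c)`, since the pairing `∫ f a` modulo total derivatives is nondegenerate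
(`eq_zero_of_forall_intg_mul`). In this form the bracket of `P` and `Q` is the cyclic sum of
`∫ a · P_*[Q c] b` and the same terms with `P` and `Q` exchanged (`jacobiForm`); see
`sum_schouten_eq_zero_iff`. For skew-adjoint operators it is expressed by Lie derivatives of covectors
(`jacobiForm_eq`), which makes its invariance under evolutionary vector fields a consequence of the
Jacobi identity for their commutator (`jacobiForm_lieDer_add`). Moving all derivatives away from one
argument gives differential polynomials in the other two that vanish if and only if the bracket does
(`bracketTerm`).

**Converse directions.** For explicit operators `bracketTerm` is evaluated by the Leibniz rules for the
total derivative, for evolutionary vector fields and for adjoints of linearizations. That the normal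
forms solve the deformation equations then becomes a polynomial identity. By cyclic symmetry it is
enough to check the components with equal second and third indices (`sum_schouten_eq_zero`).

**Direct part.** Up to Miura transformations, the terms to be normalized are cocycles `P`, that is,
bivectors of degree 2 or 3 with `[P, P₀] = 0`: in first order this is the term `P₁` itself, and in second
order it is the difference between the transformed `P₂` and the second normal form with `p = 0`
(`IsDeformation.exists_miura_two`; the invariance of the bracket shows that the transformed terms still
satisfy the second-order equation). The claim is thus the computation of cocycles modulo `Lie_ξ P₀`. The
entry `P¹¹` is removed by a vector field along `u¹`. A vector field along `u²` brings `P²¹` to a form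
in which the cocycle condition shows that it is `1/u¹` times a polynomial in `∂u²`, `∂²u²`, `∂³u²`, where
`∂ = d_x / u¹`, with coefficients depending only on `u²`. The other components of the condition then
leave, in degree 2, the parameters `r` and `s` (`IsCocycle.eq_normalForm1`). In degree 3 the surviving
terms are removed by further vector fields, except for one depending on a function `p` of `u²`
(`IsCocycle.exists_eq_diagonal`).

The gauge transformations are found by solving linear first-order equations in `u¹`, which is possible
because the domain is a product of intervals (`exists_pderivCoeff_zero_eq`). The equations for the
coefficients are obtained by applying the operators to a jet variable of high order and comparing
coefficients of jet monomials. -/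

noncomputable section

namespace DegPoisson

/-! ### Calculus in the coefficient ring -/

section CoeffCalculus

variable {M : CoordBox}

@[ext]
theorem Coeff.ext' {f g : Coeff M} (h : ∀ x, f.1 x = g.1 x) : f = g :=
  Subtype.ext (funext h)

theorem extendZero_apply (f : M.carrier → ℝ) (x : M.carrier) : extendZero f x = f x := by
  simp [extendZero]

theorem extendZero_eventuallyEq {f : Coeff M} {g : (Fin 2 → ℝ) → ℝ} (x : M.carrier)
    (h : ∀ y : M.carrier, g y = f.1 y) : extendZero f.1 =ᶠ[nhds (x : Fin 2 → ℝ)] g := by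
  filter_upwards [M.isOpen_carrier.mem_nhds x.2] with y hy
  rw [h ⟨y, hy⟩, ← extendZero_apply f.1 ⟨y, hy⟩]

theorem differentiableAt_extendZero (f : Coeff M) (x : M.carrier) :
    DifferentiableAt ℝ (extendZero f.1) x :=
  ((contDiffOn_extendZero f).contDiffAt (M.isOpen_carrier.mem_nhds x.2)).differentiableAt
    (by simp)

theorem pderivCoeff_apply_eq (i : Fin 2) (f : Coeff M) (g : (Fin 2 → ℝ) → ℝ) (x : M.carrier)
    (h : ∀ y : M.carrier, g y = f.1 y) :
    (pderivCoeff i f).1 x = fderiv ℝ g x (Pi.single i 1) := by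
  change fderiv ℝ (extendZero f.1) x (Pi.single i 1) = _
  rw [(extendZero_eventuallyEq x h).fderiv_eq]

theorem pderivCoeff_add (i : Fin 2) (f g : Coeff M) :
    pderivCoeff i (f + g) = pderivCoeff i f + pderivCoeff i g := by
  ext x
  rw [pderivCoeff_apply_eq i (f + g) (extendZero f.1 + extendZero g.1) x
    (fun y => by simp only [Pi.add_apply, extendZero_apply]; rfl),
    fderiv_add (differentiableAt_extendZero f x) (differentiableAt_extendZero g x)]
  rfl

theorem pderivCoeff_mul (i : Fin 2) (f g : Coeff M) :
    pderivCoeff i (f * g) = f * pderivCoeff i g + g * pderivCoeff i f := by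
  ext x
  rw [pderivCoeff_apply_eq i (f * g) (extendZero f.1 * extendZero g.1) x
    (fun y => by simp only [Pi.mul_apply, extendZero_apply]; rfl),
    fderiv_mul (differentiableAt_extendZero f x) (differentiableAt_extendZero g x)]
  simp only [extendZero_apply]
  rfl

theorem pderivCoeff_algebraMap (i : Fin 2) (c : ℝ) :
    pderivCoeff i (algebraMap ℝ (Coeff M) c) = 0 := by
  ext x
  rw [pderivCoeff_apply_eq i (algebraMap ℝ (Coeff M) c) (fun _ => c) x (fun y => rfl)]
  simp
  rfl

/-- The partial derivative `∂/∂uⁱ` as a derivation of the coefficient ring. -/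
def coeffDer (i : Fin 2) : Derivation ℝ (Coeff M) (Coeff M) where
  toFun := pderivCoeff i
  map_add' := pderivCoeff_add i
  map_smul' c f := by
    rw [Algebra.smul_def, pderivCoeff_mul, pderivCoeff_algebraMap]
    simp [Algebra.smul_def]
  map_one_eq_zero' := by
    have := pderivCoeff_algebraMap (M := M) i 1
    rwa [map_one] at this
  leibniz' f g := pderivCoeff_mul i f g

theorem coeffDer_apply (i : Fin 2) (f : Coeff M) : coeffDer i f = pderivCoeff i f := rfl

theorem pderivCoeff_comm (f : Coeff M) :
    pderivCoeff 0 (pderivCoeff 1 f) = pderivCoeff 1 (pderivCoeff 0 f) := by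
  have key : ∀ (i j : Fin 2) (x : M.carrier), (pderivCoeff i (pderivCoeff j f)).1 x =
      fderiv ℝ (fderiv ℝ (extendZero f.1)) x (Pi.single i 1) (Pi.single j 1) := by
    intro i j x
    rw [pderivCoeff_apply_eq i (pderivCoeff j f)
      (fun y => fderiv ℝ (extendZero f.1) y (Pi.single j 1)) x (fun y => rfl)]
    have h1 : DifferentiableAt ℝ (fderiv ℝ (extendZero f.1)) x :=
      ((((contDiffOn_extendZero f).fderiv_of_isOpen M.isOpen_carrier (m := ∞)
        (by simp))).contDiffAt (M.isOpen_carrier.mem_nhds x.2)).differentiableAt (by simp)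
    rw [fderiv_clm_apply h1 (differentiableAt_const _)]
    simp
  ext x
  rw [key, key]
  have h2 : IsSymmSndFDerivAt ℝ (extendZero f.1) (x : Fin 2 → ℝ) :=
    ((contDiffOn_extendZero f).contDiffAt
      (M.isOpen_carrier.mem_nhds x.2)).isSymmSndFDerivAt
        (by simpa using WithTop.coe_le_coe.2 (le_top (a := (2 : ℕ∞))))
  exact h2 _ _

/-- The coordinate function `u¹`. -/
def coordU1 (M : CoordBox) : Coeff M :=
  ⟨fun x => x.1 0, fun x => x 0, (contDiff_apply ℝ ℝ (0 : Fin 2)).contDiffOn, fun _ => rfl⟩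

theorem coordU1_mul_invU1 : coordU1 M * invU1 M = 1 := by
  ext x
  exact mul_inv_cancel₀ (fun h => M.zero_notMem (h ▸ x.2.1))

theorem pderivCoeff_coordU1 (i : Fin 2) :
    pderivCoeff i (coordU1 M) = if i = 0 then 1 else 0 := by
  ext x
  rw [pderivCoeff_apply_eq i (coordU1 M) (fun y => y 0) x (fun y => rfl)]
  have : fderiv ℝ (fun y : Fin 2 → ℝ => y 0) (x : Fin 2 → ℝ) =
      ContinuousLinearMap.proj (R := ℝ) (φ := fun _ : Fin 2 => ℝ) 0 :=
    (ContinuousLinearMap.proj (R := ℝ) (φ := fun _ : Fin 2 => ℝ) 0).fderiv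
  rw [this]
  fin_cases i
  · simp; rfl
  · simp; rfl

theorem pderivCoeff_invU1_zero : pderivCoeff 0 (invU1 M) = -invU1 M ^ 2 := by
  have h := congrArg (pderivCoeff 0) (coordU1_mul_invU1 (M := M))
  rw [pderivCoeff_mul, ← coeffDer_apply 0 1, Derivation.map_one_eq_zero, pderivCoeff_coordU1] at h
  simp only [if_true, Fin.isValue] at h
  linear_combination invU1 M * h - pderivCoeff 0 (invU1 M) * coordU1_mul_invU1 (M := M)

theorem pderivCoeff_invU1_one : pderivCoeff 1 (invU1 M) = 0 := by
  have h := congrArg (pderivCoeff 1) (coordU1_mul_invU1 (M := M))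
  rw [pderivCoeff_mul, ← coeffDer_apply 1 1, Derivation.map_one_eq_zero, pderivCoeff_coordU1] at h
  simp only [one_ne_zero, if_false, Fin.isValue] at h
  linear_combination invU1 M * h - pderivCoeff 1 (invU1 M) * coordU1_mul_invU1 (M := M)

end CoeffCalculus

/-! ### Antiderivatives with respect to the first coordinate -/

section Antiderivative

open MeasureTheory intervalIntegral

/-- Smooth dependence of an integral over `[0, 1]` on a parameter. -/
theorem contDiffOn_integral_unitInterval {E : Type} [NormedAddCommGroup E] [NormedSpace ℝ E]
    [FiniteDimensional ℝ E] {U : Set E} (hU : IsOpen U) (n : ℕ) :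
    ∀ {G : Type} [NormedAddCommGroup G] [NormedSpace ℝ G] [CompleteSpace G]
      {Ω : Set (E × ℝ)} (_ : IsOpen Ω) (_ : ∀ x ∈ U, ∀ t ∈ Set.Icc (0 : ℝ) 1, (x, t) ∈ Ω)
      {h : E × ℝ → G} (_ : ContDiffOn ℝ ∞ h Ω),
      ContDiffOn ℝ n (fun x => ∫ t in (0 : ℝ)..1, h (x, t)) U := by
  have hprop : ProperSpace E := FiniteDimensional.proper ℝ E
  have deriv_aux : ∀ {G : Type} [NormedAddCommGroup G] [NormedSpace ℝ G] [CompleteSpace G]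
      {Ω : Set (E × ℝ)} (_ : IsOpen Ω) (_ : ∀ x ∈ U, ∀ t ∈ Set.Icc (0 : ℝ) 1, (x, t) ∈ Ω)
      {h : E × ℝ → G} (_ : ContDiffOn ℝ ∞ h Ω), ∀ x ∈ U,
      HasFDerivAt (fun x => ∫ t in (0 : ℝ)..1, h (x, t))
        (∫ t in (0 : ℝ)..1, (fderiv ℝ h (x, t)).comp (ContinuousLinearMap.inl ℝ E ℝ)) x := by
    intro G _ _ _ Ω hΩ hsub h hh x hx
    have hsegcont : ∀ y ∈ U, ∀ {G' : Type} [NormedAddCommGroup G'] {k : E × ℝ → G'},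
        ContinuousOn k Ω → ContinuousOn (fun t => k (y, t)) (Set.uIcc 0 1) := by
      intro y hy G' _ k hk
      refine hk.comp (by fun_prop) fun t ht => hsub y hy t ?_
      rwa [Set.uIcc_of_le zero_le_one] at ht
    have hcontD : ContinuousOn
        (fun p => (fderiv ℝ h p).comp (ContinuousLinearMap.inl ℝ E ℝ)) Ω :=
      (hh.continuousOn_fderiv_of_isOpen hΩ (by simp)).clm_comp continuousOn_const
    obtain ⟨u, v, hu, hv, hxu, hIv, huv⟩ := generalized_tube_lemma
      (isCompact_singleton (x := x)) (isCompact_Icc (a := (0 : ℝ)) (b := 1)) hΩ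
      (by rintro ⟨y, t⟩ ⟨hy, ht⟩
          obtain rfl : y = x := hy
          exact hsub y hx t ht)
    obtain ⟨ε, hε, hball⟩ := Metric.isOpen_iff.1 (hu.inter hU) x ⟨hxu rfl, hx⟩
    have hcb : Metric.closedBall x (ε / 2) ⊆ u ∩ U :=
      (Metric.closedBall_subset_ball (by linarith)).trans hball
    have hcomp : IsCompact (Metric.closedBall x (ε / 2) ×ˢ Set.Icc (0 : ℝ) 1) :=
      (isCompact_closedBall x (ε / 2)).prod isCompact_Icc
    obtain ⟨C, hC⟩ := hcomp.exists_bound_of_continuousOn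
      (hcontD.mono fun p hp => hsub p.1 (hcb hp.1).2 p.2 hp.2)
    have hs : Metric.closedBall x (ε / 2) ∈ nhds x := Metric.closedBall_mem_nhds x (by linarith)
    have hIoc : ∀ t ∈ Set.uIoc (0 : ℝ) 1, t ∈ Set.Icc (0 : ℝ) 1 := by
      intro t ht
      rw [Set.uIoc_of_le zero_le_one] at ht
      exact ⟨ht.1.le, ht.2⟩
    refine hasFDerivAt_integral_of_dominated_of_fderiv_le (μ := volume)
      (bound := fun _ => C) (F := fun x t => h (x, t))
      (F' := fun x t => (fderiv ℝ h (x, t)).comp (ContinuousLinearMap.inl ℝ E ℝ)) hs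
      ?_ ?_ ?_ ?_ ?_ ?_
    · filter_upwards [hU.mem_nhds hx] with y hy
      exact (intervalIntegrable_iff.1
        (hsegcont y hy hh.continuousOn).intervalIntegrable).aestronglyMeasurable
    · exact (hsegcont x hx hh.continuousOn).intervalIntegrable
    · exact (intervalIntegrable_iff.1
        (hsegcont x hx hcontD).intervalIntegrable).aestronglyMeasurable
    · exact Filter.Eventually.of_forall fun t ht y hy => hC (y, t) ⟨hy, hIoc t ht⟩
    · exact intervalIntegrable_const
    · refine Filter.Eventually.of_forall fun t ht y hy => ?_
      have hmem := hsub y (hcb hy).2 t (hIoc t ht)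
      have hd : HasFDerivAt h (fderiv ℝ h (y, t)) (y, t) :=
        ((hh.contDiffAt (hΩ.mem_nhds hmem)).differentiableAt (by simp)).hasFDerivAt
      exact hd.comp y ((hasFDerivAt_id y).prodMk (hasFDerivAt_const t y))
  induction n with
  | zero =>
    intro G _ _ _ Ω hΩ hsub h hh
    exact contDiffOn_zero.2 fun x hx =>
      (deriv_aux hΩ hsub hh x hx).continuousAt.continuousWithinAt
  | succ n ih =>
    intro G _ _ _ Ω hΩ hsub h hh
    rw [Nat.cast_succ, contDiffOn_succ_iff_fderiv_of_isOpen hU]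
    refine ⟨fun x hx => (deriv_aux hΩ hsub hh x hx).differentiableAt.differentiableWithinAt,
      by simp, ?_⟩
    have := ih hΩ hsub (h := fun p => (fderiv ℝ h p).comp (ContinuousLinearMap.inl ℝ E ℝ))
      ((hh.fderiv_of_isOpen hΩ (by simp)).clm_comp contDiffOn_const)
    exact this.congr fun x hx => (deriv_aux hΩ hsub hh x hx).fderiv

variable {M : CoordBox}

/-- The element of the coefficient ring given by a smooth function on the plane. -/
def Coeff.ofContDiffOn (g : (Fin 2 → ℝ) → ℝ) (hg : ContDiffOn ℝ ∞ g M.carrier) : Coeff M :=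
  ⟨fun x => g x, g, hg, fun _ => rfl⟩

/-- Every coefficient has an antiderivative in `u¹`, because `I` is an interval: the primitive from
a base point `c`, rescaled to an integral over `[0, 1]` so that its integrand, hence also its
value, is smooth in both coordinates. -/
theorem exists_pderivCoeff_zero_eq (f : Coeff M) : ∃ g : Coeff M, pderivCoeff 0 g = f := by
  rcases M.I.eq_empty_or_nonempty with hI | ⟨c, hc⟩
  · refine ⟨0, ?_⟩
    ext x
    exact absurd x.2.1 (by simp [hI])
  set φ : (Fin 2 → ℝ) × ℝ → (Fin 2 → ℝ) := fun p => ![c + (p.1 0 - c) * p.2, p.1 1] with hφ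
  have hφs : ContDiff ℝ ∞ φ := by
    rw [contDiff_pi]
    intro i
    have h0 : ∀ j : Fin 2, ContDiff ℝ ∞ (fun p : (Fin 2 → ℝ) × ℝ => p.1 j) := fun j =>
      (contDiff_apply ℝ ℝ j).comp contDiff_fst
    fin_cases i
    · exact contDiff_const.add (((h0 0).sub contDiff_const).mul contDiff_snd)
    · exact h0 1
  set Ω : Set ((Fin 2 → ℝ) × ℝ) := φ ⁻¹' M.carrier with hΩdef
  have hΩ : IsOpen Ω := M.isOpen_carrier.preimage hφs.continuous
  have hsub : ∀ x ∈ M.carrier, ∀ t ∈ Set.Icc (0 : ℝ) 1, (x, t) ∈ Ω := by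
    intro x hx t ht
    refine ⟨?_, hx.2⟩
    have := M.ordConnected_I.convex.add_smul_sub_mem hc hx.1 ht
    simpa [hφ, mul_comm] using this
  set F : (Fin 2 → ℝ) → ℝ := fun x =>
    ∫ t in (0 : ℝ)..1, (x 0 - c) * extendZero f.1 (φ (x, t)) with hF
  have hFs : ContDiffOn ℝ ∞ F M.carrier := by
    rw [contDiffOn_infty]
    intro n
    refine contDiffOn_integral_unitInterval M.isOpen_carrier n hΩ hsub
      (h := fun p => (p.1 0 - c) * extendZero f.1 (φ p)) ?_
    refine ContDiffOn.mul ?_ ((contDiffOn_extendZero f).comp hφs.contDiffOn fun p hp => hp)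
    exact (((contDiff_apply ℝ ℝ (0 : Fin 2)).comp contDiff_fst).sub contDiff_const).contDiffOn
  refine ⟨Coeff.ofContDiffOn F hFs, ?_⟩
  ext x
  rw [pderivCoeff_apply_eq 0 _ F x (fun _ => rfl)]
  have hFd : DifferentiableAt ℝ F x :=
    (hFs.contDiffAt (M.isOpen_carrier.mem_nhds x.2)).differentiableAt (by simp)
  -- along the coordinate line the rescaled integral is the usual primitive
  set k : ℝ → ℝ := fun s => extendZero f.1 ![s, x.1 1] with hk
  have hFk : ∀ s, F ![s, x.1 1] = ∫ t in c..s, k t := by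
    intro s
    have := intervalIntegral.smul_integral_comp_add_mul (a := 0) (b := 1) k (s - c) c
    simp only [mul_zero, add_zero, mul_one, add_sub_cancel, smul_eq_mul] at this
    rw [← this, ← intervalIntegral.integral_const_mul]
    simp [hF, hφ, hk]
  have hkc : ContinuousOn k M.I := by
    refine (contDiffOn_extendZero f).continuousOn.comp (t := M.carrier) ?_ fun s hs => ⟨hs, x.2.2⟩
    refine Continuous.continuousOn (continuous_pi fun i => ?_)
    fin_cases i
    · exact continuous_id
    · exact continuous_const
  have hsegI : Set.uIcc c (x.1 0) ⊆ M.I := M.ordConnected_I.uIcc_subset hc x.2.1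
  have hprim : HasDerivAt (fun s => ∫ t in c..s, k t) (k (x.1 0)) (x.1 0) :=
    intervalIntegral.integral_hasDerivAt_right ((hkc.mono hsegI).intervalIntegrable)
      (hkc.stronglyMeasurableAtFilter M.isOpen_I _ x.2.1)
      (hkc.continuousAt (M.isOpen_I.mem_nhds x.2.1))
  have hline : HasDerivAt (fun s : ℝ => (![s, x.1 1] : Fin 2 → ℝ)) (Pi.single 0 1) (x.1 0) := by
    rw [hasDerivAt_pi]
    intro i
    fin_cases i
    · exact hasDerivAt_id (x.1 0)
    · exact hasDerivAt_const (x.1 0) (x.1 1)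
  have hx : (![x.1 0, x.1 1] : Fin 2 → ℝ) = x.1 := by
    ext i; fin_cases i <;> rfl
  have hcomp : HasDerivAt (fun s => F ![s, x.1 1]) (fderiv ℝ F x.1 (Pi.single 0 1)) (x.1 0) := by
    have h1 : HasFDerivAt F (fderiv ℝ F x.1) ![x.1 0, x.1 1] := by
      rw [hx]; exact hFd.hasFDerivAt
    exact h1.comp_hasDerivAt (x.1 0) hline
  rw [funext hFk] at hcomp
  rw [hcomp.unique hprim, hk]
  simp only [hx]
  exact extendZero_apply f.1 x

/-- Functions of `u²` alone are the kernel of `∂/∂u¹`. Connectedness of `I` is essential. -/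
theorem isFunOfU2_iff {f : Coeff M} : IsFunOfU2 f ↔ pderivCoeff 0 f = 0 := by
  have hline : ∀ y s : ℝ, HasDerivAt (fun s : ℝ => (![s, y] : Fin 2 → ℝ)) (Pi.single 0 1) s := by
    intro y s
    rw [hasDerivAt_pi]
    intro i
    fin_cases i
    · exact hasDerivAt_id s
    · exact hasDerivAt_const s y
  have hderiv : ∀ x : M.carrier, HasDerivAt (fun s => extendZero f.1 ![s, x.1 1])
      ((pderivCoeff 0 f).1 x) (x.1 0) := by
    intro x
    have hx : (![x.1 0, x.1 1] : Fin 2 → ℝ) = x.1 := by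
      ext i; fin_cases i <;> rfl
    have h1 : HasFDerivAt (extendZero f.1) (fderiv ℝ (extendZero f.1) x.1) ![x.1 0, x.1 1] := by
      rw [hx]; exact (differentiableAt_extendZero f x).hasFDerivAt
    exact h1.comp_hasDerivAt (x.1 0) (hline (x.1 1) (x.1 0))
  constructor
  · rintro ⟨φ, hφ⟩
    ext x
    refine (hderiv x).unique ?_
    refine (hasDerivAt_const (x.1 0) (φ (x.1 1))).congr_of_eventuallyEq ?_
    filter_upwards [M.isOpen_I.mem_nhds x.2.1] with s hs
    exact (extendZero_apply f.1 ⟨![s, x.1 1], hs, x.2.2⟩).trans (hφ _)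
  · intro h0
    classical
    refine ⟨fun y => if h : ∃ c, c ∈ M.I then extendZero f.1 ![h.choose, y] else 0, fun x => ?_⟩
    have hex : ∃ c, c ∈ M.I := ⟨_, x.2.1⟩
    simp only [hex, dif_pos]
    have hconst := M.isOpen_I.is_const_of_deriv_eq_zero M.ordConnected_I.isPreconnected
      (f := fun s => extendZero f.1 ![s, x.1 1])
      (fun s hs => ((hderiv ⟨![s, x.1 1], hs, x.2.2⟩).differentiableAt).differentiableWithinAt)
      (fun s hs => by
        have := (hderiv ⟨![s, x.1 1], hs, x.2.2⟩).deriv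
        rw [h0] at this
        exact this) x.2.1 hex.choose_spec
    rw [← hconst, ← extendZero_apply f.1 x]
    congr 1
    ext i; fin_cases i <;> rfl

end Antiderivative

/-! ### Derivations of the ring of differential polynomials -/

section JetDerivations

open MvPolynomial

variable {M : CoordBox}

theorem coeff_pderivU (i : Fin 2) (F : DiffPoly M) (m : Fin 2 × ℕ →₀ ℕ) :
    coeff m (pderivU i F) = pderivCoeff i (coeff m F) := by
  classical
  rw [pderivU, coeff_sum]
  simp only [coeff_monomial]
  rw [Finset.sum_ite_eq' F.support m]
  split_ifs with h
  · rfl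
  · rw [notMem_support_iff.1 h]
    exact (map_zero (coeffDer (M := M) i)).symm

theorem pderivU_add (i : Fin 2) (F G : DiffPoly M) :
    pderivU i (F + G) = pderivU i F + pderivU i G := by
  refine MvPolynomial.ext _ _ fun m => ?_
  simp only [coeff_pderivU, coeff_add, pderivCoeff_add]

theorem pderivU_C_mul (i : Fin 2) (f : Coeff M) (G : DiffPoly M) :
    pderivU i (C f * G) = C f * pderivU i G + G * C (pderivCoeff i f) := by
  refine MvPolynomial.ext _ _ fun m => ?_
  rw [mul_comm G]
  simp only [coeff_pderivU, coeff_add, coeff_C_mul, pderivCoeff_mul]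
  ring

theorem pderivU_mul_X (i : Fin 2) (F : DiffPoly M) (v : Fin 2 × ℕ) :
    pderivU i (F * X v) = pderivU i F * X v := by
  classical
  refine MvPolynomial.ext _ _ fun m => ?_
  simp only [coeff_pderivU, coeff_mul_X']
  split_ifs
  · rfl
  · exact map_zero (coeffDer (M := M) i)

theorem pderivU_C (i : Fin 2) (f : Coeff M) : pderivU i (C f) = C (pderivCoeff i f) := by
  classical
  refine MvPolynomial.ext _ _ fun m => ?_
  simp only [coeff_pderivU, coeff_C]
  split_ifs
  · rfl
  · exact map_zero (coeffDer (M := M) i)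

theorem pderivU_X (i : Fin 2) (v : Fin 2 × ℕ) : pderivU i (X v : DiffPoly M) = 0 := by
  have h1 : pderivCoeff i (1 : Coeff M) = 0 := (coeffDer i).map_one_eq_zero
  have := pderivU_mul_X (M := M) i (C 1) v
  rwa [pderivU_C, h1, C_1, C_0, one_mul, zero_mul] at this

theorem pderivU_mul (i : Fin 2) (F G : DiffPoly M) :
    pderivU i (F * G) = F * pderivU i G + G * pderivU i F := by
  induction F using MvPolynomial.induction_on generalizing G with
  | C a => rw [pderivU_C_mul, pderivU_C]
  | add p q hp hq => rw [add_mul, pderivU_add, hp, hq, pderivU_add]; ring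
  | mul_X p v hp =>
    rw [show p * X v * G = (p * G) * X v by ring, pderivU_mul_X, hp, pderivU_mul_X]; ring

section Module

variable {N : Type*} [AddCommGroup N] [Module (DiffPoly M) N] [Module (Coeff M) N]
  [IsScalarTower (Coeff M) (DiffPoly M) N] (w : Fin 2 → ℕ → N)

theorem jetDer_add (F G : DiffPoly M) : jetDer w (F + G) = jetDer w F + jetDer w G := by
  simp only [jetDer, pderivU_add, add_smul, Finset.sum_add_distrib, map_add]
  abel

theorem jetDer_mul (F G : DiffPoly M) :
    jetDer w (F * G) = F • jetDer w G + G • jetDer w F := by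
  simp only [jetDer, pderivU_mul, Derivation.leibniz, Fin.sum_univ_two]
  module

theorem jetDer_C (f : Coeff M) :
    jetDer w (C f) = (C (pderivCoeff 0 f) : DiffPoly M) • w 0 0 +
      (C (pderivCoeff 1 f) : DiffPoly M) • w 1 0 := by
  simp only [jetDer, pderivU_C, Fin.sum_univ_two, derivation_C, add_zero]

theorem jetDer_X (v : Fin 2 × ℕ) : jetDer w (X v : DiffPoly M) = w v.1 (v.2 + 1) := by
  simp only [jetDer, pderivU_X, zero_smul, Finset.sum_const_zero, mkDerivation_X, zero_add]

theorem jetDer_zero : jetDer w (0 : DiffPoly M) = 0 := by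
  have := jetDer_add w (0 : DiffPoly M) 0
  rw [add_zero] at this
  exact left_eq_add.1 this

theorem jetDer_neg (F : DiffPoly M) : jetDer w (-F) = -jetDer w F := by
  have := jetDer_add w F (-F)
  rw [add_neg_cancel, jetDer_zero] at this
  exact (neg_eq_of_add_eq_zero_right this.symm).symm

theorem jetDer_sub (F G : DiffPoly M) : jetDer w (F - G) = jetDer w F - jetDer w G := by
  rw [sub_eq_add_neg, jetDer_add, jetDer_neg, sub_eq_add_neg]

end Module

theorem algebraMap_eq_C (c : ℝ) : algebraMap ℝ (DiffPoly M) c = C (algebraMap ℝ (Coeff M) c) :=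
  rfl

/-- `jetDer w` as a derivation, for weights in the ring of differential polynomials itself. -/
def jetDeriv (w : Fin 2 → ℕ → DiffPoly M) : Derivation ℝ (DiffPoly M) (DiffPoly M) where
  toFun := jetDer w
  map_add' := jetDer_add w
  map_smul' c F := by
    rw [Algebra.smul_def, jetDer_mul, algebraMap_eq_C, jetDer_C, pderivCoeff_algebraMap,
      pderivCoeff_algebraMap]
    simp only [C_0, zero_mul, add_zero, mul_zero, ← algebraMap_eq_C, smul_eq_mul,
      Algebra.smul_def, RingHom.id_apply]
  map_one_eq_zero' := by
    have h : ∀ i, pderivCoeff i (1 : Coeff M) = 0 := fun i => (coeffDer i).map_one_eq_zero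
    have := jetDer_C w (1 : Coeff M)
    simp only [h, C_0, zero_smul, add_zero, C_1] at this
    exact this
  leibniz' := jetDer_mul w

/-- The total `x`-derivative as a derivation. -/
def totalDer : Derivation ℝ (DiffPoly M) (DiffPoly M) := jetDeriv fun l s => X (l, s)

/-- The action of an evolutionary vector field as a derivation. -/
def evolDer (ξ : VecField M) : Derivation ℝ (DiffPoly M) (DiffPoly M) :=
  jetDeriv fun l s => totalD^[s] (ξ l)

theorem totalDer_apply (F : DiffPoly M) : totalDer F = totalD F := rfl

theorem evolDer_apply (ξ : VecField M) (F : DiffPoly M) : evolDer ξ F = evol ξ F := rfl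

theorem totalD_add (F G : DiffPoly M) : totalD (F + G) = totalD F + totalD G := jetDer_add _ F G

theorem totalD_sub (F G : DiffPoly M) : totalD (F - G) = totalD F - totalD G := jetDer_sub _ F G

theorem totalD_neg (F : DiffPoly M) : totalD (-F) = -totalD F := jetDer_neg _ F

theorem totalD_zero : totalD (0 : DiffPoly M) = 0 := jetDer_zero _

theorem totalD_mul (F G : DiffPoly M) : totalD (F * G) = F * totalD G + G * totalD F :=
  jetDer_mul _ F G

theorem totalD_smul (c : ℝ) (F : DiffPoly M) : totalD (c • F) = c • totalD F :=
  totalDer.map_smul c F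

theorem totalD_pow (F : DiffPoly M) (n : ℕ) :
    totalD (F ^ n) = n • (F ^ (n - 1) * totalD F) := totalDer.leibniz_pow F n

theorem totalD_C (f : Coeff M) :
    totalD (C f) = C (pderivCoeff 0 f) * X (0, 0) + C (pderivCoeff 1 f) * X (1, 0) :=
  jetDer_C _ f

theorem totalD_X (v : Fin 2 × ℕ) : totalD (X v : DiffPoly M) = X (v.1, v.2 + 1) := jetDer_X _ v

theorem iterate_totalD_add (n : ℕ) (F G : DiffPoly M) :
    totalD^[n] (F + G) = totalD^[n] F + totalD^[n] G :=
  iterate_map_add (totalDer (M := M)) n F G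

theorem iterate_totalD_sub (n : ℕ) (F G : DiffPoly M) :
    totalD^[n] (F - G) = totalD^[n] F - totalD^[n] G :=
  iterate_map_sub (totalDer (M := M)) n F G

theorem iterate_totalD_zero (n : ℕ) : totalD^[n] (0 : DiffPoly M) = 0 :=
  iterate_map_zero (totalDer (M := M)) n

theorem iterate_totalD_smul (n : ℕ) (c : ℝ) (F : DiffPoly M) :
    totalD^[n] (c • F) = c • totalD^[n] F := by
  induction n generalizing F with
  | zero => rfl
  | succ n ih => rw [Function.iterate_succ_apply, totalD_smul, ih, Function.iterate_succ_apply]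

theorem iterate_totalD_X (n : ℕ) (v : Fin 2 × ℕ) :
    totalD^[n] (X v : DiffPoly M) = X (v.1, v.2 + n) := by
  induction n with
  | zero => rfl
  | succ n ih => rw [Function.iterate_succ_apply', ih, totalD_X]; rfl

theorem evol_add (ξ : VecField M) (F G : DiffPoly M) : evol ξ (F + G) = evol ξ F + evol ξ G :=
  jetDer_add _ F G

theorem evol_sub (ξ : VecField M) (F G : DiffPoly M) : evol ξ (F - G) = evol ξ F - evol ξ G :=
  jetDer_sub _ F G

theorem evol_neg (ξ : VecField M) (F : DiffPoly M) : evol ξ (-F) = -evol ξ F := jetDer_neg _ F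

theorem evol_zero (ξ : VecField M) : evol ξ (0 : DiffPoly M) = 0 := jetDer_zero _

theorem evol_mul (ξ : VecField M) (F G : DiffPoly M) :
    evol ξ (F * G) = F * evol ξ G + G * evol ξ F := jetDer_mul _ F G

theorem evol_smul (ξ : VecField M) (c : ℝ) (F : DiffPoly M) : evol ξ (c • F) = c • evol ξ F :=
  (evolDer ξ).map_smul c F

theorem evol_sum (ξ : VecField M) {ι : Type*} (s : Finset ι) (f : ι → DiffPoly M) :
    evol ξ (∑ i ∈ s, f i) = ∑ i ∈ s, evol ξ (f i) := map_sum (evolDer ξ) f s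

theorem evol_pow (ξ : VecField M) (F : DiffPoly M) (n : ℕ) :
    evol ξ (F ^ n) = n • (F ^ (n - 1) * evol ξ F) := (evolDer ξ).leibniz_pow F n

theorem evol_C (ξ : VecField M) (f : Coeff M) :
    evol ξ (C f) = C (pderivCoeff 0 f) * ξ 0 + C (pderivCoeff 1 f) * ξ 1 := jetDer_C _ f

theorem evol_X (ξ : VecField M) (v : Fin 2 × ℕ) :
    evol ξ (X v : DiffPoly M) = totalD^[v.2 + 1] (ξ v.1) := jetDer_X _ v

/-- A map on differential polynomials that satisfies the Leibniz rule is determined by its values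
on the coefficients and on the jet variables. -/
theorem eq_zero_of_leibniz {D : DiffPoly M → DiffPoly M}
    (hadd : ∀ F G, D (F + G) = D F + D G) (hmul : ∀ F G, D (F * G) = F * D G + G * D F)
    (hC : ∀ f, D (C f) = 0) (hX : ∀ v, D (X v) = 0) (F : DiffPoly M) : D F = 0 := by
  induction F using MvPolynomial.induction_on with
  | C a => exact hC a
  | add p q hp hq => rw [hadd, hp, hq, add_zero]
  | mul_X p v hp => rw [hmul, hp, hX, mul_zero, mul_zero, add_zero]

theorem evol_totalD (ξ : VecField M) (F : DiffPoly M) :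
    evol ξ (totalD F) = totalD (evol ξ F) := by
  refine sub_eq_zero.1 (eq_zero_of_leibniz (D := fun F => evol ξ (totalD F) - totalD (evol ξ F))
    ?_ ?_ ?_ ?_ F)
  · intro F G
    simp only [totalD_add, evol_add]
    ring
  · intro F G
    simp only [totalD_add, evol_add, totalD_mul, evol_mul]
    ring
  · intro f
    simp only [totalD_add, evol_add, totalD_mul, evol_mul, totalD_C, evol_C, evol_X,
      pderivCoeff_comm, Function.iterate_one, zero_add]
    ring
  · intro v
    rw [totalD_X, evol_X, evol_X, Function.iterate_succ_apply', sub_self]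

theorem evol_iterate_totalD (ξ : VecField M) (n : ℕ) (F : DiffPoly M) :
    evol ξ (totalD^[n] F) = totalD^[n] (evol ξ F) := by
  induction n with
  | zero => rfl
  | succ n ih =>
    rw [Function.iterate_succ_apply', evol_totalD, ih, Function.iterate_succ_apply']

/-- The commutator of evolutionary vector fields. -/
def vbracket (ξ η : VecField M) : VecField M := fun i => evol ξ (η i) - evol η (ξ i)

theorem evol_vbracket (ξ η : VecField M) (F : DiffPoly M) :
    evol (vbracket ξ η) F = evol ξ (evol η F) - evol η (evol ξ F) := by
  refine sub_eq_zero.1 (eq_zero_of_leibniz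
    (D := fun F => evol (vbracket ξ η) F - (evol ξ (evol η F) - evol η (evol ξ F))) ?_ ?_ ?_ ?_ F)
  · intro F G
    simp only [evol_add]
    ring
  · intro F G
    simp only [evol_add, evol_mul]
    ring
  · intro f
    simp only [evol_add, evol_mul, evol_C, pderivCoeff_comm, vbracket]
    ring
  · intro v
    simp only [evol_X, evol_iterate_totalD, vbracket, iterate_totalD_sub, sub_self]

theorem evol_add_left (ξ η : VecField M) (F : DiffPoly M) :
    evol (ξ + η) F = evol ξ F + evol η F := by
  refine sub_eq_zero.1 (eq_zero_of_leibniz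
    (D := fun F => evol (ξ + η) F - (evol ξ F + evol η F)) ?_ ?_ ?_ ?_ F)
  · intro F G
    simp only [evol_add]
    ring
  · intro F G
    simp only [evol_mul]
    ring
  · intro f
    simp only [evol_C, Pi.add_apply]
    ring
  · intro v
    simp only [evol_X, Pi.add_apply, iterate_totalD_add, sub_self]

theorem evol_smul_left (c : ℝ) (ξ : VecField M) (F : DiffPoly M) :
    evol (c • ξ) F = c • evol ξ F := by
  refine sub_eq_zero.1 (eq_zero_of_leibniz (D := fun F => evol (c • ξ) F - c • evol ξ F)
    ?_ ?_ ?_ ?_ F)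
  · intro F G
    simp only [evol_add, smul_add]
    ring
  · intro F G
    simp only [evol_mul, smul_add, ← mul_smul_comm]
    ring
  · intro f
    simp only [evol_C, Pi.smul_apply, smul_add, mul_smul_comm, sub_self]
  · intro v
    simp only [evol_X, Pi.smul_apply, iterate_totalD_smul, sub_self]

end JetDerivations

/-! ### Differential operators acting on differential polynomials -/

section Operators

open Polynomial

variable {M : CoordBox}

/-- The action `b ↦ ∑ aₘ ∂ᵐ b` of a differential operator on differential polynomials. -/
def opAct (p : DiffOp M) (b : DiffPoly M) : DiffPoly M := p.sum fun m a => a * totalD^[m] b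

theorem opAct_add (p q : DiffOp M) (b : DiffPoly M) :
    opAct (p + q) b = opAct p b + opAct q b :=
  Polynomial.sum_add_index p q _ (fun _ => zero_mul _) fun _ _ _ => add_mul _ _ _

theorem opAct_monomial (m : ℕ) (a b : DiffPoly M) :
    opAct (monomial m a) b = a * totalD^[m] b :=
  Polynomial.sum_monomial_index _ _ (zero_mul _)

theorem opAct_zero (b : DiffPoly M) : opAct (0 : DiffOp M) b = 0 := Polynomial.sum_zero_index _

theorem opAct_C (a b : DiffPoly M) : opAct (C a) b = a * b := opAct_monomial 0 a b

theorem opAct_C_mul (a : DiffPoly M) (p : DiffOp M) (b : DiffPoly M) :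
    opAct (C a * p) b = a * opAct p b := by
  induction p using Polynomial.induction_on' with
  | add p q hp hq => rw [mul_add, opAct_add, hp, hq, opAct_add, mul_add]
  | monomial n c => rw [C_mul_monomial, opAct_monomial, opAct_monomial, mul_assoc]

theorem opAct_neg (p : DiffOp M) (b : DiffPoly M) : opAct (-p) b = -opAct p b := by
  have := opAct_add p (-p) b
  rw [add_neg_cancel, opAct_zero] at this
  exact (neg_eq_of_add_eq_zero_right this.symm).symm

theorem opAct_sub (p q : DiffOp M) (b : DiffPoly M) :
    opAct (p - q) b = opAct p b - opAct q b := by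
  rw [sub_eq_add_neg, opAct_add, opAct_neg, sub_eq_add_neg]

theorem opAct_sum {ι : Type*} (s : Finset ι) (f : ι → DiffOp M) (b : DiffPoly M) :
    opAct (∑ i ∈ s, f i) b = ∑ i ∈ s, opAct (f i) b := by
  classical
  induction s using Finset.induction_on with
  | empty => simp only [Finset.sum_empty, opAct_zero]
  | insert i s hi ih => rw [Finset.sum_insert hi, Finset.sum_insert hi, opAct_add, ih]

theorem opAct_smul (c : ℝ) (p : DiffOp M) (b : DiffPoly M) :
    opAct (c • p) b = c • opAct p b := by
  induction p using Polynomial.induction_on' with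
  | add p q hp hq => rw [smul_add, opAct_add, hp, hq, opAct_add, smul_add]
  | monomial n a => rw [smul_monomial, opAct_monomial, opAct_monomial, smul_mul_assoc]

theorem opAct_X_mul (p : DiffOp M) (b : DiffPoly M) : opAct (X * p) b = opAct p (totalD b) := by
  induction p using Polynomial.induction_on' with
  | add p q hp hq => rw [mul_add, opAct_add, hp, hq, opAct_add]
  | monomial n c =>
    rw [X_mul_monomial, opAct_monomial, opAct_monomial, Function.iterate_succ_apply]

theorem opAct_X (b : DiffPoly M) : opAct (X : DiffOp M) b = totalD b := by
  have := opAct_X_mul (C 1) b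
  rwa [C_1, mul_one, ← C_1, opAct_C, one_mul] at this

theorem opAct_X_pow (n : ℕ) (b : DiffPoly M) :
    opAct (X ^ n : DiffOp M) b = totalD^[n] b := by
  rw [X_pow_eq_monomial, opAct_monomial, one_mul]

theorem opAct_add_right (p : DiffOp M) (b c : DiffPoly M) :
    opAct p (b + c) = opAct p b + opAct p c := by
  induction p using Polynomial.induction_on' with
  | add p q hp hq => rw [opAct_add, hp, hq, opAct_add, opAct_add]; abel
  | monomial n a =>
    rw [opAct_monomial, opAct_monomial, opAct_monomial, iterate_totalD_add, mul_add]

theorem opAct_zero_right (p : DiffOp M) : opAct p 0 = 0 := by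
  have := opAct_add_right p 0 0
  rw [add_zero] at this
  exact left_eq_add.1 this

theorem opAct_sum_right {ι : Type*} (p : DiffOp M) (s : Finset ι) (f : ι → DiffPoly M) :
    opAct p (∑ i ∈ s, f i) = ∑ i ∈ s, opAct p (f i) := by
  classical
  induction s using Finset.induction_on with
  | empty => simp only [Finset.sum_empty, opAct_zero_right]
  | insert i s hi ih => rw [Finset.sum_insert hi, Finset.sum_insert hi, opAct_add_right, ih]

theorem dxOp_add (p q : DiffOp M) : dxOp (p + q) = dxOp p + dxOp q := by
  rw [dxOp, Polynomial.sum_add_index p q _ (fun _ => by rw [totalD_zero, map_zero])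
    fun _ _ _ => by rw [totalD_add, map_add], dxOp, dxOp]
  ring

theorem dxOp_monomial (n : ℕ) (a : DiffPoly M) :
    dxOp (monomial n a) = monomial n (totalD a) + monomial (n + 1) a := by
  rw [dxOp, Polynomial.sum_monomial_index _ _ (by rw [totalD_zero, map_zero]), X_mul_monomial]

theorem opAct_dxOp (p : DiffOp M) (b : DiffPoly M) : opAct (dxOp p) b = totalD (opAct p b) := by
  induction p using Polynomial.induction_on' with
  | add p q hp hq => rw [dxOp_add, opAct_add, hp, hq, opAct_add, totalD_add]
  | monomial n a =>
    rw [dxOp_monomial, opAct_add, opAct_monomial, opAct_monomial, opAct_monomial, totalD_mul,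
      Function.iterate_succ_apply']
    ring

theorem opAct_iterate_dxOp (n : ℕ) (p : DiffOp M) (b : DiffPoly M) :
    opAct (dxOp^[n] p) b = totalD^[n] (opAct p b) := by
  induction n with
  | zero => rfl
  | succ n ih =>
    rw [Function.iterate_succ_apply', opAct_dxOp, ih, Function.iterate_succ_apply']

theorem opAct_compOp (p q : DiffOp M) (b : DiffPoly M) :
    opAct (compOp p q) b = opAct p (opAct q b) := by
  rw [compOp, Polynomial.sum_def, opAct_sum, opAct, Polynomial.sum_def]
  exact Finset.sum_congr rfl fun m _ => by rw [opAct_C_mul, opAct_iterate_dxOp]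

/-- The action of the formal adjoint of a differential operator. -/
def adjAct (p : DiffOp M) (b : DiffPoly M) : DiffPoly M := opAct (adjOp p) b

theorem adjAct_eq_sum (p : DiffOp M) (b : DiffPoly M) :
    adjAct p b = p.sum fun m a => (-1) ^ m * totalD^[m] (a * b) := by
  rw [adjAct, adjOp, Polynomial.sum_def, opAct_sum, Polynomial.sum_def]
  refine Finset.sum_congr rfl fun m _ => ?_
  rw [show ((-1 : DiffOp M) ^ m) = C ((-1) ^ m) by rw [C_pow, C_neg, C_1], opAct_C_mul,
    opAct_iterate_dxOp, opAct_C]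

theorem adjAct_add (p q : DiffOp M) (b : DiffPoly M) :
    adjAct (p + q) b = adjAct p b + adjAct q b := by
  simp only [adjAct_eq_sum]
  exact Polynomial.sum_add_index p q _
    (fun _ => by rw [zero_mul, iterate_totalD_zero, mul_zero])
    fun _ _ _ => by rw [add_mul, iterate_totalD_add, mul_add]

theorem adjAct_monomial (m : ℕ) (a b : DiffPoly M) :
    adjAct (monomial m a) b = (-1) ^ m * totalD^[m] (a * b) := by
  rw [adjAct_eq_sum]
  exact Polynomial.sum_monomial_index _ _ (by rw [zero_mul, iterate_totalD_zero, mul_zero])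

theorem adjAct_zero (b : DiffPoly M) : adjAct (0 : DiffOp M) b = 0 := by
  rw [adjAct_eq_sum]; exact Polynomial.sum_zero_index _

theorem adjAct_neg (p : DiffOp M) (b : DiffPoly M) : adjAct (-p) b = -adjAct p b := by
  have := adjAct_add p (-p) b
  rw [add_neg_cancel, adjAct_zero] at this
  exact (neg_eq_of_add_eq_zero_right this.symm).symm

theorem adjAct_C_mul (a : DiffPoly M) (p : DiffOp M) (b : DiffPoly M) :
    adjAct (C a * p) b = adjAct p (a * b) := by
  induction p using Polynomial.induction_on' with
  | add p q hp hq => rw [mul_add, adjAct_add, hp, hq, adjAct_add]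
  | monomial n c =>
    rw [C_mul_monomial, adjAct_monomial, adjAct_monomial]
    congr 2
    ring

theorem adjAct_X_pow (m : ℕ) (b : DiffPoly M) :
    adjAct (X ^ m : DiffOp M) b = (-1) ^ m * totalD^[m] b := by
  rw [X_pow_eq_monomial, adjAct_monomial, one_mul]

theorem adjAct_C (a b : DiffPoly M) : adjAct (C a) b = a * b := by
  have := adjAct_monomial 0 a b
  rw [pow_zero, one_mul] at this
  exact this

theorem adjAct_add_right (p : DiffOp M) (b c : DiffPoly M) :
    adjAct p (b + c) = adjAct p b + adjAct p c := opAct_add_right _ b c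

theorem adjAct_zero_right (p : DiffOp M) : adjAct p 0 = 0 := opAct_zero_right _

/-! ### Local functionals -/

/-- The space of local functionals: differential polynomials modulo total `x`-derivatives. -/
abbrev LocalFun (M : CoordBox) : Type :=
  DiffPoly M ⧸ LinearMap.range (totalDer (M := M)).toLinearMap

/-- The local functional `∫ f dx`. -/
def intg : DiffPoly M →ₗ[ℝ] LocalFun M :=
  Submodule.mkQ (LinearMap.range (totalDer (M := M)).toLinearMap)

theorem intg_eq_zero_iff {f : DiffPoly M} : intg f = 0 ↔ ∃ h, totalD h = f := by
  rw [intg, Submodule.mkQ_apply, Submodule.Quotient.mk_eq_zero]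
  rfl

theorem intg_totalD (f : DiffPoly M) : intg (totalD f) = 0 := intg_eq_zero_iff.2 ⟨f, rfl⟩

theorem intg_totalD_mul (f g : DiffPoly M) : intg (totalD f * g) = -intg (f * totalD g) := by
  have := intg_totalD (f * g)
  rw [totalD_mul, map_add] at this
  rw [mul_comm (totalD f), eq_neg_iff_add_eq_zero, add_comm]
  exact this

theorem intg_iterate_totalD_mul (n : ℕ) (f g : DiffPoly M) :
    intg (totalD^[n] f * g) = intg (f * ((-1) ^ n * totalD^[n] g)) := by
  induction n generalizing g with
  | zero => simp
  | succ n ih =>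
    rw [Function.iterate_succ_apply', intg_totalD_mul, ih, ← Function.iterate_succ_apply,
      ← map_neg]
    congr 1
    ring

theorem intg_adjAct_mul (p : DiffOp M) (b c : DiffPoly M) :
    intg (adjAct p b * c) = intg (b * opAct p c) := by
  induction p using Polynomial.induction_on' with
  | add p q hp hq => rw [adjAct_add, opAct_add, add_mul, mul_add, map_add, map_add, hp, hq]
  | monomial n a =>
    rw [adjAct_monomial, opAct_monomial,
      show (-1) ^ n * totalD^[n] (a * b) * c = totalD^[n] (a * b) * ((-1) ^ n * c) by ring,
      intg_iterate_totalD_mul]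
    have h : totalD^[n] ((-1 : DiffPoly M) ^ n * c) = (-1) ^ n * totalD^[n] c := by
      rcases neg_one_pow_eq_or (DiffPoly M) n with h | h
      · rw [h, one_mul, one_mul]
      · rw [h, neg_one_mul, neg_one_mul]
        exact iterate_map_neg (totalDer (M := M)) n c
    rw [h, ← mul_assoc ((-1) ^ n), ← mul_pow, neg_one_mul, neg_neg, one_pow, one_mul]
    congr 1
    ring

/-- The operator on local functionals induced by an evolutionary vector field. -/
def evolInt (ξ : VecField M) : LocalFun M →ₗ[ℝ] LocalFun M :=
  Submodule.mapQ _ _ (evolDer ξ).toLinearMap (by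
    rintro _ ⟨h, rfl⟩
    exact ⟨evol ξ h, (evol_totalD ξ h).symm⟩)

theorem evolInt_intg (ξ : VecField M) (f : DiffPoly M) :
    evolInt ξ (intg f) = intg (evol ξ f) := rfl

theorem evolInt_vbracket (ξ η : VecField M) (F : LocalFun M) :
    evolInt (vbracket ξ η) F = evolInt ξ (evolInt η F) - evolInt η (evolInt ξ F) := by
  obtain ⟨f, rfl⟩ := Submodule.mkQ_surjective _ F
  change evolInt _ (intg f) = evolInt ξ (evolInt η (intg f)) - evolInt η (evolInt ξ (intg f))
  simp only [evolInt_intg, evol_vbracket, map_sub]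

end Operators

/-! ### Test functions -/

section TestFunctions

open MvPolynomial

variable {M : CoordBox}

/-- Beyond some order a differential polynomial does not depend on the jet variables. -/
theorem exists_forall_pderiv_eq_zero (F : DiffPoly M) :
    ∃ K : ℕ, ∀ (i : Fin 2) (k : ℕ), K ≤ k → pderiv (i, k) F = 0 := by
  classical
  refine ⟨F.vars.sup Prod.snd + 1, fun i k hk => pderiv_eq_zero_of_notMem_vars fun h => ?_⟩
  have := Finset.le_sup (f := Prod.snd) h
  simp only at this
  omega

theorem pderiv_totalD (i : Fin 2) (k : ℕ) (F : DiffPoly M) :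
    pderiv (i, k + 1) (totalD F) = totalD (pderiv (i, k + 1) F) + pderiv (i, k) F := by
  classical
  refine sub_eq_zero.1 (eq_zero_of_leibniz (D := fun F => pderiv (i, k + 1) (totalD F) -
    (totalD (pderiv (i, k + 1) F) + pderiv (i, k) F)) ?_ ?_ ?_ ?_ F)
  · intro F G
    simp only [totalD_add, map_add]
    ring
  · intro F G
    simp only [totalD_add, map_add, totalD_mul, Derivation.leibniz, smul_eq_mul]
    ring
  · intro f
    simp [totalD_C, totalD_zero, pderiv_X]
  · rintro ⟨j, l⟩
    rw [totalD_X, pderiv_X, pderiv_X, pderiv_X]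
    have h1 : totalD (1 : DiffPoly M) = 0 := totalDer.map_one_eq_zero
    by_cases h : (j, l) = (i, k + 1)
    · simp only [Prod.mk.injEq] at h
      obtain ⟨rfl, rfl⟩ := h
      simp [h1]
    · by_cases h' : (j, l) = (i, k)
      · simp only [Prod.mk.injEq] at h'
        obtain ⟨rfl, rfl⟩ := h'
        simp [totalD_zero]
      · have h3 : ((j, l + 1) : Fin 2 × ℕ) ≠ (i, k + 1) := by
          simp only [Prod.mk.injEq, ne_eq, Nat.add_right_cancel_iff] at h' ⊢
          exact h'
        rw [Pi.single_eq_of_ne h3, Pi.single_eq_of_ne h, Pi.single_eq_of_ne h', totalD_zero,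
          add_zero, sub_self]

theorem pderiv_pderiv_swap (v v' : Fin 2 × ℕ) (F : DiffPoly M) :
    pderiv v (pderiv v' F) = pderiv v' (pderiv v F) := by
  classical
  refine sub_eq_zero.1 (eq_zero_of_leibniz
    (D := fun F => pderiv v (pderiv v' F) - pderiv v' (pderiv v F)) ?_ ?_ ?_ ?_ F)
  · intro F G
    simp only [map_add]
    ring
  · intro F G
    simp only [map_add, Derivation.leibniz, smul_eq_mul]
    ring
  · intro f
    simp
  · intro u
    simp only [pderiv_X, Pi.single_apply]
    split_ifs <;> simp

/-- The pairing `∫ f a` is nondegenerate. If `f (u¹₍ₖ₎)²` with `k` large were a total derivative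
`∂g`, then `∂g` would be linear in the highest jet variable occurring in it, so that `f = 0`. -/
theorem eq_zero_of_forall_intg_mul {f : DiffPoly M} (h : ∀ a, intg (f * a) = 0) : f = 0 := by
  classical
  obtain ⟨K, hK⟩ := exists_forall_pderiv_eq_zero f
  obtain ⟨g, hg⟩ := intg_eq_zero_iff.1 (h (X (0, K + 1) ^ 2))
  obtain ⟨L, hL⟩ := exists_forall_pderiv_eq_zero g
  have hg0 : ∀ n k : ℕ, L ≤ k + n → K + 1 ≤ k → pderiv (0, k) g = 0 := by
    intro n
    induction n with
    | zero => intro k hk _; exact hL 0 k hk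
    | succ n ih =>
      intro k hk hk'
      have h1 := pderiv_totalD (0 : Fin 2) k g
      rw [ih (k + 1) (by omega) (by omega), totalD_zero, zero_add, hg] at h1
      rw [← h1, Derivation.leibniz, Derivation.leibniz_pow, hK 0 (k + 1) (by omega), pderiv_X]
      have : k ≠ K := by omega
      simp [this.symm]
  have h1 := pderiv_totalD (0 : Fin 2) K g
  have h2 := hg0 L (K + 1) (by omega) le_rfl
  rw [h2, totalD_zero, zero_add, hg, Derivation.leibniz, Derivation.leibniz_pow,
    hK 0 (K + 1) (by omega), pderiv_X_self] at h1
  have h3 := congrArg (pderiv ((0 : Fin 2), K + 1)) h1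
  have h4 : pderiv ((0 : Fin 2), K + 1) (pderiv ((0 : Fin 2), K) g) = 0 := by
    rw [pderiv_pderiv_swap, h2, map_zero]
  rw [h4] at h3
  simp only [add_zero, Nat.add_one_sub_one, pow_one, smul_eq_mul, mul_one,
    Derivation.leibniz, map_nsmul, pderiv_X_self, hK 0 (K + 1) (by omega), mul_zero] at h3
  have h5 : (2 : ℝ) • f = 0 := by
    rw [← h3, two_smul]
    ring
  exact (smul_eq_zero.1 h5).resolve_left two_ne_zero

end TestFunctions

section Faithful

variable {M : CoordBox}

open MvPolynomial in
/-- An operator is determined by its action: on `u¹₍ₖ₎` with `k` large, the coefficients of the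
operator are read off as the derivatives with respect to the variables `u¹₍ₖ₊ₘ₎`. -/
theorem opAct_injective {p q : DiffOp M} (h : ∀ b, opAct p b = opAct q b) : p = q := by
  classical
  refine sub_eq_zero.1 ?_
  have h' : ∀ b, opAct (p - q) b = 0 := fun b => by rw [opAct_sub, h, sub_self]
  generalize p - q = r at h'
  choose K hK using fun F : DiffPoly M => exists_forall_pderiv_eq_zero F
  set L := r.support.sup fun m => K (r.coeff m) with hL
  ext1 n
  rw [Polynomial.coeff_zero]
  by_cases hn : n ∈ r.support
  · have h1 := congrArg (pderiv ((0 : Fin 2), L + n)) (h' (X (0, L)))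
    rw [opAct, Polynomial.sum_def, map_sum, map_zero, Finset.sum_eq_single n] at h1
    · rw [iterate_totalD_X, Derivation.leibniz, pderiv_X_self,
        hK (r.coeff n) 0 (L + n) ((Finset.le_sup (f := fun m => K (r.coeff m)) hn).trans
          (Nat.le_add_right _ _))] at h1
      simpa using h1
    · intro m hm hmn
      rw [iterate_totalD_X, Derivation.leibniz, pderiv_X_of_ne (by simpa using hmn),
        hK (r.coeff m) 0 (L + n) ((Finset.le_sup (f := fun m => K (r.coeff m)) hm).trans
          (Nat.le_add_right _ _))]
      simp
    · exact fun h => absurd hn h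
  · exact Polynomial.notMem_support_iff.1 hn

end Faithful

/-! ### Trivectors as bidifferential operators -/

section Trivectors

open MvPolynomial

variable {M : CoordBox}

theorem sum_support_add {σ R A : Type*} [CommSemiring R] [AddCommMonoid A]
    (g : (σ →₀ ℕ) → R → A) (h0 : ∀ d, g d 0 = 0)
    (hadd : ∀ d a b, g d (a + b) = g d a + g d b) (p q : MvPolynomial σ R) :
    ∑ d ∈ (p + q).support, g d (coeff d (p + q)) =
      ∑ d ∈ p.support, g d (coeff d p) + ∑ d ∈ q.support, g d (coeff d q) := by
  classical
  have key : ∀ (r : MvPolynomial σ R) (s : Finset (σ →₀ ℕ)), r.support ⊆ s →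
      ∑ d ∈ r.support, g d (coeff d r) = ∑ d ∈ s, g d (coeff d r) := fun r s hs =>
    Finset.sum_subset hs fun d _ hd => by rw [notMem_support_iff.1 hd, h0]
  rw [key (p + q) _ support_add, key p _ Finset.subset_union_left,
    key q _ Finset.subset_union_right, ← Finset.sum_add_distrib]
  exact Finset.sum_congr rfl fun d _ => by rw [coeff_add, hadd]

theorem sum_support_monomial {σ R A : Type*} [CommSemiring R] [AddCommMonoid A]
    (g : (σ →₀ ℕ) → R → A) (h0 : ∀ d, g d 0 = 0) (d : σ →₀ ℕ) (a : R) :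
    ∑ e ∈ (monomial d a).support, g e (coeff e (monomial d a)) = g d a := by
  classical
  rw [Finset.sum_subset (support_monomial_subset (s := d) (a := a))
    fun e _ he => by rw [notMem_support_iff.1 he, h0], Finset.sum_singleton, coeff_monomial,
    if_pos rfl]

/-- The bidifferential operator `(b, c) ↦ ∑ f ∂ᵐ b ∂ⁿ c` defined by a trivector component
`∑ f λᵐ μⁿ`. -/
def triAct (T : TriDist M) (b c : DiffPoly M) : DiffPoly M :=
  ∑ d ∈ T.support, T.coeff d * totalD^[d 0] b * totalD^[d 1] c

theorem triAct_add (S T : TriDist M) (b c : DiffPoly M) :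
    triAct (S + T) b c = triAct S b c + triAct T b c :=
  sum_support_add (fun d a => a * totalD^[d 0] b * totalD^[d 1] c)
    (fun _ => by simp only [zero_mul]) (fun _ _ _ => by simp only [add_mul]) S T

theorem triAct_monomial (d : Fin 2 →₀ ℕ) (a b c : DiffPoly M) :
    triAct (monomial d a) b c = a * totalD^[d 0] b * totalD^[d 1] c :=
  sum_support_monomial (fun d a => a * totalD^[d 0] b * totalD^[d 1] c)
    (fun _ => by simp only [zero_mul]) d a

theorem triAct_zero (b c : DiffPoly M) : triAct (0 : TriDist M) b c = 0 := by
  simp [triAct]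

theorem triAct_sum {ι : Type*} (s : Finset ι) (f : ι → TriDist M) (b c : DiffPoly M) :
    triAct (∑ i ∈ s, f i) b c = ∑ i ∈ s, triAct (f i) b c := by
  classical
  induction s using Finset.induction_on with
  | empty => simp only [Finset.sum_empty, triAct_zero]
  | insert i s hi ih => rw [Finset.sum_insert hi, Finset.sum_insert hi, triAct_add, ih]

theorem triAct_X_mul (i : Fin 2) (T : TriDist M) (b c : DiffPoly M) :
    triAct (X i * T) b c =
      if i = 0 then triAct T (totalD b) c else triAct T b (totalD c) := by
  induction T using MvPolynomial.induction_on' with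
  | add p q hp hq =>
    rw [mul_add, triAct_add, hp, hq]
    split_ifs <;> rw [triAct_add]
  | monomial d a =>
    rw [X, monomial_mul, one_mul, triAct_monomial, triAct_monomial, triAct_monomial]
    fin_cases i
    · simp [add_comm 1]
    · simp [add_comm 1]

theorem triAct_X_zero_pow_mul (n : ℕ) (T : TriDist M) (b c : DiffPoly M) :
    triAct (X 0 ^ n * T) b c = triAct T (totalD^[n] b) c := by
  induction n generalizing b with
  | zero => rw [pow_zero, one_mul]; rfl
  | succ n ih =>
    rw [pow_succ', mul_assoc, triAct_X_mul, if_pos rfl, ih, Function.iterate_succ_apply]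

theorem triAct_neg_one_pow_mul (n : ℕ) (T : TriDist M) (b c : DiffPoly M) :
    triAct ((-1) ^ n * T) b c = (-1) ^ n * triAct T b c := by
  have hneg : triAct (-T) b c = -triAct T b c := by
    have := triAct_add T (-T) b c
    rw [add_neg_cancel, triAct_zero] at this
    exact (neg_eq_of_add_eq_zero_right this.symm).symm
  rcases Nat.even_or_odd n with h | h
  · rw [h.neg_one_pow (α := TriDist M), h.neg_one_pow (α := DiffPoly M), one_mul, one_mul]
  · rw [h.neg_one_pow (α := TriDist M), h.neg_one_pow (α := DiffPoly M), neg_one_mul,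
      neg_one_mul, hneg]

theorem dxTri_add (S T : TriDist M) : dxTri (S + T) = dxTri S + dxTri T := by
  rw [dxTri, sum_support_add (fun d a => monomial d (totalD a))
    (fun _ => by rw [totalD_zero, map_zero]) (fun _ _ _ => by rw [totalD_add, map_add]), dxTri,
    dxTri]
  ring

theorem dxTri_monomial (d : Fin 2 →₀ ℕ) (a : DiffPoly M) :
    dxTri (monomial d a) = monomial d (totalD a) + (X 0 + X 1) * monomial d a := by
  rw [dxTri, sum_support_monomial (fun d a => monomial d (totalD a))
    (fun _ => by rw [totalD_zero, map_zero])]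

theorem triAct_dxTri (T : TriDist M) (b c : DiffPoly M) :
    triAct (dxTri T) b c = totalD (triAct T b c) := by
  induction T using MvPolynomial.induction_on' with
  | add p q hp hq => rw [dxTri_add, triAct_add, hp, hq, triAct_add, totalD_add]
  | monomial d a =>
    rw [dxTri_monomial, triAct_add, add_mul, triAct_add, triAct_X_mul, triAct_X_mul, if_pos rfl,
      if_neg one_ne_zero, triAct_monomial, triAct_monomial, triAct_monomial, triAct_monomial,
      totalD_mul, totalD_mul, ← Function.iterate_succ_apply, ← Function.iterate_succ_apply,
      Function.iterate_succ_apply', Function.iterate_succ_apply']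
    ring

theorem triAct_iterate_dxTri (n : ℕ) (T : TriDist M) (b c : DiffPoly M) :
    triAct (dxTri^[n] T) b c = totalD^[n] (triAct T b c) := by
  induction n with
  | zero => rfl
  | succ n ih =>
    rw [Function.iterate_succ_apply', triAct_dxTri, ih, Function.iterate_succ_apply']

theorem intg_mul_iterate_totalD (n : ℕ) (f g : DiffPoly M) :
    intg (f * ((-1) ^ n * totalD^[n] g)) = intg (totalD^[n] f * g) :=
  (intg_iterate_totalD_mul n f g).symm

theorem iterate_dxTri_zero (n : ℕ) : dxTri^[n] (0 : TriDist M) = 0 := by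
  induction n with
  | zero => rfl
  | succ n ih =>
    have h : dxTri (0 : TriDist M) = 0 := by
      have := dxTri_add (0 : TriDist M) 0
      rw [add_zero] at this
      exact left_eq_add.1 this
    rw [Function.iterate_succ_apply, h, ih]

theorem iterate_dxTri_add (n : ℕ) (S T : TriDist M) :
    dxTri^[n] (S + T) = dxTri^[n] S + dxTri^[n] T := by
  induction n generalizing S T with
  | zero => rfl
  | succ n ih =>
    rw [Function.iterate_succ_apply, Function.iterate_succ_apply, Function.iterate_succ_apply,
      dxTri_add, ih]

theorem triAct_C_mul_X_pow (i : Fin 2) (a : DiffPoly M) (n : ℕ) (b c : DiffPoly M) :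
    triAct (C a * X i ^ n) b c =
      if i = 0 then a * totalD^[n] b * c else a * b * totalD^[n] c := by
  rw [C_mul_X_pow_eq_monomial, triAct_monomial]
  fin_cases i <;> simp

/-- Moving the base point from `z` to `x` is a cyclic shift of the trilinear pairing. -/
theorem intg_mul_triAct_fromZ (T : TriDist M) (a b c : DiffPoly M) :
    intg (a * triAct (fromZ T) b c) = intg (triAct T a b * c) := by
  have hadd : ∀ S T : TriDist M, fromZ (S + T) = fromZ S + fromZ T := fun S T =>
    sum_support_add (fun d f => (-1) ^ (d 0) * dxTri^[d 0] (C f * X 0 ^ (d 1)))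
      (fun _ => by rw [C_0, zero_mul, iterate_dxTri_zero, mul_zero])
      (fun _ _ _ => by rw [C_add, add_mul, iterate_dxTri_add, mul_add]) S T
  induction T using MvPolynomial.induction_on' with
  | add p q hp hq =>
    rw [hadd, triAct_add, triAct_add, mul_add, add_mul, map_add, map_add, hp, hq]
  | monomial d f =>
    have h : fromZ (monomial d f) = (-1) ^ (d 0) * dxTri^[d 0] (C f * X 0 ^ (d 1)) :=
      sum_support_monomial (fun d f => (-1) ^ (d 0) * dxTri^[d 0] (C f * X 0 ^ (d 1)))
        (fun _ => by rw [C_0, zero_mul, iterate_dxTri_zero, mul_zero]) d f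
    rw [h, triAct_neg_one_pow_mul, triAct_iterate_dxTri, triAct_C_mul_X_pow, if_pos rfl,
      intg_mul_iterate_totalD, triAct_monomial]
    congr 1
    ring

/-- Moving the base point from `y` to `x` is a cyclic shift of the trilinear pairing. -/
theorem intg_mul_triAct_fromY (T : TriDist M) (a b c : DiffPoly M) :
    intg (a * triAct (fromY T) b c) = intg (triAct T c a * b) := by
  have hadd : ∀ S T : TriDist M, fromY (S + T) = fromY S + fromY T := fun S T =>
    sum_support_add (fun d f => (-1) ^ (d 1) * dxTri^[d 1] (C f * X 1 ^ (d 0)))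
      (fun _ => by rw [C_0, zero_mul, iterate_dxTri_zero, mul_zero])
      (fun _ _ _ => by rw [C_add, add_mul, iterate_dxTri_add, mul_add]) S T
  induction T using MvPolynomial.induction_on' with
  | add p q hp hq =>
    rw [hadd, triAct_add, triAct_add, mul_add, add_mul, map_add, map_add, hp, hq]
  | monomial d f =>
    have h : fromY (monomial d f) = (-1) ^ (d 1) * dxTri^[d 1] (C f * X 1 ^ (d 0)) :=
      sum_support_monomial (fun d f => (-1) ^ (d 1) * dxTri^[d 1] (C f * X 1 ^ (d 0)))
        (fun _ => by rw [C_0, zero_mul, iterate_dxTri_zero, mul_zero]) d f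
    rw [h, triAct_neg_one_pow_mul, triAct_iterate_dxTri, triAct_C_mul_X_pow, if_neg one_ne_zero,
      intg_mul_iterate_totalD, triAct_monomial]
    congr 1
    ring

/-- A trivector component is determined by its action: on `u¹₍ₖ₎` and `u²₍ₖ₎` with `k` large, its
coefficients are read off as mixed derivatives. -/
theorem eq_zero_of_triAct {T : TriDist M} (h : ∀ b c, triAct T b c = 0) : T = 0 := by
  classical
  choose K hK using fun F : DiffPoly M => exists_forall_pderiv_eq_zero F
  set L := T.support.sup fun d => K (T.coeff d) with hL
  refine MvPolynomial.ext _ _ fun d => ?_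
  rw [coeff_zero]
  by_cases hd : d ∈ T.support
  · have hKL : ∀ e ∈ T.support, ∀ (i : Fin 2) n, pderiv (i, L + n) (T.coeff e) = 0 := by
      intro e he i n
      exact hK _ i _ ((Finset.le_sup (f := fun e => K (T.coeff e)) he).trans
        (Nat.le_add_right _ _))
    have h1 := congrArg (fun F => pderiv ((0 : Fin 2), L + d 0) (pderiv ((1 : Fin 2), L + d 1) F))
      (h (X (0, L)) (X (1, L)))
    simp only [triAct, map_sum, map_zero, iterate_totalD_X] at h1
    rw [Finset.sum_eq_single d] at h1
    · simpa [Derivation.leibniz, hKL d hd, pderiv_X] using h1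
    · intro e he hed
      by_cases h0 : e 0 = d 0
      · have h2 : e 1 ≠ d 1 := fun h2 => hed (by ext i; fin_cases i <;> assumption)
        simp [Derivation.leibniz, hKL e he, pderiv_X, h2]
      · simp only [Derivation.leibniz, hKL e he, pderiv_X, Pi.single_apply, Prod.mk.injEq,
          smul_zero, add_zero]
        split_ifs <;> simp_all [Derivation.leibniz, pderiv_X]
    · exact fun h => absurd hd h
  · exact notMem_support_iff.1 hd

end Trivectors

/-! ### Bivectors as operators, and their Lie derivatives -/

section Bivectors

variable {M : CoordBox}

/-- The pairing of a covector and a vector field, before integration. -/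
def dotp (a b : Fin 2 → DiffPoly M) : DiffPoly M := ∑ i, a i * b i

theorem dotp_comm (a b : Fin 2 → DiffPoly M) : dotp a b = dotp b a :=
  Finset.sum_congr rfl fun _ _ => mul_comm _ _

theorem dotp_sub (a b c : Fin 2 → DiffPoly M) : dotp a (b - c) = dotp a b - dotp a c := by
  simp only [dotp, Pi.sub_apply, mul_sub, Finset.sum_sub_distrib]

/-- The action of a matrix differential operator. -/
def matAct (P : MatOp M) (b : Fin 2 → DiffPoly M) : Fin 2 → DiffPoly M :=
  fun i => ∑ j, opAct (P i j) (b j)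

/-- The action of the operator obtained by differentiating the coefficients of `p` along `η`. -/
def opDer (η : VecField M) (p : DiffOp M) (b : DiffPoly M) : DiffPoly M :=
  p.sum fun m a => evol η a * totalD^[m] b

theorem opDer_add (η : VecField M) (p q : DiffOp M) (b : DiffPoly M) :
    opDer η (p + q) b = opDer η p b + opDer η q b :=
  Polynomial.sum_add_index p q _ (fun _ => by rw [evol_zero, zero_mul])
    fun _ _ _ => by rw [evol_add, add_mul]

theorem opDer_monomial (η : VecField M) (m : ℕ) (a b : DiffPoly M) :
    opDer η (Polynomial.monomial m a) b = evol η a * totalD^[m] b :=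
  Polynomial.sum_monomial_index _ _ (by rw [evol_zero, zero_mul])

theorem opDer_eq (η : VecField M) (p : DiffOp M) (b : DiffPoly M) :
    opDer η p b = evol η (opAct p b) - opAct p (evol η b) := by
  induction p using Polynomial.induction_on' with
  | add p q hp hq => rw [opDer_add, hp, hq, opAct_add, opAct_add, evol_add]; abel
  | monomial n a =>
    rw [opDer_monomial, opAct_monomial, opAct_monomial, evol_mul, evol_iterate_totalD]
    ring

theorem opAct_sum_monomial_evol (η : VecField M) (p : DiffOp M) (b : DiffPoly M) :
    opAct (p.sum fun m a => Polynomial.monomial m (evol η a)) b = opDer η p b := by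
  rw [Polynomial.sum_def, opAct_sum, opDer, Polynomial.sum_def]
  exact Finset.sum_congr rfl fun m _ => opAct_monomial _ _ _

theorem sum_opAct_frechet (F : DiffPoly M) (η : VecField M) :
    ∑ k, opAct (frechet F k) (η k) = evol η F := by
  refine sub_eq_zero.1 (eq_zero_of_leibniz
    (D := fun F => ∑ k, opAct (frechet F k) (η k) - evol η F) ?_ ?_ ?_ ?_ F)
  · intro F G
    simp only [frechet, jetDer_add, opAct_add, evol_add, Finset.sum_add_distrib]
    ring
  · intro F G
    simp only [frechet, jetDer_mul, opAct_add, evol_mul, Finset.sum_add_distrib,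
      Polynomial.smul_eq_C_mul, opAct_C_mul, ← Finset.mul_sum]
    ring
  · intro f
    simp [frechet, jetDer_C, evol_C, opAct_add, Polynomial.smul_eq_C_mul,
      Fin.sum_univ_two, opAct_C, opAct_zero]
  · rintro ⟨j, n⟩
    simp only [frechet, jetDer_X, evol_X]
    rw [Finset.sum_eq_single j (fun k _ hk => by rw [if_neg hk.symm, opAct_zero])
      (fun h => absurd (Finset.mem_univ j) h), if_pos rfl, opAct_X_pow, sub_self]

/-- The Lie derivative `L_ξ b = ξ(b) + (D_ξ)* b` of a covector along an evolutionary vector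
field. -/
def covLie (ξ : VecField M) (b : Fin 2 → DiffPoly M) : Fin 2 → DiffPoly M :=
  fun k => evol ξ (b k) + ∑ j, adjAct (frechet (ξ j) k) (b j)

theorem intg_dotp_covLie (ξ : VecField M) (b η : Fin 2 → DiffPoly M) :
    intg (dotp (covLie ξ b) η) =
      evolInt ξ (intg (dotp b η)) - intg (dotp b (vbracket ξ η)) := by
  have h : intg (∑ k, (∑ j, adjAct (frechet (ξ j) k) (b j)) * η k) =
      intg (∑ j, b j * evol η (ξ j)) := by
    simp only [Finset.sum_mul, map_sum, intg_adjAct_mul]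
    rw [Finset.sum_comm]
    refine Finset.sum_congr rfl fun j _ => ?_
    rw [← map_sum, ← Finset.mul_sum, sum_opAct_frechet]
  rw [evolInt_intg, ← map_sub]
  have e1 : dotp (covLie ξ b) η = ∑ k, evol ξ (b k) * η k +
      ∑ k, (∑ j, adjAct (frechet (ξ j) k) (b j)) * η k := by
    rw [← Finset.sum_add_distrib]
    exact Finset.sum_congr rfl fun k _ => add_mul _ _ _
  rw [e1, map_add, h, ← map_add]
  refine congrArg intg ?_
  simp only [dotp, vbracket, Fin.sum_univ_two, evol_add, evol_mul]
  ring

theorem matAct_lieDer (ξ : VecField M) (P : MatOp M) (b : Fin 2 → DiffPoly M) :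
    matAct (lieDer ξ P) b = vbracket ξ (matAct P b) - matAct P (covLie ξ b) := by
  funext i
  have hD : evol (matAct P b) (ξ i) =
      ∑ k, ∑ j, opAct (frechet (ξ i) k) (opAct (P k j) (b j)) := by
    simp only [← sum_opAct_frechet (ξ i) (matAct P b), matAct, opAct_sum_right]
  rw [Pi.sub_apply, vbracket, hD]
  simp only [matAct, lieDer, opAct_sub, opAct_sum_monomial_evol, opDer_eq, opAct_sum,
    opAct_compOp, covLie, opAct_add_right, opAct_sum_right, adjAct,
    Finset.sum_sub_distrib, Finset.sum_add_distrib, evol_sum]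
  rw [Finset.sum_comm (f := fun x k => opAct (frechet (ξ i) k) (opAct (P k x) (b x))),
    Finset.sum_comm (f := fun x k => opAct (P i k) (opAct (adjOp (frechet (ξ x) k)) (b x)))]
  abel

theorem isSkew_iff {P : MatOp M} :
    IsSkew P ↔ ∀ a b, intg (dotp a (matAct P b)) = -intg (dotp b (matAct P a)) := by
  have key : ∀ (i j : Fin 2) (a b : DiffPoly M),
      intg (a * opAct (P i j) b) = intg (b * adjAct (P i j) a) := fun i j a b => by
    rw [← intg_adjAct_mul, mul_comm]
  constructor
  · intro h a b
    simp only [dotp, matAct, Finset.mul_sum, map_sum]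
    rw [Finset.sum_comm, ← Finset.sum_neg_distrib]
    refine Finset.sum_congr rfl fun j _ => ?_
    rw [← Finset.sum_neg_distrib]
    refine Finset.sum_congr rfl fun i _ => ?_
    rw [key, adjAct, h j i, opAct_neg, mul_neg, map_neg]
  · intro h i j
    refine opAct_injective fun a => ?_
    refine sub_eq_zero.1 (eq_zero_of_forall_intg_mul fun b => ?_)
    have := h (Pi.single j a) (Pi.single i b)
    simp only [dotp, matAct, Pi.single_apply, ite_mul, zero_mul, Finset.sum_ite_eq',
      Finset.mem_univ, if_true] at this
    rw [Finset.sum_eq_single i (fun k _ hk => by rw [if_neg hk, opAct_zero_right])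
      (fun h => absurd (Finset.mem_univ i) h), if_pos rfl,
      Finset.sum_eq_single j (fun k _ hk => by rw [if_neg hk, opAct_zero_right])
      (fun h => absurd (Finset.mem_univ j) h), if_pos rfl, key, adjAct] at this
    rw [opAct_neg, sub_neg_eq_add, add_mul, map_add, mul_comm, this, mul_comm, neg_add_cancel]

theorem IsSkew.lieDer {P : MatOp M} (h : IsSkew P) (ξ : VecField M) : IsSkew (lieDer ξ P) := by
  rw [isSkew_iff] at h ⊢
  have key : ∀ a b, intg (dotp a (matAct (DegPoisson.lieDer ξ P) b)) =
      evolInt ξ (intg (dotp a (matAct P b))) - intg (dotp (covLie ξ a) (matAct P b))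
        - intg (dotp a (matAct P (covLie ξ b))) := by
    intro a b
    rw [intg_dotp_covLie, matAct_lieDer]
    rw [dotp_sub, map_sub]
    abel
  intro a b
  rw [key, key, h a b, h (covLie ξ a) b, h a (covLie ξ b), map_neg]
  abel

end Bivectors

/-! ### The Schouten bracket as a trilinear form -/

section Schouten

open MvPolynomial

variable {M : CoordBox}

/-- `∫ a · P_*[Q c] b`, where `P_*[η]` is the derivative of `P` along `η`. -/
def schoutenForm (P Q : MatOp M) (a b c : Fin 2 → DiffPoly M) : LocalFun M :=
  intg (∑ i, a i * ∑ j, opDer (matAct Q c) (P i j) (b j))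

/-- The trilinear form of the Schouten bracket. -/
def jacobiForm (P Q : MatOp M) (a b c : Fin 2 → DiffPoly M) : LocalFun M :=
  schoutenForm P Q a b c + schoutenForm Q P a b c + schoutenForm P Q b c a
    + schoutenForm Q P b c a + schoutenForm P Q c a b + schoutenForm Q P c a b

theorem triAct_aeval (p : DiffOp M) (b c : DiffPoly M) :
    triAct (Polynomial.aeval (X 1 : TriDist M) p) b c = b * opAct p c := by
  induction p using Polynomial.induction_on' with
  | add p q hp hq => rw [map_add, triAct_add, hp, hq, opAct_add, mul_add]
  | monomial n a =>
    rw [Polynomial.aeval_monomial, algebraMap_eq, triAct_C_mul_X_pow, if_neg one_ne_zero,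
      opAct_monomial]
    ring

theorem opAct_jetDer_dxOp (Q : Fin 2 → DiffOp M) (F c : DiffPoly M) :
    opAct (jetDer (fun l s => dxOp^[s] (Q l)) F) c = evol (fun l => opAct (Q l) c) F := by
  refine sub_eq_zero.1 (eq_zero_of_leibniz (D := fun F =>
    opAct (jetDer (fun l s => dxOp^[s] (Q l)) F) c - evol (fun l => opAct (Q l) c) F)
    ?_ ?_ ?_ ?_ F)
  · intro F G
    simp only [jetDer_add, opAct_add, evol_add]
    ring
  · intro F G
    simp only [jetDer_mul, opAct_add, evol_mul, Polynomial.smul_eq_C_mul, opAct_C_mul]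
    ring
  · intro f
    simp [jetDer_C, evol_C, opAct_add, Polynomial.smul_eq_C_mul, opAct_C_mul]
  · intro v
    rw [jetDer_X, evol_X, opAct_iterate_dxOp, sub_self]

theorem triAct_schoutenTerm (P Q : MatOp M) (i j k : Fin 2) (b c : DiffPoly M) :
    triAct (schoutenTerm P Q i j k) b c = opDer (fun l => opAct (Q l k) c) (P i j) b := by
  rw [schoutenTerm, Polynomial.sum_def, triAct_sum, opDer, Polynomial.sum_def]
  refine Finset.sum_congr rfl fun m _ => ?_
  rw [triAct_X_zero_pow_mul, triAct_aeval, opAct_jetDer_dxOp, mul_comm]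

theorem intg_mul_triAct_schouten (P Q : MatOp M) (i j k : Fin 2) (a b c : DiffPoly M) :
    intg (a * triAct (schouten P Q i j k) b c) =
      jacobiForm P Q (Pi.single i a) (Pi.single j b) (Pi.single k c) := by
  have key : ∀ (P Q : MatOp M) (i j k : Fin 2) (a b c : DiffPoly M),
      schoutenForm P Q (Pi.single i a) (Pi.single j b) (Pi.single k c) =
        intg (a * opDer (fun l => opAct (Q l k) c) (P i j) b) := by
    intro P Q i j k a b c
    have h0 : ∀ η (p : DiffOp M), opDer η p 0 = 0 := fun η p => by
      rw [opDer_eq, evol_zero, opAct_zero_right, evol_zero, sub_zero]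
    have h1 : matAct Q (Pi.single k c) = fun l => opAct (Q l k) c := by
      funext l
      rw [matAct, Finset.sum_eq_single k (fun m _ hm => by
        rw [Pi.single_eq_of_ne hm, opAct_zero_right])
        (fun h => absurd (Finset.mem_univ k) h), Pi.single_eq_same]
    rw [schoutenForm, h1, Finset.sum_eq_single i (fun m _ hm => by
        rw [Pi.single_eq_of_ne hm, zero_mul])
        (fun h => absurd (Finset.mem_univ i) h), Pi.single_eq_same,
        Finset.sum_eq_single j (fun m _ hm => by rw [Pi.single_eq_of_ne hm, h0])
        (fun h => absurd (Finset.mem_univ j) h), Pi.single_eq_same]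
  simp only [schouten, triAct_add, mul_add, map_add, intg_mul_triAct_fromZ,
    intg_mul_triAct_fromY, triAct_schoutenTerm, jacobiForm, key]
  simp only [mul_comm _ c, mul_comm _ b]
  abel

/-- For skew-adjoint `P` and `Q` the trilinear form of the Schouten bracket is a sum of
expressions built from Lie derivatives only. -/
theorem jacobiForm_eq {P Q : MatOp M} (hP : IsSkew P) (hQ : IsSkew Q)
    (a b c : Fin 2 → DiffPoly M) :
    jacobiForm P Q a b c = -(intg (dotp (covLie (matAct P a) b) (matAct Q c))
      + intg (dotp (covLie (matAct Q a) b) (matAct P c))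
      + intg (dotp (covLie (matAct P b) c) (matAct Q a))
      + intg (dotp (covLie (matAct Q b) c) (matAct P a))
      + intg (dotp (covLie (matAct P c) a) (matAct Q b))
      + intg (dotp (covLie (matAct Q c) a) (matAct P b))) := by
  rw [isSkew_iff] at hP hQ
  -- `x` and `y` are the two parts of `schoutenForm P Q a b c`
  have hx : ∀ {P Q : MatOp M}, (∀ a b, intg (dotp a (matAct P b)) = -intg (dotp b (matAct P a))) →
      ∀ a b c, schoutenForm P Q a b c =
      intg (dotp a fun i => evol (matAct Q c) (matAct P b i)) +
        intg (dotp (matAct P a) fun i => evol (matAct Q c) (b i)) := by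
    intro P Q h a b c
    have h1 : ∑ i, a i * ∑ j, opDer (matAct Q c) (P i j) (b j) =
        dotp a (fun i => evol (matAct Q c) (matAct P b i)) -
          dotp a (matAct P fun j => evol (matAct Q c) (b j)) := by
      simp only [opDer_eq, dotp, matAct, evol_sum, Finset.sum_sub_distrib, mul_sub]
    rw [schoutenForm, h1, map_sub, h, sub_neg_eq_add, dotp_comm (matAct P a)]
  -- the Leibniz rule for the pairing
  have hL : ∀ a η ζ : Fin 2 → DiffPoly M, evolInt ζ (intg (dotp a η)) =
      intg (dotp a fun i => evol ζ (η i)) + intg (dotp η fun i => evol ζ (a i)) := by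
    intro a η ζ
    rw [evolInt_intg, ← map_add]
    refine congrArg intg ?_
    simp only [dotp, evol_sum, evol_mul, Finset.sum_add_distrib]
  have hB : ∀ a η ζ : Fin 2 → DiffPoly M, intg (dotp a (vbracket η ζ)) =
      intg (dotp a fun i => evol η (ζ i)) - intg (dotp a fun i => evol ζ (η i)) := by
    intro a η ζ
    rw [← map_sub]
    refine congrArg intg ?_
    simp only [dotp, vbracket, mul_sub, Finset.sum_sub_distrib]
  have hE : ∀ (ζ : VecField M) (a b : Fin 2 → DiffPoly M),
      evolInt ζ (intg (dotp a (matAct P b))) = -evolInt ζ (intg (dotp b (matAct P a))) := by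
    intro ζ a b; rw [hP, map_neg]
  have hE' : ∀ (ζ : VecField M) (a b : Fin 2 → DiffPoly M),
      evolInt ζ (intg (dotp a (matAct Q b))) = -evolInt ζ (intg (dotp b (matAct Q a))) := by
    intro ζ a b; rw [hQ, map_neg]
  have e1 := hE (matAct Q c) a b
  have e2 := hE (matAct Q a) b c
  have e3 := hE (matAct Q b) c a
  have e4 := hE' (matAct P c) a b
  have e5 := hE' (matAct P a) b c
  have e6 := hE' (matAct P b) c a
  simp only [hL] at e1 e2 e3 e4 e5 e6
  simp only [jacobiForm, intg_dotp_covLie, hx hP, hx hQ, hL, hB]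
  linear_combination (norm := module) e1 + e2 + e3 + e4 + e5 + e6

theorem evol_sub_left (ξ η : VecField M) (F : DiffPoly M) :
    evol (ξ - η) F = evol ξ F - evol η F := by
  have := evol_add_left (ξ - η) η F
  rw [sub_add_cancel] at this
  exact eq_sub_of_add_eq this.symm

theorem evolInt_sub_left (ξ η : VecField M) (F : LocalFun M) :
    evolInt (ξ - η) F = evolInt ξ F - evolInt η F := by
  obtain ⟨f, rfl⟩ := Submodule.mkQ_surjective _ F
  change evolInt _ (intg f) = evolInt ξ (intg f) - evolInt η (intg f)
  rw [evolInt_intg, evolInt_intg, evolInt_intg, evol_sub_left, map_sub]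

theorem vbracket_sub_left (ξ η ζ : VecField M) :
    vbracket (ξ - η) ζ = vbracket ξ ζ - vbracket η ζ := by
  funext i
  simp only [vbracket, Pi.sub_apply, evol_sub_left, evol_sub]
  abel

theorem vbracket_apply (ξ η : VecField M) (i : Fin 2) :
    vbracket ξ η i = evol ξ (η i) - evol η (ξ i) := rfl

theorem vbracket_jacobi (ξ η ζ : VecField M) :
    vbracket ξ (vbracket η ζ) = vbracket (vbracket ξ η) ζ + vbracket η (vbracket ξ ζ) := by
  funext i
  simp only [vbracket_apply, Pi.add_apply, evol_vbracket, evol_sub]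
  abel

/-- Infinitesimal invariance of `∫ ⟨L_{P a} b, Q c⟩` under evolutionary vector fields. -/
theorem evolInt_intg_covLie (ξ : VecField M) (P Q : MatOp M) (a b c : Fin 2 → DiffPoly M) :
    evolInt ξ (intg (dotp (covLie (matAct P a) b) (matAct Q c))) =
      intg (dotp (covLie (matAct (lieDer ξ P) a) b) (matAct Q c))
      + intg (dotp (covLie (matAct P a) b) (matAct (lieDer ξ Q) c))
      + intg (dotp (covLie (matAct P (covLie ξ a)) b) (matAct Q c))
      + intg (dotp (covLie (matAct P a) (covLie ξ b)) (matAct Q c))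
      + intg (dotp (covLie (matAct P a) b) (matAct Q (covLie ξ c))) := by
  simp only [intg_dotp_covLie, matAct_lieDer, evolInt_sub_left, vbracket_sub_left,
    dotp_sub, map_sub, evolInt_vbracket]
  have h : intg (dotp b (vbracket ξ (vbracket (matAct P a) (matAct Q c)))) =
      intg (dotp b (vbracket (vbracket ξ (matAct P a)) (matAct Q c))) +
      intg (dotp b (vbracket (matAct P a) (vbracket ξ (matAct Q c)))) := by
    rw [vbracket_jacobi, ← map_add]
    refine congrArg intg ?_
    simp only [dotp, Pi.add_apply, mul_add, Finset.sum_add_distrib]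
  linear_combination (norm := module) -h

/-- If the Schouten bracket of `P` and `Q` vanishes, so does its Lie derivative. -/
theorem jacobiForm_lieDer_add {P Q : MatOp M} (hP : IsSkew P) (hQ : IsSkew Q)
    (h : ∀ a b c, jacobiForm P Q a b c = 0) (ξ : VecField M) (a b c : Fin 2 → DiffPoly M) :
    jacobiForm (lieDer ξ P) Q a b c + jacobiForm P (lieDer ξ Q) a b c = 0 := by
  have h0 := congrArg (evolInt ξ) (h a b c)
  have h1 := h (covLie ξ a) b c
  have h2 := h a (covLie ξ b) c
  have h3 := h a b (covLie ξ c)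
  rw [jacobiForm_eq hP hQ] at h0 h1 h2 h3
  simp only [map_neg, map_add, map_zero, evolInt_intg_covLie] at h0
  rw [jacobiForm_eq (hP.lieDer ξ) hQ, jacobiForm_eq hP (hQ.lieDer ξ)]
  linear_combination (norm := module) h0 - h1 - h2 - h3

end Schouten

/-! ### Components of the Schouten bracket -/

section Components

variable {M : CoordBox}

theorem matAct_single (P : MatOp M) (k : Fin 2) (c : DiffPoly M) :
    matAct P (Pi.single k c) = fun l => opAct (P l k) c := by
  funext l
  rw [matAct, Finset.sum_eq_single k (fun m _ hm => by
    rw [Pi.single_eq_of_ne hm, opAct_zero_right])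
    (fun h => absurd (Finset.mem_univ k) h), Pi.single_eq_same]

theorem matAct_add_right (P : MatOp M) (b c : Fin 2 → DiffPoly M) :
    matAct P (b + c) = matAct P b + matAct P c := by
  funext i
  simp only [matAct, Pi.add_apply, opAct_add_right, Finset.sum_add_distrib]

theorem opDer_add_right (η : VecField M) (p : DiffOp M) (b c : DiffPoly M) :
    opDer η p (b + c) = opDer η p b + opDer η p c := by
  simp only [opDer_eq, opAct_add_right, evol_add]
  abel

theorem opDer_zero_right (η : VecField M) (p : DiffOp M) : opDer η p 0 = 0 := by
  rw [opDer_eq, evol_zero, opAct_zero_right, evol_zero, sub_zero]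

theorem opDer_add_left (η ζ : VecField M) (p : DiffOp M) (b : DiffPoly M) :
    opDer (η + ζ) p b = opDer η p b + opDer ζ p b := by
  simp only [opDer_eq, opAct_add_right, evol_add_left]
  abel

theorem schoutenForm_add₁ (P Q : MatOp M) (a a' b c : Fin 2 → DiffPoly M) :
    schoutenForm P Q (a + a') b c = schoutenForm P Q a b c + schoutenForm P Q a' b c := by
  rw [schoutenForm, schoutenForm, schoutenForm, ← map_add]
  simp only [Pi.add_apply, add_mul, Finset.sum_add_distrib]

theorem schoutenForm_add₂ (P Q : MatOp M) (a b b' c : Fin 2 → DiffPoly M) :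
    schoutenForm P Q a (b + b') c = schoutenForm P Q a b c + schoutenForm P Q a b' c := by
  rw [schoutenForm, schoutenForm, schoutenForm, ← map_add]
  simp only [Pi.add_apply, opDer_add_right, mul_add, Finset.sum_add_distrib]

theorem schoutenForm_add₃ (P Q : MatOp M) (a b c c' : Fin 2 → DiffPoly M) :
    schoutenForm P Q a b (c + c') = schoutenForm P Q a b c + schoutenForm P Q a b c' := by
  rw [schoutenForm, schoutenForm, schoutenForm, ← map_add]
  simp only [matAct_add_right, opDer_add_left, mul_add, Finset.sum_add_distrib]

theorem jacobiForm_cyclic (P Q : MatOp M) (a b c : Fin 2 → DiffPoly M) :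
    jacobiForm P Q b c a = jacobiForm P Q a b c := by
  simp only [jacobiForm]
  abel

theorem jacobiForm_add₁ (P Q : MatOp M) (a a' b c : Fin 2 → DiffPoly M) :
    jacobiForm P Q (a + a') b c = jacobiForm P Q a b c + jacobiForm P Q a' b c := by
  simp only [jacobiForm, schoutenForm_add₁, schoutenForm_add₂, schoutenForm_add₃]
  abel

theorem jacobiForm_add₂ (P Q : MatOp M) (a b b' c : Fin 2 → DiffPoly M) :
    jacobiForm P Q a (b + b') c = jacobiForm P Q a b c + jacobiForm P Q a b' c := by
  rw [← jacobiForm_cyclic P Q a (b + b') c, jacobiForm_add₁, jacobiForm_cyclic P Q a b c,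
    jacobiForm_cyclic P Q a b' c]

theorem jacobiForm_add₃ (P Q : MatOp M) (a b c c' : Fin 2 → DiffPoly M) :
    jacobiForm P Q a b (c + c') = jacobiForm P Q a b c + jacobiForm P Q a b c' := by
  rw [← jacobiForm_cyclic P Q a b (c + c'), jacobiForm_add₂, jacobiForm_cyclic P Q a b c,
    jacobiForm_cyclic P Q a b c']

theorem eq_single_add_single (a : Fin 2 → DiffPoly M) :
    a = Pi.single 0 (a 0) + Pi.single 1 (a 1) := by
  funext i
  fin_cases i <;> simp

/-- The trilinear form of a bracket is determined by its components. -/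
theorem jacobiForm_eq_sum (P Q : MatOp M) (a b c : Fin 2 → DiffPoly M) :
    jacobiForm P Q a b c = ∑ i, ∑ j, ∑ k,
      jacobiForm P Q (Pi.single i (a i)) (Pi.single j (b j)) (Pi.single k (c k)) := by
  conv_lhs => rw [eq_single_add_single a, eq_single_add_single b, eq_single_add_single c]
  simp only [jacobiForm_add₁, jacobiForm_add₂, jacobiForm_add₃, Fin.sum_univ_two]
  abel

/-- A sum of Schouten brackets vanishes if and only if its trilinear form vanishes. -/
theorem sum_schouten_eq_zero_iff {ι : Type*} (s : Finset ι) (P Q : ι → MatOp M) :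
    (∀ i j k, ∑ n ∈ s, schouten (P n) (Q n) i j k = 0) ↔
      ∀ a b c, ∑ n ∈ s, jacobiForm (P n) (Q n) a b c = 0 := by
  have key : ∀ i j k a b c, intg (a * triAct (∑ n ∈ s, schouten (P n) (Q n) i j k) b c) =
      ∑ n ∈ s, jacobiForm (P n) (Q n) (Pi.single i a) (Pi.single j b) (Pi.single k c) := by
    intro i j k a b c
    simp only [triAct_sum, Finset.mul_sum, map_sum, intg_mul_triAct_schouten]
  constructor
  · intro h a b c
    have h' : ∀ i j k a b c, ∑ n ∈ s,
        jacobiForm (P n) (Q n) (Pi.single i a) (Pi.single j b) (Pi.single k c) = 0 := by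
      intro i j k a b c
      rw [← key, h, triAct_zero, mul_zero, map_zero]
    simp only [jacobiForm_eq_sum _ _ a b c, Fin.sum_univ_two, Finset.sum_add_distrib, h',
      add_zero]
  · intro h i j k
    refine eq_zero_of_triAct fun b c => eq_zero_of_forall_intg_mul fun a => ?_
    rw [mul_comm, key, h]

/-- The covector `∑ₘ (∂aₘ/∂u)* (b ∂ᵐ c)`, the variational derivative of `∫ b p c` at fixed
`b` and `c`, for the operator `p = ∑ aₘ ∂ᵐ`. -/
def varDer (p : DiffOp M) (l : Fin 2) (b c : DiffPoly M) : DiffPoly M :=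
  p.sum fun m a => adjAct (frechet a l) (b * totalD^[m] c)

theorem frechet_zero (l : Fin 2) : frechet (0 : DiffPoly M) l = 0 := jetDer_zero _

theorem frechet_add (F G : DiffPoly M) (l : Fin 2) :
    frechet (F + G) l = frechet F l + frechet G l := jetDer_add _ F G

theorem varDer_add (p q : DiffOp M) (l : Fin 2) (b c : DiffPoly M) :
    varDer (p + q) l b c = varDer p l b c + varDer q l b c :=
  Polynomial.sum_add_index p q _ (fun _ => by rw [frechet_zero, adjAct_zero])
    fun _ _ _ => by rw [frechet_add, adjAct_add]

theorem varDer_monomial (m : ℕ) (a : DiffPoly M) (l : Fin 2) (b c : DiffPoly M) :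
    varDer (Polynomial.monomial m a) l b c = adjAct (frechet a l) (b * totalD^[m] c) :=
  Polynomial.sum_monomial_index _ _ (by rw [frechet_zero, adjAct_zero])

theorem intg_mul_opDer (η : VecField M) (p : DiffOp M) (b c : DiffPoly M) :
    intg (b * opDer η p c) = ∑ l, intg (varDer p l b c * η l) := by
  induction p using Polynomial.induction_on' with
  | add p q hp hq =>
    simp only [opDer_add, mul_add, map_add, hp, hq, varDer_add, add_mul, Finset.sum_add_distrib]
  | monomial n a =>
    simp only [opDer_monomial, varDer_monomial, intg_adjAct_mul]
    rw [← map_sum, ← Finset.mul_sum, sum_opAct_frechet]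
    refine congrArg intg ?_
    ring

theorem IsSkew.intg_mul_opAct {P : MatOp M} (h : IsSkew P) (i j : Fin 2) (a b : DiffPoly M) :
    intg (a * opAct (P i j) b) = -intg (b * opAct (P j i) a) := by
  rw [← intg_adjAct_mul, adjAct, h j i, opAct_neg, neg_mul, map_neg, mul_comm]

theorem IsSkew.intg_mul_opDer {P : MatOp M} (h : IsSkew P) (η : VecField M) (i j : Fin 2)
    (a b : DiffPoly M) :
    intg (a * opDer η (P i j) b) = -intg (b * opDer η (P j i) a) := by
  have e : ∀ (p : DiffOp M) (a b : DiffPoly M), intg (a * opDer η p b) =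
      evolInt η (intg (a * opAct p b)) - intg (evol η a * opAct p b)
        - intg (a * opAct p (evol η b)) := by
    intro p a b
    rw [evolInt_intg, ← map_sub, ← map_sub, opDer_eq, evol_mul]
    refine congrArg intg ?_
    ring
  rw [e, e, h.intg_mul_opAct i j a b, h.intg_mul_opAct i j _ b, h.intg_mul_opAct i j a, map_neg]
  abel

/-- The `(i, j, k)` component of the Schouten bracket of skew-adjoint operators, normalized by
removing all derivatives from the test function attached to `i`: half of the terms. -/
def bracketTerm (P Q : MatOp M) (i j k : Fin 2) (b c : DiffPoly M) : DiffPoly M :=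
  opDer (fun l => opAct (Q l k) c) (P i j) b - opDer (fun l => opAct (Q l j) b) (P i k) c
    - (opAct (Q i 0) (varDer (P j k) 0 b c) + opAct (Q i 1) (varDer (P j k) 1 b c))

theorem schoutenForm_single (P Q : MatOp M) (i j k : Fin 2) (a b c : DiffPoly M) :
    schoutenForm P Q (Pi.single i a) (Pi.single j b) (Pi.single k c) =
      intg (a * opDer (fun l => opAct (Q l k) c) (P i j) b) := by
  rw [schoutenForm, matAct_single]
  refine congrArg intg ?_
  rw [Finset.sum_eq_single i (fun m _ hm => by rw [Pi.single_eq_of_ne hm, zero_mul])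
    (fun h => absurd (Finset.mem_univ i) h), Pi.single_eq_same,
    Finset.sum_eq_single j (fun m _ hm => by rw [Pi.single_eq_of_ne hm, opDer_zero_right])
    (fun h => absurd (Finset.mem_univ j) h), Pi.single_eq_same]

/-- On arguments with one component each the bracket is the local functional of `a` times a
bidifferential operator in `b` and `c`, all derivatives having been moved off `a` by parts. -/
theorem jacobiForm_single {P Q : MatOp M} (hP : IsSkew P) (hQ : IsSkew Q) (i j k : Fin 2)
    (a b c : DiffPoly M) :
    jacobiForm P Q (Pi.single i a) (Pi.single j b) (Pi.single k c) =
      intg (a * (bracketTerm P Q i j k b c + bracketTerm Q P i j k b c)) := by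
  have key : ∀ {P Q : MatOp M}, IsSkew P → IsSkew Q →
      intg (a * bracketTerm P Q i j k b c) =
      schoutenForm P Q (Pi.single i a) (Pi.single j b) (Pi.single k c) +
      schoutenForm P Q (Pi.single j b) (Pi.single k c) (Pi.single i a) +
      schoutenForm P Q (Pi.single k c) (Pi.single i a) (Pi.single j b) := by
    intro P Q hP hQ
    rw [schoutenForm_single, schoutenForm_single, schoutenForm_single, intg_mul_opDer _ (P j k),
      hP.intg_mul_opDer _ k i, bracketTerm, Fin.sum_univ_two, mul_sub, mul_sub, mul_add, map_sub,
      map_sub, map_add, hQ.intg_mul_opAct i 0, hQ.intg_mul_opAct i 1]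
    abel
  rw [mul_add, map_add, key hP hQ, key hQ hP, jacobiForm]
  abel

end Components

/-! ### Rules for explicit calculations -/

section Rules

open MvPolynomial

variable {M : CoordBox}

/-- The adjoint of the linearization of `F` with respect to `uˡ`, applied to `h`. -/
def adjLin (l : Fin 2) (F h : DiffPoly M) : DiffPoly M := adjAct (frechet F l) h

theorem adjLin_add (l : Fin 2) (F G h : DiffPoly M) :
    adjLin l (F + G) h = adjLin l F h + adjLin l G h := by
  rw [adjLin, frechet_add, adjAct_add]; rfl

theorem adjLin_neg (l : Fin 2) (F h : DiffPoly M) : adjLin l (-F) h = -adjLin l F h := by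
  rw [adjLin, frechet, jetDer_neg, adjAct_neg]; rfl

theorem adjLin_sub (l : Fin 2) (F G h : DiffPoly M) :
    adjLin l (F - G) h = adjLin l F h - adjLin l G h := by
  rw [sub_eq_add_neg, adjLin_add, adjLin_neg, sub_eq_add_neg]

theorem adjLin_mul (l : Fin 2) (F G h : DiffPoly M) :
    adjLin l (F * G) h = adjLin l G (F * h) + adjLin l F (G * h) := by
  rw [adjLin, frechet, jetDer_mul, adjAct_add, Polynomial.smul_eq_C_mul, adjAct_C_mul,
    Polynomial.smul_eq_C_mul, adjAct_C_mul]
  rfl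

theorem adjLin_C (l : Fin 2) (f : Coeff M) (h : DiffPoly M) :
    adjLin l (C f) h = C (pderivCoeff l f) * h := by
  rw [adjLin, frechet, jetDer_C]
  fin_cases l <;> simp [Polynomial.smul_eq_C_mul, adjAct_C]

theorem adjLin_X_self (l : Fin 2) (k : ℕ) (h : DiffPoly M) :
    adjLin l (X (l, k)) h = (-1) ^ (k + 1) * totalD^[k + 1] h := by
  rw [adjLin, frechet, jetDer_X, if_pos rfl, adjAct_X_pow]

theorem adjLin_zero_X_one (k : ℕ) (h : DiffPoly M) : adjLin 0 (X (1, k)) h = 0 := by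
  rw [adjLin, frechet, jetDer_X, if_neg one_ne_zero, adjAct_zero]

theorem adjLin_one_X_zero (k : ℕ) (h : DiffPoly M) : adjLin 1 (X (0, k)) h = 0 := by
  rw [adjLin, frechet, jetDer_X, if_neg zero_ne_one, adjAct_zero]

theorem adjLin_zero (l : Fin 2) (h : DiffPoly M) : adjLin l 0 h = 0 := by
  rw [adjLin, frechet_zero, adjAct_zero]

theorem adjLin_one_eq_zero (l : Fin 2) (h : DiffPoly M) : adjLin l 1 h = 0 := by
  rw [← C_1, adjLin_C, ← coeffDer_apply, Derivation.map_one_eq_zero, C_0, zero_mul]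

theorem adjLin_natCast (l : Fin 2) (n : ℕ) (h : DiffPoly M) : adjLin l (n : DiffPoly M) h = 0 := by
  induction n with
  | zero => rw [Nat.cast_zero, adjLin_zero]
  | succ n ih => rw [Nat.cast_succ, adjLin_add, ih, adjLin_one_eq_zero, add_zero]

theorem adjLin_pow (l : Fin 2) (F h : DiffPoly M) (n : ℕ) :
    adjLin l (F ^ n) h = adjLin l F (n * F ^ (n - 1) * h) := by
  induction n generalizing h with
  | zero =>
    rw [pow_zero, adjLin_one_eq_zero, Nat.cast_zero, zero_mul, zero_mul, adjLin,
      adjAct_zero_right]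
  | succ n ih =>
    rw [pow_succ, adjLin_mul, ih, adjLin, adjLin, adjLin, ← adjAct_add_right,
      Nat.add_sub_cancel]
    refine congrArg (adjAct _) ?_
    rcases n with _ | n
    · simp
    · rw [Nat.add_sub_cancel, pow_succ]
      push_cast
      ring

theorem varDer_C_mul_X_pow (a : DiffPoly M) (m : ℕ) (l : Fin 2) (b c : DiffPoly M) :
    varDer (Polynomial.C a * Polynomial.X ^ m) l b c = adjLin l a (b * totalD^[m] c) := by
  rw [Polynomial.C_mul_X_pow_eq_monomial, varDer_monomial]; rfl

theorem varDer_C_mul_X (a : DiffPoly M) (l : Fin 2) (b c : DiffPoly M) :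
    varDer (Polynomial.C a * Polynomial.X) l b c = adjLin l a (b * totalD c) := by
  rw [Polynomial.C_mul_X_eq_monomial, varDer_monomial]; rfl

theorem varDer_C (a : DiffPoly M) (l : Fin 2) (b c : DiffPoly M) :
    varDer (Polynomial.C a) l b c = adjLin l a (b * c) := varDer_monomial 0 a l b c

theorem varDer_zero (l : Fin 2) (b c : DiffPoly M) : varDer 0 l b c = 0 :=
  Polynomial.sum_zero_index _

theorem varDer_X (l : Fin 2) (b c : DiffPoly M) : varDer Polynomial.X l b c = 0 := by
  have h1 : ∀ l, pderivCoeff l (1 : Coeff M) = 0 := fun l => (coeffDer l).map_one_eq_zero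
  have := varDer_C_mul_X (C 1) l b c
  rwa [adjLin_C, h1, C_0, zero_mul, C_1, Polynomial.C_1, one_mul] at this

theorem opDer_C_mul_X_pow (η : VecField M) (a : DiffPoly M) (m : ℕ) (b : DiffPoly M) :
    opDer η (Polynomial.C a * Polynomial.X ^ m) b = evol η a * totalD^[m] b := by
  rw [Polynomial.C_mul_X_pow_eq_monomial, opDer_monomial]

theorem opDer_C_mul_X (η : VecField M) (a : DiffPoly M) (b : DiffPoly M) :
    opDer η (Polynomial.C a * Polynomial.X) b = evol η a * totalD b := by
  rw [Polynomial.C_mul_X_eq_monomial, opDer_monomial]; rfl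

theorem opDer_C (η : VecField M) (a : DiffPoly M) (b : DiffPoly M) :
    opDer η (Polynomial.C a) b = evol η a * b := opDer_monomial η 0 a b

theorem opDer_zero (η : VecField M) (b : DiffPoly M) : opDer η 0 b = 0 :=
  Polynomial.sum_zero_index _

theorem opDer_X (η : VecField M) (b : DiffPoly M) : opDer η Polynomial.X b = 0 := by
  have h1 : ∀ l, pderivCoeff l (1 : Coeff M) = 0 := fun l => (coeffDer l).map_one_eq_zero
  have := opDer_C_mul_X η (C 1) b
  rwa [evol_C, h1, h1, C_0, zero_mul, zero_mul, add_zero, zero_mul, C_1, Polynomial.C_1,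
    one_mul] at this

theorem totalD_iterate_one (F : DiffPoly M) : totalD^[1] F = totalD F := by
  rw [Function.iterate_one]

theorem totalD_iterate_two (F : DiffPoly M) : totalD^[2] F = totalD (totalD F) := by
  rw [Function.iterate_succ_apply', totalD_iterate_one]

theorem totalD_iterate_three (F : DiffPoly M) :
    totalD^[3] F = totalD (totalD (totalD F)) := by
  rw [Function.iterate_succ_apply', totalD_iterate_two]

theorem totalD_iterate_four (F : DiffPoly M) :
    totalD^[4] F = totalD (totalD (totalD (totalD F))) := by
  rw [Function.iterate_succ_apply', totalD_iterate_three]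

theorem totalD_ofNat (n : ℕ) [n.AtLeastTwo] : totalD (ofNat(n) : DiffPoly M) = 0 :=
  totalDer.map_natCast n

theorem evol_ofNat (ξ : VecField M) (n : ℕ) [n.AtLeastTwo] :
    evol ξ (ofNat(n) : DiffPoly M) = 0 := (evolDer ξ).map_natCast n

theorem adjLin_ofNat (l : Fin 2) (n : ℕ) [n.AtLeastTwo] (h : DiffPoly M) :
    adjLin l (ofNat(n) : DiffPoly M) h = 0 := adjLin_natCast l n h

theorem pderivCoeff_ofNat (i : Fin 2) (n : ℕ) [n.AtLeastTwo] :
    pderivCoeff i (ofNat(n) : Coeff M) = 0 := (coeffDer i).map_natCast n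

theorem C_ofNat (n : ℕ) [n.AtLeastTwo] : (C (ofNat(n) : Coeff M) : DiffPoly M) = ofNat(n) :=
  map_ofNat (C : Coeff M →+* DiffPoly M) n

/-- Rules for differentiating coefficients and embedding them into the differential
polynomials. -/
theorem coeff_rules :
    (∀ (i : Fin 2) (f g : Coeff M), pderivCoeff i (f + g) = pderivCoeff i f + pderivCoeff i g) ∧
    (∀ (i : Fin 2) (f g : Coeff M), pderivCoeff i (f - g) = pderivCoeff i f - pderivCoeff i g) ∧
    (∀ (i : Fin 2) (f : Coeff M), pderivCoeff i (-f) = -pderivCoeff i f) ∧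
    (∀ (i : Fin 2) (f g : Coeff M),
      pderivCoeff i (f * g) = f * pderivCoeff i g + g * pderivCoeff i f) ∧
    (∀ (i : Fin 2) (f : Coeff M) (n : ℕ),
      pderivCoeff i (f ^ n) = n * f ^ (n - 1) * pderivCoeff i f) ∧
    (∀ i : Fin 2, pderivCoeff i (0 : Coeff M) = 0) ∧
    (∀ i : Fin 2, pderivCoeff i (1 : Coeff M) = 0) ∧
    (∀ f : Coeff M, pderivCoeff 0 (pderivCoeff 1 f) = pderivCoeff 1 (pderivCoeff 0 f)) ∧
    pderivCoeff 0 (invU1 M) = -invU1 M ^ 2 ∧ pderivCoeff 1 (invU1 M) = 0 ∧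
    (∀ f g : Coeff M, (C (f + g) : DiffPoly M) = C f + C g) ∧
    (∀ f g : Coeff M, (C (f - g) : DiffPoly M) = C f - C g) ∧
    (∀ f g : Coeff M, (C (f * g) : DiffPoly M) = C f * C g) ∧
    (∀ f : Coeff M, (C (-f) : DiffPoly M) = -C f) ∧
    (∀ (f : Coeff M) (n : ℕ), (C (f ^ n) : DiffPoly M) = C f ^ n) ∧
    (C (0 : Coeff M) : DiffPoly M) = 0 ∧ (C (1 : Coeff M) : DiffPoly M) = 1 :=
  ⟨pderivCoeff_add, fun i => map_sub (coeffDer i), fun i => map_neg (coeffDer i),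
    pderivCoeff_mul, fun i f n => by
      rw [← coeffDer_apply, Derivation.leibniz_pow, nsmul_eq_mul, smul_eq_mul, mul_assoc,
        coeffDer_apply],
    fun i => map_zero (coeffDer i), fun i => (coeffDer i).map_one_eq_zero, pderivCoeff_comm,
    pderivCoeff_invU1_zero, pderivCoeff_invU1_one, fun f g => C_add, fun f g => map_sub C f g,
    fun f g => C_mul, fun f => map_neg C f, fun f n => C_pow f n, C_0, C_1⟩

/-- Rules for the total derivative. -/
theorem totalD_rules :
    (∀ F G : DiffPoly M, totalD (F + G) = totalD F + totalD G) ∧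
    (∀ F G : DiffPoly M, totalD (F - G) = totalD F - totalD G) ∧
    (∀ F : DiffPoly M, totalD (-F) = -totalD F) ∧
    (∀ F G : DiffPoly M, totalD (F * G) = F * totalD G + G * totalD F) ∧
    (∀ (F : DiffPoly M) (n : ℕ), totalD (F ^ n) = n * F ^ (n - 1) * totalD F) ∧
    totalD (0 : DiffPoly M) = 0 ∧ totalD (1 : DiffPoly M) = 0 ∧
    (∀ f : Coeff M, totalD (C f) =
      C (pderivCoeff 0 f) * X (0, 0) + C (pderivCoeff 1 f) * X (1, 0)) ∧
    (∀ v : Fin 2 × ℕ, totalD (X v : DiffPoly M) = X (v.1, v.2 + 1)) ∧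
    (∀ F : DiffPoly M, totalD^[1] F = totalD F) ∧
    (∀ F : DiffPoly M, totalD^[2] F = totalD (totalD F)) ∧
    (∀ F : DiffPoly M, totalD^[3] F = totalD (totalD (totalD F))) ∧
    (∀ F : DiffPoly M, totalD^[4] F = totalD (totalD (totalD (totalD F)))) :=
  ⟨totalD_add, totalD_sub, totalD_neg, totalD_mul, fun F n => by
    rw [totalD_pow, nsmul_eq_mul, mul_assoc], totalD_zero, totalDer.map_one_eq_zero, totalD_C,
    totalD_X, totalD_iterate_one, totalD_iterate_two, totalD_iterate_three,
    totalD_iterate_four⟩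

/-- Rules for the action of an evolutionary vector field. -/
theorem evol_rules (ξ : VecField M) :
    (∀ F G : DiffPoly M, evol ξ (F + G) = evol ξ F + evol ξ G) ∧
    (∀ F G : DiffPoly M, evol ξ (F - G) = evol ξ F - evol ξ G) ∧
    (∀ F : DiffPoly M, evol ξ (-F) = -evol ξ F) ∧
    (∀ F G : DiffPoly M, evol ξ (F * G) = F * evol ξ G + G * evol ξ F) ∧
    (∀ (F : DiffPoly M) (n : ℕ), evol ξ (F ^ n) = n * F ^ (n - 1) * evol ξ F) ∧
    evol ξ (0 : DiffPoly M) = 0 ∧ evol ξ (1 : DiffPoly M) = 0 ∧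
    (∀ f : Coeff M, evol ξ (C f) = C (pderivCoeff 0 f) * ξ 0 + C (pderivCoeff 1 f) * ξ 1) ∧
    (∀ v : Fin 2 × ℕ, evol ξ (X v : DiffPoly M) = totalD^[v.2 + 1] (ξ v.1)) :=
  ⟨evol_add ξ, evol_sub ξ, evol_neg ξ, evol_mul ξ, fun F n => by
    rw [evol_pow, nsmul_eq_mul, mul_assoc], evol_zero ξ, (evolDer ξ).map_one_eq_zero, evol_C ξ,
    evol_X ξ⟩

/-- Rules for adjoints of linearizations. -/
theorem adjLin_rules :
    (∀ (l : Fin 2) (F G h : DiffPoly M), adjLin l (F + G) h = adjLin l F h + adjLin l G h) ∧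
    (∀ (l : Fin 2) (F G h : DiffPoly M), adjLin l (F - G) h = adjLin l F h - adjLin l G h) ∧
    (∀ (l : Fin 2) (F h : DiffPoly M), adjLin l (-F) h = -adjLin l F h) ∧
    (∀ (l : Fin 2) (F G h : DiffPoly M),
      adjLin l (F * G) h = adjLin l G (F * h) + adjLin l F (G * h)) ∧
    (∀ (l : Fin 2) (F h : DiffPoly M) (n : ℕ),
      adjLin l (F ^ n) h = adjLin l F (n * F ^ (n - 1) * h)) ∧
    (∀ (l : Fin 2) (h : DiffPoly M), adjLin l 0 h = 0) ∧
    (∀ (l : Fin 2) (h : DiffPoly M), adjLin l 1 h = 0) ∧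
    (∀ (l : Fin 2) (f : Coeff M) (h : DiffPoly M),
      adjLin l (C f) h = C (pderivCoeff l f) * h) ∧
    (∀ (l : Fin 2) (k : ℕ) (h : DiffPoly M),
      adjLin l (X (l, k)) h = (-1) ^ (k + 1) * totalD^[k + 1] h) ∧
    (∀ (k : ℕ) (h : DiffPoly M), adjLin 0 (X (1, k)) h = 0) ∧
    (∀ (k : ℕ) (h : DiffPoly M), adjLin 1 (X (0, k)) h = 0) :=
  ⟨adjLin_add, adjLin_sub, adjLin_neg, adjLin_mul, adjLin_pow, adjLin_zero, adjLin_one_eq_zero,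
    adjLin_C, adjLin_X_self, adjLin_zero_X_one, adjLin_one_X_zero⟩

/-- Rules for the action of explicit operators, and for the derivatives of their coefficients. -/
theorem operator_rules :
    (∀ (p q : DiffOp M) (b : DiffPoly M), opAct (p + q) b = opAct p b + opAct q b) ∧
    (∀ (a : DiffPoly M) (p : DiffOp M) (b : DiffPoly M),
      opAct (Polynomial.C a * p) b = a * opAct p b) ∧
    (∀ a b : DiffPoly M, opAct (Polynomial.C a) b = a * b) ∧
    (∀ b : DiffPoly M, opAct (0 : DiffOp M) b = 0) ∧
    (∀ b : DiffPoly M, opAct (Polynomial.X : DiffOp M) b = totalD b) ∧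
    (∀ (n : ℕ) (b : DiffPoly M), opAct (Polynomial.X ^ n : DiffOp M) b = totalD^[n] b) ∧
    (∀ (η : VecField M) (p q : DiffOp M) (b : DiffPoly M),
      opDer η (p + q) b = opDer η p b + opDer η q b) ∧
    (∀ (η : VecField M) (a : DiffPoly M) (m : ℕ) (b : DiffPoly M),
      opDer η (Polynomial.C a * Polynomial.X ^ m) b = evol η a * totalD^[m] b) ∧
    (∀ (η : VecField M) (a b : DiffPoly M),
      opDer η (Polynomial.C a * Polynomial.X) b = evol η a * totalD b) ∧
    (∀ (η : VecField M) (a b : DiffPoly M), opDer η (Polynomial.C a) b = evol η a * b) ∧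
    (∀ (η : VecField M) (b : DiffPoly M), opDer η 0 b = 0) ∧
    (∀ (η : VecField M) (b : DiffPoly M), opDer η Polynomial.X b = 0) ∧
    (∀ (p q : DiffOp M) (l : Fin 2) (b c : DiffPoly M),
      varDer (p + q) l b c = varDer p l b c + varDer q l b c) ∧
    (∀ (a : DiffPoly M) (m : ℕ) (l : Fin 2) (b c : DiffPoly M),
      varDer (Polynomial.C a * Polynomial.X ^ m) l b c = adjLin l a (b * totalD^[m] c)) ∧
    (∀ (a : DiffPoly M) (l : Fin 2) (b c : DiffPoly M),
      varDer (Polynomial.C a * Polynomial.X) l b c = adjLin l a (b * totalD c)) ∧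
    (∀ (a : DiffPoly M) (l : Fin 2) (b c : DiffPoly M),
      varDer (Polynomial.C a) l b c = adjLin l a (b * c)) ∧
    (∀ (l : Fin 2) (b c : DiffPoly M), varDer 0 l b c = 0) ∧
    (∀ (l : Fin 2) (b c : DiffPoly M), varDer Polynomial.X l b c = 0) :=
  ⟨opAct_add, opAct_C_mul, opAct_C, opAct_zero, opAct_X, opAct_X_pow, opDer_add,
    opDer_C_mul_X_pow, opDer_C_mul_X, opDer_C, opDer_zero, opDer_X, varDer_add,
    varDer_C_mul_X_pow, varDer_C_mul_X, varDer_C, varDer_zero, varDer_X⟩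

/-- The entries of the undeformed structure. -/
theorem poisson0_entries :
    poisson0 M 0 0 = Polynomial.X ∧
    poisson0 M 0 1 = Polynomial.C (-(C (invU1 M) * X (1, 0))) ∧
    poisson0 M 1 0 = Polynomial.C (C (invU1 M) * X (1, 0)) ∧ poisson0 M 1 1 = 0 :=
  ⟨rfl, rfl, rfl, rfl⟩

end Rules

section Reduction

variable {M : CoordBox}

/-- The components of the equation `[P, Q] = 0`. -/
theorem bracketTerm_add_eq_zero {P Q : MatOp M} (hP : IsSkew P) (hQ : IsSkew Q)
    (h : ∀ a b c, jacobiForm P Q a b c = 0) (i j k : Fin 2) (b c : DiffPoly M) :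
    bracketTerm P Q i j k b c + bracketTerm Q P i j k b c = 0 := by
  refine eq_zero_of_forall_intg_mul fun a => ?_
  rw [mul_comm, ← jacobiForm_single hP hQ, h]

/-- By cyclic symmetry it suffices to check four components of a sum of brackets. -/
theorem sum_schouten_eq_zero {ι : Type*} {s : Finset ι} {P Q : ι → MatOp M}
    (hP : ∀ n, IsSkew (P n)) (hQ : ∀ n, IsSkew (Q n))
    (h : ∀ i b c, (∑ n ∈ s, (bracketTerm (P n) (Q n) i 0 0 b c +
        bracketTerm (Q n) (P n) i 0 0 b c) = 0) ∧
      ∑ n ∈ s, (bracketTerm (P n) (Q n) i 1 1 b c + bracketTerm (Q n) (P n) i 1 1 b c) = 0)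
    (i j k : Fin 2) : ∑ n ∈ s, schouten (P n) (Q n) i j k = 0 := by
  refine (sum_schouten_eq_zero_iff s P Q).2 (fun a b c => ?_) i j k
  have key : ∀ i j k a b c, ∑ n ∈ s,
      jacobiForm (P n) (Q n) (Pi.single i a) (Pi.single j b) (Pi.single k c) =
      intg (a * ∑ n ∈ s, (bracketTerm (P n) (Q n) i j k b c +
        bracketTerm (Q n) (P n) i j k b c)) := by
    intro i j k a b c
    rw [Finset.mul_sum, map_sum]
    exact Finset.sum_congr rfl fun n _ => jacobiForm_single (hP n) (hQ n) i j k a b c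
  have cyc : ∀ i j k a b c, ∑ n ∈ s,
      jacobiForm (P n) (Q n) (Pi.single j b) (Pi.single k c) (Pi.single i a) = ∑ n ∈ s,
      jacobiForm (P n) (Q n) (Pi.single i a) (Pi.single j b) (Pi.single k c) :=
    fun i j k a b c => Finset.sum_congr rfl fun n _ => jacobiForm_cyclic ..
  have hi : ∀ i j a b c, ∑ n ∈ s,
      jacobiForm (P n) (Q n) (Pi.single i a) (Pi.single j b) (Pi.single j c) = 0 := by
    intro i j a b c
    rw [key]
    match j with
    | 0 => rw [(h i b c).1, mul_zero, map_zero]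
    | 1 => rw [(h i b c).2, mul_zero, map_zero]
  have all : ∀ i j k a b c, ∑ n ∈ s,
      jacobiForm (P n) (Q n) (Pi.single i a) (Pi.single j b) (Pi.single k c) = 0 := by
    intro i j k a b c
    by_cases hjk : j = k
    · rw [hjk]; exact hi ..
    by_cases hik : i = k
    · rw [← cyc, hik]
      exact hi ..
    · have hij : i = j := by lia
      rw [cyc k i j c a b, hij]
      exact hi ..
  simp only [jacobiForm_eq_sum _ _ a b c, Fin.sum_univ_two, Finset.sum_add_distrib, all,
    add_zero]

end Reduction

/-! ### Degrees and the Euler derivation -/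

section Degree

open MvPolynomial

variable {M : CoordBox}

/-- The Euler derivation, multiplying a differential polynomial of degree `d` by `d`. -/
def eulerDer : Derivation (Coeff M) (DiffPoly M) (DiffPoly M) :=
  mkDerivation (Coeff M) fun v => ((v.2 + 1 : ℕ) : DiffPoly M) * X v

theorem eulerDer_C (f : Coeff M) : eulerDer (C f : DiffPoly M) = 0 := derivation_C _ f

theorem eulerDer_X (v : Fin 2 × ℕ) :
    eulerDer (X v : DiffPoly M) = ((v.2 + 1 : ℕ) : DiffPoly M) * X v := mkDerivation_X _ _ v

theorem eulerDer_mul (F G : DiffPoly M) :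
    eulerDer (F * G) = F * eulerDer G + G * eulerDer F := eulerDer.leibniz F G

theorem coeff_eulerDer (F : DiffPoly M) (m : Fin 2 × ℕ →₀ ℕ) :
    coeff m (eulerDer F) =
      (Finsupp.weight (fun v : Fin 2 × ℕ => v.2 + 1) m : Coeff M) * coeff m F := by
  classical
  induction F using MvPolynomial.induction_on generalizing m with
  | C a =>
    rw [eulerDer_C, coeff_zero, coeff_C]
    split_ifs with h
    · rw [← h, map_zero, Nat.cast_zero, zero_mul]
    · rw [mul_zero]
  | add p q hp hq => rw [map_add, coeff_add, hp, hq, coeff_add, mul_add]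
  | mul_X p v hp =>
    have e : eulerDer (p * X v) = C ((v.2 + 1 : ℕ) : Coeff M) * (p * X v) + eulerDer p * X v := by
      rw [eulerDer_mul, eulerDer_X, map_natCast]
      ring
    rw [e, coeff_add, coeff_C_mul, coeff_mul_X', coeff_mul_X', hp]
    split_ifs with h
    · have hm : m = (m - Finsupp.single v 1) + Finsupp.single v 1 :=
        (tsub_add_cancel_of_le (Finsupp.single_le_iff.2
          (Nat.one_le_iff_ne_zero.2 (Finsupp.mem_support_iff.1 h)))).symm
      conv_rhs => rw [hm]
      rw [map_add, Finsupp.weight_single, one_smul, ← hm]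
      push_cast
      ring
    · ring

theorem Coeff.natCast_mul_eq_zero {n : ℕ} (hn : n ≠ 0) {f : Coeff M} (h : (n : Coeff M) * f = 0) :
    f = 0 := by
  have h1 : (n : ℝ) • f = 0 := by rwa [Algebra.smul_def, map_natCast]
  have := congrArg (fun g => (n : ℝ)⁻¹ • g) h1
  simpa only [smul_smul, inv_mul_cancel₀ (Nat.cast_ne_zero (R := ℝ).2 hn), one_smul,
    smul_zero] using this

/-- Homogeneity is an eigenvalue equation for the Euler derivation, as natural numbers are
invertible in the coefficients. -/
theorem isHomogeneousDP_iff {d : ℕ} {F : DiffPoly M} :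
    IsHomogeneousDP d F ↔ eulerDer F = (d : DiffPoly M) * F := by
  constructor
  · intro h
    refine MvPolynomial.ext _ _ fun m => ?_
    rw [coeff_eulerDer, ← map_natCast (C : Coeff M →+* DiffPoly M), coeff_C_mul]
    by_cases hm : coeff m F = 0
    · rw [hm, mul_zero, mul_zero]
    · rw [h hm]
  · intro h m hm
    have := congrArg (coeff m) h
    rw [coeff_eulerDer, ← map_natCast (C : Coeff M →+* DiffPoly M), coeff_C_mul] at this
    by_contra hne
    rcases lt_or_gt_of_ne hne with hlt | hlt
    · obtain ⟨k, hk⟩ := Nat.exists_eq_add_of_lt hlt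
      refine hm (Coeff.natCast_mul_eq_zero (n := k + 1) (by lia) ?_)
      rw [hk] at this
      push_cast at this ⊢
      linear_combination -this
    · obtain ⟨k, hk⟩ := Nat.exists_eq_add_of_lt hlt
      refine hm (Coeff.natCast_mul_eq_zero (n := k + 1) (by lia) ?_)
      rw [hk] at this
      push_cast at this ⊢
      linear_combination this

theorem eulerDer_totalD (F : DiffPoly M) :
    eulerDer (totalD F) = totalD (eulerDer F) + totalD F := by
  refine sub_eq_zero.1 (eq_zero_of_leibniz
    (D := fun F => eulerDer (totalD F) - (totalD (eulerDer F) + totalD F)) ?_ ?_ ?_ ?_ F)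
  · intro F G
    simp only [totalD_add, map_add]
    ring
  · intro F G
    simp only [totalD_add, map_add, totalD_mul, eulerDer_mul]
    ring
  · intro f
    simp only [totalD_C, map_add, eulerDer_mul, eulerDer_C, eulerDer_X, totalD_zero]
    push_cast
    ring
  · intro v
    have h := (totalDer (M := M)).map_natCast (v.2 + 1)
    rw [totalDer_apply] at h
    rw [totalD_X, eulerDer_X, eulerDer_X, totalD_mul, totalD_X, h]
    push_cast
    ring

theorem eulerDer_iterate_totalD (n : ℕ) (F : DiffPoly M) :
    eulerDer (totalD^[n] F) = totalD^[n] (eulerDer F) + n * totalD^[n] F := by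
  induction n with
  | zero => rw [Nat.cast_zero, zero_mul, add_zero]; rfl
  | succ n ih =>
    have h := (totalDer (M := M)).map_natCast n
    rw [totalDer_apply] at h
    rw [Function.iterate_succ_apply', eulerDer_totalD, ih, totalD_add, totalD_mul, h,
      Function.iterate_succ_apply']
    push_cast
    ring

theorem eulerDer_evol (η : VecField M) (F : DiffPoly M) :
    eulerDer (evol η F) = evol (fun i => eulerDer (η i)) F + evol η (eulerDer F) := by
  refine sub_eq_zero.1 (eq_zero_of_leibniz (D := fun F => eulerDer (evol η F)
    - (evol (fun i => eulerDer (η i)) F + evol η (eulerDer F))) ?_ ?_ ?_ ?_ F)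
  · intro F G
    simp only [evol_add, map_add]
    ring
  · intro F G
    simp only [evol_add, map_add, evol_mul, eulerDer_mul]
    ring
  · intro f
    simp only [evol_C, map_add, eulerDer_mul, eulerDer_C, evol_zero]
    ring
  · intro v
    have h := (evolDer η).map_natCast (v.2 + 1)
    rw [evolDer_apply] at h
    rw [evol_X, evol_X, eulerDer_X, evol_mul, evol_X, h, eulerDer_iterate_totalD]
    ring

/-- The operator `p` has degree `d`: it raises the degree by `d`. -/
def OpHasDegree (d : ℕ) (p : DiffOp M) : Prop :=
  ∀ b, eulerDer (opAct p b) = opAct p (eulerDer b) + d * opAct p b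

theorem coeff_sum_monomial (p : DiffOp M) (f : ℕ → DiffPoly M → DiffPoly M) (hf : ∀ n, f n 0 = 0)
    (m : ℕ) : (p.sum fun n a => Polynomial.monomial n (f n a)).coeff m = f m (p.coeff m) := by
  classical
  rw [Polynomial.sum_def, Polynomial.finsetSum_coeff]
  simp only [Polynomial.coeff_monomial]
  rw [Finset.sum_ite_eq' p.support m]
  split_ifs with h
  · rfl
  · rw [Polynomial.notMem_support_iff.1 h, hf]

theorem opHasDegree_iff {d : ℕ} {p : DiffOp M} :
    OpHasDegree d p ↔ ∀ m, eulerDer (p.coeff m) + m * p.coeff m = d * p.coeff m := by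
  have key : ∀ b, opAct (p.sum fun m a => Polynomial.monomial m
      (eulerDer a + (m : DiffPoly M) * a - (d : DiffPoly M) * a)) b =
      eulerDer (opAct p b) - (opAct p (eulerDer b) + d * opAct p b) := by
    intro b
    induction p using Polynomial.induction_on' with
    | add p q hp hq =>
      rw [Polynomial.sum_add_index p q _ (fun m => by simp)
        (fun m a a' => by rw [← map_add]; refine congrArg _ ?_; rw [map_add]; ring),
        opAct_add, hp, hq, opAct_add, opAct_add, map_add]
      ring
    | monomial n a =>
      rw [Polynomial.sum_monomial_index _ _ (by simp), opAct_monomial, opAct_monomial,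
        opAct_monomial, eulerDer_mul, eulerDer_iterate_totalD]
      ring
  constructor
  · intro h m
    have h0 : (p.sum fun m a => Polynomial.monomial m
        (eulerDer a + (m : DiffPoly M) * a - (d : DiffPoly M) * a)) = 0 :=
      opAct_injective fun b => by rw [key, h b, sub_self, opAct_zero]
    have := congrArg (fun q => Polynomial.coeff q m) h0
    rw [coeff_sum_monomial p
        (fun m a => eulerDer a + (m : DiffPoly M) * a - (d : DiffPoly M) * a)
        (fun n => by simp)] at this
    exact sub_eq_zero.1 this
  · intro h b
    have h0 : (p.sum fun m a => Polynomial.monomial m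
        (eulerDer a + (m : DiffPoly M) * a - (d : DiffPoly M) * a)) = 0 := by
      refine Polynomial.ext fun m => ?_
      rw [coeff_sum_monomial p
        (fun m a => eulerDer a + (m : DiffPoly M) * a - (d : DiffPoly M) * a) (fun n => by simp), h,
        sub_self, Polynomial.coeff_zero]
    have := key b
    rw [h0, opAct_zero] at this
    exact sub_eq_zero.1 this.symm

theorem hasDegree_iff {d : ℕ} {P : MatOp M} : HasDegree d P ↔ ∀ i j, OpHasDegree d (P i j) := by
  refine forall₂_congr fun i j => ?_
  rw [opHasDegree_iff]
  refine forall_congr' fun m => ?_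
  constructor
  · rintro ⟨h1, h2⟩
    rcases le_or_gt m d with h | h
    · rw [isHomogeneousDP_iff.1 (h1 h), ← add_mul, ← Nat.cast_add, Nat.sub_add_cancel h]
    · rw [h2 h]; simp
  · intro h
    refine ⟨fun hm => isHomogeneousDP_iff.2 ?_, fun hm => ?_⟩
    · rw [Nat.cast_sub hm, sub_mul, ← h, add_sub_cancel_right]
    · obtain ⟨k, rfl⟩ := Nat.exists_eq_add_of_lt hm
      refine MvPolynomial.ext _ _ fun n => ?_
      have := congrArg (coeff n) h
      rw [coeff_add, coeff_eulerDer, ← map_natCast (C : Coeff M →+* DiffPoly M), coeff_C_mul,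
        ← map_natCast (C : Coeff M →+* DiffPoly M), coeff_C_mul] at this
      refine Coeff.natCast_mul_eq_zero
        (n := Finsupp.weight (fun v : Fin 2 × ℕ => v.2 + 1) n + k + 1) (by lia) ?_
      push_cast at this ⊢
      linear_combination this

theorem OpHasDegree.add {d : ℕ} {p q : DiffOp M} (hp : OpHasDegree d p) (hq : OpHasDegree d q) :
    OpHasDegree d (p + q) := fun b => by
  rw [opAct_add, map_add, hp, hq, opAct_add]
  ring

theorem OpHasDegree.sub {d : ℕ} {p q : DiffOp M} (hp : OpHasDegree d p) (hq : OpHasDegree d q) :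
    OpHasDegree d (p - q) := fun b => by
  rw [opAct_sub, map_sub, hp, hq, opAct_sub]
  ring

theorem opAct_natCast_mul (p : DiffOp M) (n : ℕ) (b : DiffPoly M) :
    opAct p ((n : DiffPoly M) * b) = n * opAct p b := by
  induction n with
  | zero => rw [Nat.cast_zero, zero_mul, zero_mul, opAct_zero_right]
  | succ n ih => rw [Nat.cast_succ, add_mul, opAct_add_right, ih, one_mul, add_mul, one_mul]

theorem iterate_totalD_natCast_mul (m n : ℕ) (b : DiffPoly M) :
    totalD^[m] ((n : DiffPoly M) * b) = n * totalD^[m] b := by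
  rw [← opAct_X_pow, ← opAct_X_pow, opAct_natCast_mul]

theorem evol_natCast_mul_left (n : ℕ) (ξ : VecField M) (F : DiffPoly M) :
    evol (fun i => (n : DiffPoly M) * ξ i) F = n * evol ξ F := by
  have h : ∀ G : DiffPoly M, (n : DiffPoly M) * G = (n : ℝ) • G := fun G => by
    rw [Algebra.smul_def, map_natCast]
  simp only [h]
  exact evol_smul_left (n : ℝ) ξ F

theorem OpHasDegree.compOp {d e : ℕ} {p q : DiffOp M} (hp : OpHasDegree d p)
    (hq : OpHasDegree e q) : OpHasDegree (d + e) (compOp p q) := fun b => by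
  rw [opAct_compOp, hp, hq, opAct_add_right, opAct_compOp, opAct_natCast_mul]
  push_cast
  ring

theorem opHasDegree_frechet {n : ℕ} {F : DiffPoly M} (h : IsHomogeneousDP n F) (k : Fin 2) :
    OpHasDegree n (frechet F k) := by
  have e : ∀ b, opAct (frechet F k) b = evol (Pi.single k b) F := by
    intro b
    rw [← sum_opAct_frechet, Finset.sum_eq_single k (fun m _ hm => by
      rw [Pi.single_eq_of_ne hm, opAct_zero_right])
      (fun h => absurd (Finset.mem_univ k) h), Pi.single_eq_same]
  intro b
  have hn : evol (Pi.single k b) (n : DiffPoly M) = 0 := (evolDer _).map_natCast n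
  have hs : (fun i => eulerDer ((Pi.single k b : VecField M) i)) = Pi.single k (eulerDer b) := by
    funext i
    by_cases hi : i = k
    · subst hi; simp
    · simp [Pi.single_eq_of_ne hi]
  rw [e, e, eulerDer_evol, isHomogeneousDP_iff.1 h, evol_mul, hn, hs]
  ring

theorem OpHasDegree.adjOp {d : ℕ} {p : DiffOp M} (hp : OpHasDegree d p) :
    OpHasDegree d (adjOp p) := by
  rw [opHasDegree_iff] at hp
  intro b
  have e := adjAct_eq_sum p
  simp only [adjAct] at e
  rw [e, e, Polynomial.sum_def, Polynomial.sum_def, map_sum, Finset.mul_sum,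
    ← Finset.sum_add_distrib]
  refine Finset.sum_congr rfl fun m _ => ?_
  have h1 : eulerDer (p.coeff m * b) =
      p.coeff m * eulerDer b + (d * (p.coeff m * b) - m * (p.coeff m * b)) := by
    rw [eulerDer_mul]
    linear_combination b * hp m
  rw [show ((-1 : DiffPoly M) ^ m) = C ((-1) ^ m) by rw [C_pow, C_neg, C_1], eulerDer_mul,
    eulerDer_C, eulerDer_iterate_totalD, h1, iterate_totalD_add, iterate_totalD_sub,
    iterate_totalD_natCast_mul, iterate_totalD_natCast_mul]
  ring

theorem HasDegree.lieDer {d n : ℕ} {P : MatOp M} (hP : HasDegree d P) {ξ : VecField M}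
    (hξ : ∀ i, IsHomogeneousDP n (ξ i)) : HasDegree (n + d) (lieDer ξ P) := by
  rw [hasDegree_iff] at hP ⊢
  intro i j
  have h1 : OpHasDegree (n + d) ((P i j).sum fun m a => Polynomial.monomial m (evol ξ a)) := by
    rw [opHasDegree_iff]
    intro m
    rw [coeff_sum_monomial _ (fun _ a => evol ξ a) fun _ => evol_zero ξ, eulerDer_evol]
    have h := opHasDegree_iff.1 (hP i j) m
    have hnat : ∀ n : ℕ, evol ξ (n : DiffPoly M) = 0 := (evolDer ξ).map_natCast
    have h' := congrArg (evol ξ) h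
    rw [evol_add, evol_mul, evol_mul, hnat, hnat] at h'
    simp only [fun i => isHomogeneousDP_iff.1 (hξ i), evol_natCast_mul_left]
    push_cast
    linear_combination h'
  simp only [DegPoisson.lieDer, Fin.sum_univ_two]
  refine (h1.sub (.add ?_ ?_)).sub (.add ?_ ?_)
  · exact (opHasDegree_frechet (hξ i) 0).compOp (hP _ _)
  · exact (opHasDegree_frechet (hξ i) 1).compOp (hP _ _)
  · rw [add_comm]; exact (hP _ _).compOp (opHasDegree_frechet (hξ j) 0).adjOp
  · rw [add_comm]; exact (hP _ _).compOp (opHasDegree_frechet (hξ j) 1).adjOp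

end Degree

/-! ### The normal forms -/

section NormalForms

open MvPolynomial

variable {M : CoordBox}

theorem pderivCoeff_ofNat_mul (i : Fin 2) (n : ℕ) [n.AtLeastTwo] (f : Coeff M) :
    pderivCoeff i (ofNat(n) * f) = ofNat(n) * pderivCoeff i f := by
  rw [pderivCoeff_mul, pderivCoeff_ofNat, mul_zero, add_zero]

theorem C_ofNat_mul (n : ℕ) [n.AtLeastTwo] (f : Coeff M) :
    (C (ofNat(n) * f) : DiffPoly M) = ofNat(n) * C f := by
  rw [C_mul, C_ofNat]

/-- The entries of the first normal form; the parameter `r = 12 ρ` makes all coefficients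
integral. -/
theorem normalForm1_entries (ρ s : Coeff M) :
    normalForm1 (12 * ρ) s 0 0 = 0 ∧
    normalForm1 (12 * ρ) s 0 1 = Polynomial.C (-(C s * C (invU1 M) ^ 3 * X (1, 0) ^ 2)) ∧
    normalForm1 (12 * ρ) s 1 0 = Polynomial.C (C s * C (invU1 M) ^ 3 * X (1, 0) ^ 2) ∧
    normalForm1 (12 * ρ) s 1 1 =
      Polynomial.C (12 * C ρ * C (invU1 M) ^ 3 * X (1, 0)) * Polynomial.X +
        Polynomial.C (totalD (6 * C ρ * C (invU1 M) ^ 3 * X (1, 0))) := by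
  refine ⟨rfl, rfl, rfl, ?_⟩
  change Polynomial.C (C (12 * ρ) * _ * X _) * Polynomial.X +
    Polynomial.C ((1 / 2 : ℝ) • totalD (C (12 * ρ) * C (invU1 M) ^ 3 * X (1, 0))) = _
  rw [← totalD_smul, C_ofNat_mul]
  refine congrArg (fun F => _ + Polynomial.C (totalD F)) ?_
  algebra

/-- The entries of the second normal form; the parameters `r = 12 ρ`, `p = 2 π` make all
coefficients integral. -/
theorem normalForm2_entries (ρ s π : Coeff M)
    {v r r1 r2 r3 q q1 t t1 a1 a2 a3 b1 b2 b3 : DiffPoly M}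
    (hv : v = C (invU1 M)) (hr : r = C ρ) (hr1 : r1 = C (pderivCoeff 1 ρ))
    (hr2 : r2 = C (pderivCoeff 1 (pderivCoeff 1 ρ)))
    (hr3 : r3 = C (pderivCoeff 1 (pderivCoeff 1 (pderivCoeff 1 ρ))))
    (hq : q = C π) (hq1 : q1 = C (pderivCoeff 1 π)) (ht : t = C s)
    (ht1 : t1 = C (pderivCoeff 1 s)) (ha1 : a1 = X (0, 0)) (ha2 : a2 = X (0, 1))
    (ha3 : a3 = X (0, 2)) (hb1 : b1 = X (1, 0)) (hb2 : b2 = X (1, 1)) (hb3 : b3 = X (1, 2)) :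
    normalForm2 (12 * ρ) s (2 * π) 0 0 = 0 ∧
    normalForm2 (12 * ρ) s (2 * π) 0 1 =
      Polynomial.C (38 * t * r * (v ^ 4 * b2 -
          v ^ 5 * a1 * b1)) * Polynomial.X +
        Polynomial.C (30 * t * r * v ^ 4 * b3
          - 30 * t * r * v ^ 5 * a2 * b1
          - 128 * t * r * v ^ 5 * a1 * b2
          + (36 * t * r1 + 12 * t1 * r) *
            v ^ 4 * b1 * b2
          + 128 * t * r * v ^ 6 * a1 ^ 2 * b1
          - (36 * t * r1 + 12 * t1 * r) *
            v ^ 5 * a1 * b1 ^ 2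
          - 2 * t ^ 2 * v ^ 5 * b1 ^ 3) ∧
    normalForm2 (12 * ρ) s (2 * π) 1 0 =
      Polynomial.C (38 * t * r * (v ^ 4 * b2 -
          v ^ 5 * a1 * b1)) * Polynomial.X +
        Polynomial.C (8 * t * r * v ^ 4 * b3
          - 8 * t * r * v ^ 5 * a2 * b1
          - 62 * t * r * v ^ 5 * a1 * b2
          + (26 * t1 * r + 2 * t * r1) *
            v ^ 4 * b1 * b2
          + 62 * t * r * v ^ 6 * a1 ^ 2 * b1
          - (26 * t1 * r + 2 * t * r1) *
            v ^ 5 * a1 * b1 ^ 2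
          + 2 * t ^ 2 * v ^ 5 * b1 ^ 3) ∧
    normalForm2 (12 * ρ) s (2 * π) 1 1 =
      Polynomial.C (72 * r ^ 2 * v ^ 4) * Polynomial.X ^ 3 +
      Polynomial.C (216 * r * r1 * v ^ 4 * b1 -
        432 * r ^ 2 * v ^ 5 * a1) * Polynomial.X ^ 2 +
      Polynomial.C (1080 * r ^ 2 * v ^ 6 * a1 ^ 2
        - 288 * r ^ 2 * v ^ 5 * a2
        - v ^ 5 * (648 * r * r1 + 2 * q) * a1 * b1
        + 2 * q * v ^ 4 * b2) * Polynomial.X +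
      Polynomial.C (v ^ 5 * (108 * r * r1 - 5 * q) *
            a1 * b2
        - 1080 * r ^ 2 * v ^ 7 * a1 ^ 3
        - v ^ 5 * (180 * r * r1 + q) * a2 * b1
        + v ^ 4 * (q1 - 108 * (r1 ^ 2 +
            r * r2)) * b1 * b2
        + v ^ 6 * (540 * r * r1 + 5 * q) * a1 ^ 2 * b1
        + v ^ 4 * (q - 36 * r * r1) * b3
        - 72 * r ^ 2 * v ^ 5 * a3
        - v ^ 4 * (108 * r1 * r2 +
            36 * r * r3) * b1 ^ 3
        + 720 * r ^ 2 * v ^ 6 * a1 * a2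
        - v ^ 5 * (q1 - 108 * (r1 ^ 2 +
            r * r2)) * a1 * b1 ^ 2) := by
  have hC : ∀ {F G H K : DiffPoly M}, F = H → G = K →
      Polynomial.C F * Polynomial.X + Polynomial.C G =
        Polynomial.C H * Polynomial.X + Polynomial.C K := by
    rintro F G H K rfl rfl; rfl
  have hC' : ∀ {A B F G A' B' H K : DiffPoly M}, A = A' → B = B' → F = H → G = K →
      Polynomial.C A * Polynomial.X ^ 3 + Polynomial.C B * Polynomial.X ^ 2 +
        Polynomial.C F * Polynomial.X + Polynomial.C G =
      Polynomial.C A' * Polynomial.X ^ 3 + Polynomial.C B' * Polynomial.X ^ 2 +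
        Polynomial.C H * Polynomial.X + Polynomial.C K := by
    rintro A B F G A' B' H K rfl rfl rfl rfl; rfl
  simp only [normalForm2, u1, u2, ← hr, ← hr1, ← hr2, ← hr3, ← hv, ← hq, ← hq1, ← ht, ← ht1,
    ← ha1, ← ha2, ← ha3, ← hb1, ← hb2, ← hb3, pderivCoeff_ofNat_mul, C_ofNat_mul,
    Matrix.cons_val_zero,
    Matrix.cons_val_one, Matrix.cons_val_fin_one]
  refine ⟨trivial, hC ?_ ?_, hC ?_ ?_, hC' ?_ ?_ ?_ ?_⟩ <;>
    clear hr hr1 hr2 hr3 hv hq hq1 ht ht1 ha1 ha2 ha3 hb1 hb2 hb3 <;>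
    algebra

end NormalForms

/-! ### The normal forms are deformations -/

set_option linter.unusedSimpArgs false

section Converse

open MvPolynomial

variable {M : CoordBox}

theorem bracketTerm_poisson0_normalForm1 {ρ s : Coeff M} (h0 : pderivCoeff 0 ρ = 0)
    (h1 : pderivCoeff 0 s = 0) (i : Fin 2) (b c : DiffPoly M) :
    (bracketTerm (normalForm1 (12 * ρ) s) (poisson0 M) i 0 0 b c +
      bracketTerm (poisson0 M) (normalForm1 (12 * ρ) s) i 0 0 b c = 0) ∧
    bracketTerm (normalForm1 (12 * ρ) s) (poisson0 M) i 1 1 b c +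
      bracketTerm (poisson0 M) (normalForm1 (12 * ρ) s) i 1 1 b c = 0 := by
  fin_cases i <;> constructor <;>
  simp only [Fin.zero_eta, Fin.mk_one, Fin.isValue, bracketTerm, poisson0_entries,
    normalForm1_entries, operator_rules, totalD_rules,
    evol_rules, adjLin_rules, coeff_rules, totalD_ofNat, evol_ofNat, adjLin_ofNat, h0, h1,
    zero_mul, mul_zero, add_zero, zero_add, Nat.reduceAdd, Nat.reduceSub, Nat.cast_ofNat,
    pow_one] <;>
  ring

theorem bracketTerm_poisson0_poisson0 (i : Fin 2) (b c : DiffPoly M) :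
    bracketTerm (poisson0 M) (poisson0 M) i 0 0 b c = 0 ∧
    bracketTerm (poisson0 M) (poisson0 M) i 1 1 b c = 0 := by
  fin_cases i <;> constructor <;>
  simp only [Fin.zero_eta, Fin.mk_one, Fin.isValue, bracketTerm, poisson0_entries,
    operator_rules, totalD_rules,
    evol_rules, adjLin_rules, coeff_rules, totalD_ofNat, evol_ofNat, adjLin_ofNat,
    zero_mul, mul_zero, add_zero, zero_add, Nat.reduceAdd, Nat.reduceSub, Nat.cast_ofNat,
    pow_one] <;>
  ring

set_option maxHeartbeats 2000000 in
theorem bracketTerm_normalForm2_zero_zero_zero (ρ s π : Coeff M)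
    (b c : DiffPoly M) :
    bracketTerm (poisson0 M) (normalForm2 (12 * ρ) s (2 * π)) 0 0 0 b c
      + bracketTerm (normalForm2 (12 * ρ) s (2 * π)) (poisson0 M) 0 0 0 b c
      + bracketTerm (normalForm1 (12 * ρ) s) (normalForm1 (12 * ρ) s) 0 0 0 b c = 0 := by
  have n2 := normalForm2_entries ρ s π rfl rfl rfl rfl rfl rfl rfl rfl rfl rfl rfl rfl rfl rfl rfl
  simp only [bracketTerm, poisson0_entries, normalForm1_entries, n2, operator_rules, totalD_rules,
    evol_rules, adjLin_rules, coeff_rules, totalD_ofNat, evol_ofNat, adjLin_ofNat,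
    zero_mul, mul_zero, add_zero, zero_add, Nat.reduceAdd, Nat.reduceSub, Nat.cast_ofNat, pow_one]
  ring

set_option maxHeartbeats 2000000 in
theorem bracketTerm_normalForm2_one_zero_zero {ρ s π : Coeff M} (h0 : pderivCoeff 0 ρ = 0)
    (h1 : pderivCoeff 0 s = 0) (b c : DiffPoly M) :
    bracketTerm (poisson0 M) (normalForm2 (12 * ρ) s (2 * π)) 1 0 0 b c
      + bracketTerm (normalForm2 (12 * ρ) s (2 * π)) (poisson0 M) 1 0 0 b c
      + bracketTerm (normalForm1 (12 * ρ) s) (normalForm1 (12 * ρ) s) 1 0 0 b c = 0 := by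
  have n2 := normalForm2_entries ρ s π rfl rfl rfl rfl rfl rfl rfl rfl rfl rfl rfl rfl rfl rfl rfl
  simp only [bracketTerm, poisson0_entries, normalForm1_entries, n2, operator_rules, totalD_rules,
    evol_rules, adjLin_rules, coeff_rules, totalD_ofNat, evol_ofNat, adjLin_ofNat, h0, h1,
    zero_mul, mul_zero, add_zero, zero_add, Nat.reduceAdd, Nat.reduceSub, Nat.cast_ofNat, pow_one]
  ring

set_option maxHeartbeats 2000000 in
theorem bracketTerm_normalForm2_zero_one_one {ρ s π : Coeff M} (h0 : pderivCoeff 0 ρ = 0)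
    (h1 : pderivCoeff 0 s = 0) (h2 : pderivCoeff 0 π = 0) (b c : DiffPoly M) :
    bracketTerm (poisson0 M) (normalForm2 (12 * ρ) s (2 * π)) 0 1 1 b c
      + bracketTerm (normalForm2 (12 * ρ) s (2 * π)) (poisson0 M) 0 1 1 b c
      + bracketTerm (normalForm1 (12 * ρ) s) (normalForm1 (12 * ρ) s) 0 1 1 b c = 0 := by
  have n2 := normalForm2_entries ρ s π rfl rfl rfl rfl rfl rfl rfl rfl rfl rfl rfl rfl rfl rfl rfl
  simp only [bracketTerm, poisson0_entries, normalForm1_entries, n2, operator_rules, totalD_rules,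
    evol_rules, adjLin_rules, coeff_rules, totalD_ofNat, evol_ofNat, adjLin_ofNat, h0, h1, h2,
    zero_mul, mul_zero, add_zero, zero_add, Nat.reduceAdd, Nat.reduceSub, Nat.cast_ofNat, pow_one]
  ring

set_option maxHeartbeats 2000000 in
theorem bracketTerm_normalForm2_one_one_one {ρ s π : Coeff M} (h0 : pderivCoeff 0 ρ = 0)
    (h1 : pderivCoeff 0 s = 0) (h2 : pderivCoeff 0 π = 0) (b c : DiffPoly M) :
    bracketTerm (poisson0 M) (normalForm2 (12 * ρ) s (2 * π)) 1 1 1 b c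
      + bracketTerm (normalForm2 (12 * ρ) s (2 * π)) (poisson0 M) 1 1 1 b c
      + bracketTerm (normalForm1 (12 * ρ) s) (normalForm1 (12 * ρ) s) 1 1 1 b c = 0 := by
  have n2 := normalForm2_entries ρ s π rfl rfl rfl rfl rfl rfl rfl rfl rfl rfl rfl rfl rfl rfl rfl
  simp only [bracketTerm, poisson0_entries, normalForm1_entries, n2, operator_rules, totalD_rules,
    evol_rules, adjLin_rules, coeff_rules, totalD_ofNat, evol_ofNat, adjLin_ofNat, h0, h1, h2,
    zero_mul, mul_zero, add_zero, zero_add, Nat.reduceAdd, Nat.reduceSub, Nat.cast_ofNat, pow_one]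
  ring

end Converse

section NormalFormProperties

open MvPolynomial

variable {M : CoordBox}

theorem adjAct_X (b : DiffPoly M) : adjAct Polynomial.X b = -totalD b := by
  have := adjAct_X_pow (M := M) 1 b
  rwa [pow_one, pow_one, Function.iterate_one, neg_one_mul] at this

/-- Rules for the action of the adjoints of explicit operators. -/
theorem adjAct_rules :
    (∀ (p q : DiffOp M) (b : DiffPoly M), adjAct (p + q) b = adjAct p b + adjAct q b) ∧
    (∀ (a : DiffPoly M) (p : DiffOp M) (b : DiffPoly M),
      adjAct (Polynomial.C a * p) b = adjAct p (a * b)) ∧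
    (∀ (m : ℕ) (b : DiffPoly M),
      adjAct (Polynomial.X ^ m : DiffOp M) b = (-1) ^ m * totalD^[m] b) ∧
    (∀ b : DiffPoly M, adjAct (Polynomial.X : DiffOp M) b = -totalD b) ∧
    (∀ a b : DiffPoly M, adjAct (Polynomial.C a) b = a * b) ∧
    (∀ b : DiffPoly M, adjAct (0 : DiffOp M) b = 0) :=
  ⟨adjAct_add, adjAct_C_mul, adjAct_X_pow, adjAct_X, adjAct_C, adjAct_zero⟩

theorem isSkew_of_adjAct {P : MatOp M}
    (h : ∀ b, adjAct (P 0 0) b = -opAct (P 0 0) b ∧ adjAct (P 0 1) b = -opAct (P 1 0) b ∧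
      adjAct (P 1 0) b = -opAct (P 0 1) b ∧ adjAct (P 1 1) b = -opAct (P 1 1) b) : IsSkew P := by
  intro i j
  refine opAct_injective fun b => ?_
  rw [opAct_neg]
  obtain ⟨h1, h2, h3, h4⟩ := h b
  match i, j with
  | 0, 0 => exact h1
  | 0, 1 => exact h3
  | 1, 0 => exact h2
  | 1, 1 => exact h4

theorem isSkew_poisson0 : IsSkew (poisson0 M) := by
  refine isSkew_of_adjAct fun b => ⟨?_, ?_, ?_, ?_⟩ <;>
  simp only [poisson0_entries, operator_rules, adjAct_rules] <;>
  ring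

theorem isSkew_normalForm1 (ρ s : Coeff M) : IsSkew (normalForm1 (12 * ρ) s) := by
  refine isSkew_of_adjAct fun b => ⟨?_, ?_, ?_, ?_⟩ <;>
  simp only [normalForm1_entries, operator_rules, adjAct_rules, totalD_rules, totalD_ofNat] <;>
  ring

theorem isSkew_normalForm2 {ρ s π : Coeff M} (h0 : pderivCoeff 0 ρ = 0)
    (h1 : pderivCoeff 0 s = 0) (h2 : pderivCoeff 0 π = 0) :
    IsSkew (normalForm2 (12 * ρ) s (2 * π)) := by
  have n2 := normalForm2_entries ρ s π rfl rfl rfl rfl rfl rfl rfl rfl rfl rfl rfl rfl rfl rfl rfl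
  refine isSkew_of_adjAct fun b => ⟨?_, ?_, ?_, ?_⟩ <;>
  simp only [n2, operator_rules, adjAct_rules, totalD_rules, totalD_ofNat, coeff_rules, h0, h1,
    h2, zero_mul, mul_zero, add_zero, zero_add, Nat.reduceAdd, Nat.reduceSub, Nat.cast_ofNat,
    pow_one] <;>
  ring

theorem eulerDer_ofNat (n : ℕ) [n.AtLeastTwo] : eulerDer (ofNat(n) : DiffPoly M) = 0 :=
  eulerDer.map_natCast n

/-- Rules for the Euler derivation. -/
theorem eulerDer_rules :
    (∀ F G : DiffPoly M, eulerDer (F + G) = eulerDer F + eulerDer G) ∧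
    (∀ F G : DiffPoly M, eulerDer (F - G) = eulerDer F - eulerDer G) ∧
    (∀ F : DiffPoly M, eulerDer (-F) = -eulerDer F) ∧
    (∀ F G : DiffPoly M, eulerDer (F * G) = F * eulerDer G + G * eulerDer F) ∧
    (∀ (F : DiffPoly M) (n : ℕ), eulerDer (F ^ n) = n * F ^ (n - 1) * eulerDer F) ∧
    (∀ f : Coeff M, eulerDer (C f : DiffPoly M) = 0) ∧
    (∀ v : Fin 2 × ℕ, eulerDer (X v : DiffPoly M) = ((v.2 + 1 : ℕ) : DiffPoly M) * X v) ∧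
    (∀ F : DiffPoly M, eulerDer (totalD F) = totalD (eulerDer F) + totalD F) ∧
    eulerDer (0 : DiffPoly M) = 0 :=
  ⟨map_add _, map_sub _, map_neg _, eulerDer_mul, fun F n => by
    rw [Derivation.leibniz_pow, nsmul_eq_mul, smul_eq_mul, mul_assoc], eulerDer_C, eulerDer_X,
    eulerDer_totalD, map_zero _⟩

theorem hasDegree_of_opHasDegree {d : ℕ} {P : MatOp M}
    (h : OpHasDegree d (P 0 0) ∧ OpHasDegree d (P 0 1) ∧ OpHasDegree d (P 1 0) ∧
      OpHasDegree d (P 1 1)) : HasDegree d P := by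
  refine hasDegree_iff.2 fun i j => ?_
  match i, j with
  | 0, 0 => exact h.1
  | 0, 1 => exact h.2.1
  | 1, 0 => exact h.2.2.1
  | 1, 1 => exact h.2.2.2

theorem hasDegree_poisson0 : HasDegree 1 (poisson0 M) := by
  refine hasDegree_of_opHasDegree ⟨fun b => ?_, fun b => ?_, fun b => ?_, fun b => ?_⟩ <;>
  simp only [poisson0_entries, operator_rules, eulerDer_rules, Nat.cast_one, zero_add] <;>
  ring

theorem hasDegree_normalForm1 (ρ s : Coeff M) : HasDegree 2 (normalForm1 (12 * ρ) s) := by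
  refine hasDegree_of_opHasDegree ⟨fun b => ?_, fun b => ?_, fun b => ?_, fun b => ?_⟩ <;>
  simp only [normalForm1_entries, operator_rules, eulerDer_rules, totalD_rules, totalD_ofNat,
    eulerDer_ofNat, Nat.reduceAdd, Nat.reduceSub, Nat.cast_ofNat, Nat.cast_one, zero_add] <;>
  ring

theorem hasDegree_normalForm2 (ρ s π : Coeff M) :
    HasDegree 3 (normalForm2 (12 * ρ) s (2 * π)) := by
  have n2 := normalForm2_entries ρ s π rfl rfl rfl rfl rfl rfl rfl rfl rfl rfl rfl rfl rfl rfl rfl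
  refine hasDegree_of_opHasDegree ⟨fun b => ?_, fun b => ?_, fun b => ?_, fun b => ?_⟩ <;>
  simp only [n2, operator_rules, eulerDer_rules, totalD_rules, totalD_ofNat, eulerDer_ofNat,
    Nat.reduceAdd, Nat.reduceSub, Nat.cast_ofNat, Nat.cast_one, zero_add] <;>
  ring

theorem isSkew_zero : IsSkew (0 : MatOp M) := isSkew_of_adjAct fun b => by
  simp only [Pi.zero_apply, adjAct_zero, opAct_zero, neg_zero, and_self]

theorem hasDegree_zero (d : ℕ) : HasDegree d (0 : MatOp M) :=
  hasDegree_iff.2 fun i j b => by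
    simp only [Pi.zero_apply, opAct_zero, map_zero, mul_zero, add_zero]

theorem IsFunOfU2.exists_ofNat_mul {f : Coeff M} (hf : IsFunOfU2 f) (n : ℕ) [n.AtLeastTwo] :
    ∃ g : Coeff M, pderivCoeff 0 g = 0 ∧ f = ofNat(n) * g := by
  refine ⟨(n : ℝ)⁻¹ • f, ?_, ?_⟩
  · rw [← coeffDer_apply, Derivation.map_smul, coeffDer_apply, isFunOfU2_iff.1 hf, smul_zero]
  · rw [← Nat.cast_ofNat (R := Coeff M), ← map_natCast (algebraMap ℝ (Coeff M)),
      ← Algebra.smul_def, smul_smul]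
    exact (by rw [mul_inv_cancel₀ (NeZero.ne (n : ℝ)), one_smul] : f = ((n : ℝ) * (n : ℝ)⁻¹) • f)

/-- By cyclic symmetry of the bracket the deformation equations need to be checked only on the
components `(i, 0, 0)` and `(i, 1, 1)`. -/
theorem isDeformation_series {P₁ P₂ : MatOp M} {k : ℕ} (hk : k ≤ 2)
    (h₁ : IsSkew P₁) (h₁' : HasDegree 2 P₁)
    (h₂ : IsSkew P₂) (h₂' : HasDegree 3 P₂)
    (e₁ : ∀ i b c, (bracketTerm P₁ (poisson0 M) i 0 0 b c
        + bracketTerm (poisson0 M) P₁ i 0 0 b c = 0) ∧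
      bracketTerm P₁ (poisson0 M) i 1 1 b c + bracketTerm (poisson0 M) P₁ i 1 1 b c = 0)
    (e₂ : k = 2 → ∀ i b c, (bracketTerm (poisson0 M) P₂ i 0 0 b c
        + bracketTerm P₂ (poisson0 M) i 0 0 b c + bracketTerm P₁ P₁ i 0 0 b c = 0) ∧
      bracketTerm (poisson0 M) P₂ i 1 1 b c + bracketTerm P₂ (poisson0 M) i 1 1 b c
        + bracketTerm P₁ P₁ i 1 1 b c = 0) :
    IsDeformation k (series (poisson0 M) P₁ P₂) := by
  have hskew : ∀ n, IsSkew (series (poisson0 M) P₁ P₂ n) := by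
    intro n
    match n with
    | 0 => exact isSkew_poisson0
    | 1 => exact h₁
    | 2 => exact h₂
    | _ + 3 => exact isSkew_zero
  refine ⟨rfl, fun n => ?_, hskew, fun n hn => ?_⟩
  · match n with
    | 0 => exact hasDegree_poisson0
    | 1 => exact h₁'
    | 2 => exact h₂'
    | n + 3 => exact hasDegree_zero _
  · refine sum_schouten_eq_zero (P := fun a : ℕ × ℕ => series (poisson0 M) P₁ P₂ a.1)
      (Q := fun a => series (poisson0 M) P₁ P₂ a.2) (fun a => hskew _) (fun a => hskew _)
      fun i b c => ?_
    have e0 := bracketTerm_poisson0_poisson0 (M := M) i b c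
    have e1 := e₁ i b c
    match n, hn with
    | 0, _ =>
      simp only [Finset.Nat.antidiagonal_zero, Finset.sum_singleton, series]
      exact ⟨by linear_combination 2 * e0.1, by linear_combination 2 * e0.2⟩
    | 1, _ =>
      simp only [Finset.Nat.antidiagonal_succ, Finset.Nat.antidiagonal_zero, Finset.sum_cons,
        Finset.map_singleton, Finset.sum_singleton, Function.Embedding.prodMap,
        Function.Embedding.coeFn_mk, Prod.map, Function.Embedding.refl_apply, series]
      exact ⟨by linear_combination 2 * e1.1, by linear_combination 2 * e1.2⟩
    | 2, hn =>
      have e2 := e₂ (le_antisymm hk hn) i b c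
      simp only [Finset.Nat.antidiagonal_succ, Finset.Nat.antidiagonal_zero, Finset.sum_cons,
        Finset.map_singleton, Finset.sum_singleton, Function.Embedding.prodMap, Finset.map_cons,
        Function.Embedding.coeFn_mk, Prod.map, Function.Embedding.refl_apply, series]
      exact ⟨by linear_combination 2 * e2.1, by linear_combination 2 * e2.2⟩
    | n + 3, hn => exact absurd (hn.trans hk) (by lia)

/-- The first normal form is an infinitesimal deformation. -/
theorem isDeformation_normalForm1 {r s : Coeff M} (hr : IsFunOfU2 r) (hs : IsFunOfU2 s) :
    IsDeformation 1 (series (poisson0 M) (normalForm1 r s) 0) := by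
  obtain ⟨ρ, h0, rfl⟩ := hr.exists_ofNat_mul 12
  exact isDeformation_series one_le_two (isSkew_normalForm1 ρ s) (hasDegree_normalForm1 ρ s)
    isSkew_zero (hasDegree_zero 3)
    (fun i b c => bracketTerm_poisson0_normalForm1 h0 (isFunOfU2_iff.1 hs) i b c)
    fun h => absurd h (by lia)

/-- The second normal form extends the first one to a deformation of second order. -/
theorem isDeformation_normalForm2 {r s p : Coeff M} (hr : IsFunOfU2 r) (hs : IsFunOfU2 s)
    (hp : IsFunOfU2 p) :
    IsDeformation 2 (series (poisson0 M) (normalForm1 r s) (normalForm2 r s p)) := by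
  obtain ⟨ρ, h0, rfl⟩ := hr.exists_ofNat_mul 12
  obtain ⟨π, h2, rfl⟩ := hp.exists_ofNat_mul 2
  have h1 := isFunOfU2_iff.1 hs
  refine isDeformation_series le_rfl (isSkew_normalForm1 ρ s) (hasDegree_normalForm1 ρ s)
    (isSkew_normalForm2 h0 h1 h2) (hasDegree_normalForm2 ρ s π)
    (fun i b c => bracketTerm_poisson0_normalForm1 h0 h1 i b c) fun _ i b c => ?_
  match i with
  | 0 => exact ⟨bracketTerm_normalForm2_zero_zero_zero ρ s π b c,
      bracketTerm_normalForm2_zero_one_one h0 h1 h2 b c⟩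
  | 1 => exact ⟨bracketTerm_normalForm2_one_zero_zero h0 h1 b c,
      bracketTerm_normalForm2_one_one_one h0 h1 h2 b c⟩

end NormalFormProperties

/-! ### Homogeneous differential polynomials of low degree -/

section LowDegree

open MvPolynomial

variable {M : CoordBox}

theorem isHomogeneousDP_zero_iff {F : DiffPoly M} : IsHomogeneousDP 0 F ↔ ∃ f, F = C f := by
  constructor
  · intro h
    refine ⟨coeff 0 F, MvPolynomial.ext _ _ fun m => ?_⟩
    classical
    rw [coeff_C]
    split_ifs with hm
    · rw [hm]
    · by_contra hne
      have h1 := h hne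
      obtain ⟨v, hv⟩ := Finsupp.ne_iff.1 (Ne.symm hm)
      have := Finsupp.le_weight (fun v : Fin 2 × ℕ => v.2 + 1) (Nat.succ_ne_zero v.2) m
      rw [h1] at this
      exact hv (Nat.le_zero.1 this)
  · rintro ⟨f, rfl⟩
    exact isWeightedHomogeneous_C _ f

theorem IsHomogeneousDP.exists_sum {n : ℕ} {F : DiffPoly M} (h : IsHomogeneousDP (n + 1) F) :
    ∃ G : Fin 2 → ℕ → DiffPoly M, (∀ i k, k ≤ n → IsHomogeneousDP (n - k) (G i k)) ∧
      F = ∑ k ∈ Finset.range (n + 1), (G 0 k * X (0, k) + G 1 k * X (1, k)) := by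
  induction h using IsWeightedHomogeneous.induction_on with
  | zero => exact ⟨0, fun _ _ _ => isWeightedHomogeneous_zero _ _ _, by simp⟩
  | add p q hp hq hp' hq' =>
    obtain ⟨G, hG, eG⟩ := hp'
    obtain ⟨H, hH, eH⟩ := hq'
    refine ⟨G + H, fun i k hk => (hG i k hk).add (hH i k hk), ?_⟩
    conv_lhs => rw [eG, eH]
    rw [← Finset.sum_add_distrib]
    refine Finset.sum_congr rfl fun k _ => ?_
    simp only [Pi.add_apply]
    ring
  | monomial m r hm =>
    have h0 : m ≠ 0 := by
      rintro rfl
      rw [map_zero] at hm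
      exact absurd hm (by lia)
    obtain ⟨⟨i, k⟩, hv⟩ := Finsupp.ne_iff.1 h0
    have hle : Finsupp.single (i, k) 1 ≤ m :=
      Finsupp.single_le_iff.2 (Nat.one_le_iff_ne_zero.2 hv)
    have hsplit : (m - Finsupp.single (i, k) 1) + Finsupp.single (i, k) 1 = m :=
      tsub_add_cancel_of_le hle
    have hw := hm
    rw [← hsplit, map_add, Finsupp.weight_single, one_smul] at hw
    dsimp only at hw
    have hk : k < n + 1 := by lia
    have e : (monomial m r : DiffPoly M) = monomial (m - Finsupp.single (i, k) 1) r * X (i, k) := by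
      rw [X, monomial_mul, hsplit, mul_one]
    refine ⟨Pi.single i (Pi.single k (monomial (m - Finsupp.single (i, k) 1) r)),
      fun j l hl => ?_, ?_⟩
    · by_cases hj : j = i
      · subst hj
        rw [Pi.single_eq_same]
        by_cases hl' : l = k
        · subst hl'
          rw [Pi.single_eq_same]
          exact isWeightedHomogeneous_monomial _ _ _ (by lia)
        · rw [Pi.single_eq_of_ne hl']
          exact isWeightedHomogeneous_zero _ _ _
      · rw [Pi.single_eq_of_ne hj]
        exact isWeightedHomogeneous_zero _ _ _
    · rw [e, Finset.sum_eq_single k]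
      · fin_cases i <;> simp
      · intro l _ hl
        fin_cases i <;> simp [Pi.single_eq_of_ne hl]
      · exact fun h => absurd (Finset.mem_range.2 hk) h

theorem IsHomogeneousDP.exists_eq_one {F : DiffPoly M} (h : IsHomogeneousDP 1 F) :
    ∃ f0 f1 : Coeff M, F = C f0 * X (0, 0) + C f1 * X (1, 0) := by
  obtain ⟨G, hG, e⟩ := IsHomogeneousDP.exists_sum h
  obtain ⟨f0, h0⟩ := isHomogeneousDP_zero_iff.1 (hG 0 0 le_rfl)
  obtain ⟨f1, h1⟩ := isHomogeneousDP_zero_iff.1 (hG 1 0 le_rfl)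
  exact ⟨f0, f1, by rw [e, Finset.sum_range_one, h0, h1]⟩

theorem IsHomogeneousDP.exists_eq_two {F : DiffPoly M} (h : IsHomogeneousDP 2 F) :
    ∃ f0 f1 f2 f3 f4 : Coeff M, F = C f0 * X (0, 1) + C f1 * X (1, 1) + C f2 * X (0, 0) ^ 2 +
      C f3 * X (0, 0) * X (1, 0) + C f4 * X (1, 0) ^ 2 := by
  obtain ⟨G, hG, e⟩ := IsHomogeneousDP.exists_sum h
  obtain ⟨f0, h0⟩ := isHomogeneousDP_zero_iff.1 (hG 0 1 le_rfl)
  obtain ⟨f1, h1⟩ := isHomogeneousDP_zero_iff.1 (hG 1 1 le_rfl)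
  obtain ⟨g0, g1, h2⟩ := IsHomogeneousDP.exists_eq_one (hG 0 0 (Nat.zero_le _))
  obtain ⟨g2, g3, h3⟩ := IsHomogeneousDP.exists_eq_one (hG 1 0 (Nat.zero_le _))
  refine ⟨f0, f1, g0, g1 + g2, g3, ?_⟩
  rw [e, Finset.sum_range_succ, Finset.sum_range_one, h0, h1, h2, h3, C_add]
  ring

theorem IsHomogeneousDP.exists_eq_three {F : DiffPoly M} (h : IsHomogeneousDP 3 F) :
    ∃ f0 f1 f2 f3 f4 f5 f6 f7 f8 f9 : Coeff M,
      F = C f0 * X (0, 2) + C f1 * X (1, 2) + C f2 * X (0, 0) * X (0, 1) +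
        C f3 * X (0, 0) * X (1, 1) + C f4 * X (1, 0) * X (0, 1) + C f5 * X (1, 0) * X (1, 1) +
        C f6 * X (0, 0) ^ 3 + C f7 * X (0, 0) ^ 2 * X (1, 0) + C f8 * X (0, 0) * X (1, 0) ^ 2 +
        C f9 * X (1, 0) ^ 3 := by
  obtain ⟨G, hG, e⟩ := IsHomogeneousDP.exists_sum h
  obtain ⟨f0, h0⟩ := isHomogeneousDP_zero_iff.1 (hG 0 2 le_rfl)
  obtain ⟨f1, h1⟩ := isHomogeneousDP_zero_iff.1 (hG 1 2 le_rfl)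
  obtain ⟨g0, g1, h2⟩ := IsHomogeneousDP.exists_eq_one (hG 0 1 (by lia))
  obtain ⟨g2, g3, h3⟩ := IsHomogeneousDP.exists_eq_one (hG 1 1 (by lia))
  obtain ⟨k0, k1, k2, k3, k4, h4⟩ := IsHomogeneousDP.exists_eq_two (hG 0 0 (Nat.zero_le _))
  obtain ⟨l0, l1, l2, l3, l4, h5⟩ := IsHomogeneousDP.exists_eq_two (hG 1 0 (Nat.zero_le _))
  refine ⟨f0, f1, g0 + k0, g2 + k1, g1 + l0, g3 + l1, k2, k3 + l2, k4 + l3, l4, ?_⟩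
  rw [e, Finset.sum_range_succ, Finset.sum_range_succ, Finset.sum_range_one, h0, h1, h2, h3, h4,
    h5]
  simp only [C_add]
  ring

/-! ### Skew-adjoint scalar operators of low degree -/

theorem two_mul_cancel {x y : DiffPoly M} (h : 2 * x = 2 * y) : x = y := by
  have h2 : ∀ z : DiffPoly M, (1 / 2 : ℝ) • (2 * z) = z := fun z => by
    rw [two_mul, ← two_smul ℝ z, smul_smul, one_div_mul_cancel two_ne_zero, one_smul]
  rw [← h2 x, h, h2]

theorem coeffs_of_cubic (a0 a1 a2 a3 : DiffPoly M) (m : ℕ) :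
    (Polynomial.C a3 * Polynomial.X ^ 3 + Polynomial.C a2 * Polynomial.X ^ 2 +
      Polynomial.C a1 * Polynomial.X + Polynomial.C a0 : DiffOp M).coeff m =
      if m = 0 then a0 else if m = 1 then a1 else if m = 2 then a2 else
        if m = 3 then a3 else 0 := by
  rw [Polynomial.coeff_add, Polynomial.coeff_add, Polynomial.coeff_add,
    Polynomial.coeff_C_mul_X_pow, Polynomial.coeff_C_mul_X_pow, Polynomial.coeff_C_mul_X,
    Polynomial.coeff_C]
  split_ifs <;> first | lia | simp

theorem HasDegree.eq_three {P : MatOp M} (h : HasDegree 3 P) (i j : Fin 2) :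
    P i j = Polynomial.C ((P i j).coeff 3) * Polynomial.X ^ 3 +
      Polynomial.C ((P i j).coeff 2) * Polynomial.X ^ 2 +
      Polynomial.C ((P i j).coeff 1) * Polynomial.X + Polynomial.C ((P i j).coeff 0) := by
  refine Polynomial.ext fun m => ?_
  rw [coeffs_of_cubic]
  split_ifs with h0 h1 h2 h3
  · rw [h0]
  · rw [h1]
  · rw [h2]
  · rw [h3]
  · exact (h i j m).2 (by lia)

theorem HasDegree.eq_two {P : MatOp M} (h : HasDegree 2 P) (i j : Fin 2) :
    P i j = Polynomial.C ((P i j).coeff 2) * Polynomial.X ^ 2 +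
      Polynomial.C ((P i j).coeff 1) * Polynomial.X + Polynomial.C ((P i j).coeff 0) := by
  refine Polynomial.ext fun m => ?_
  have := coeffs_of_cubic ((P i j).coeff 0) ((P i j).coeff 1) ((P i j).coeff 2) 0 m
  rw [Polynomial.C_0, zero_mul, zero_add] at this
  rw [this]
  split_ifs with h0 h1 h2
  · rw [h0]
  · rw [h1]
  · rw [h2]
  · exact (h i j m).2 (by lia)
  · exact (h i j m).2 (by lia)

theorem skew_coeff_relations {a0 a1 a2 a3 : DiffPoly M} {p : DiffOp M}
    (hp : p = Polynomial.C a3 * Polynomial.X ^ 3 + Polynomial.C a2 * Polynomial.X ^ 2 +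
      Polynomial.C a1 * Polynomial.X + Polynomial.C a0) (hskew : adjOp p = -p) :
    2 * a2 = 3 * totalD a3 ∧
      2 * a0 = totalD a1 - totalD (totalD a2) + totalD (totalD (totalD a3)) := by
  have h : Polynomial.C (2 * a2 - 3 * totalD a3) * Polynomial.X ^ 2 +
      Polynomial.C (2 * totalD a2 - 3 * totalD (totalD a3)) * Polynomial.X +
      Polynomial.C (2 * a0 - (totalD a1 - totalD (totalD a2) + totalD (totalD (totalD a3)))) =
      (0 : DiffOp M) := by
    refine opAct_injective fun b => ?_
    have e : adjAct p b = -opAct p b := by rw [adjAct, hskew, opAct_neg]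
    rw [hp] at e
    simp only [adjAct_rules, operator_rules, totalD_rules] at e ⊢
    linear_combination e
  have key := coeffs_of_cubic (2 * a0 - (totalD a1 - totalD (totalD a2) +
    totalD (totalD (totalD a3)))) (2 * totalD a2 - 3 * totalD (totalD a3))
    (2 * a2 - 3 * totalD a3) 0
  rw [Polynomial.C_0, zero_mul, zero_add, h] at key
  exact ⟨sub_eq_zero.1 (key 2).symm, sub_eq_zero.1 (key 0).symm⟩

theorem exists_two_mul_eq {d : ℕ} {F : DiffPoly M} (h : IsHomogeneousDP d F) :
    ∃ G, IsHomogeneousDP d G ∧ 2 * G = F := by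
  refine ⟨C (algebraMap ℝ (Coeff M) (1 / 2)) * F, h.C_mul _, ?_⟩
  rw [← algebraMap_eq_C, ← Algebra.smul_def, two_mul, ← two_smul ℝ, smul_smul,
    mul_one_div_cancel two_ne_zero, one_smul]

theorem IsHomogeneousDP.totalD {d : ℕ} {F : DiffPoly M} (h : IsHomogeneousDP d F) :
    IsHomogeneousDP (d + 1) (totalD F) := by
  have h0 := (totalDer (M := M)).map_natCast d
  rw [totalDer_apply] at h0
  rw [isHomogeneousDP_iff] at h ⊢
  rw [eulerDer_totalD, h, totalD_mul, h0]
  push_cast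
  ring

/-- The general skew-adjoint scalar operator of degree 3. -/
theorem IsSkew.exists_eq_three {P : MatOp M} (hs : IsSkew P) (h : HasDegree 3 P) (i : Fin 2) :
    ∃ (f : Coeff M) (A : DiffPoly M), IsHomogeneousDP 2 A ∧
      P i i = Polynomial.C (2 * C f) * Polynomial.X ^ 3 +
        Polynomial.C (3 * DegPoisson.totalD (C f)) * Polynomial.X ^ 2 +
        Polynomial.C (2 * A + 3 * DegPoisson.totalD (DegPoisson.totalD (C f))) * Polynomial.X +
        Polynomial.C (DegPoisson.totalD A +
          DegPoisson.totalD (DegPoisson.totalD (DegPoisson.totalD (C f)))) := by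
  obtain ⟨e2, e0⟩ := skew_coeff_relations (h.eq_three i i) (hs i i)
  obtain ⟨F, hF, eF⟩ := exists_two_mul_eq ((h i i 3).1 le_rfl)
  obtain ⟨f, rfl⟩ := isHomogeneousDP_zero_iff.1 hF
  have hA : IsHomogeneousDP 2 ((P i i).coeff 1 -
      3 * DegPoisson.totalD (DegPoisson.totalD (C f))) := by
    refine ((h i i 1).1 (by lia)).sub ?_
    rw [← map_ofNat C 3]
    exact hF.totalD.totalD.C_mul _
  obtain ⟨A, hA, eA⟩ := exists_two_mul_eq hA
  have e1 : (P i i).coeff 1 = 2 * A + 3 * DegPoisson.totalD (DegPoisson.totalD (C f)) := by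
    linear_combination -eA
  have e2' : (P i i).coeff 2 = 3 * DegPoisson.totalD (C f) := by
    refine two_mul_cancel ?_
    rw [e2, ← eF]
    simp only [totalD_rules, totalD_ofNat]
    ring
  refine ⟨f, A, hA, ?_⟩
  rw [← e1, ← e2', eF]
  conv_lhs => rw [h.eq_three i i]
  refine congrArg (fun F => _ + Polynomial.C F) (two_mul_cancel ?_)
  rw [e0, e1, e2', ← eF]
  simp only [totalD_add, totalD_mul, totalD_ofNat, totalD_zero]
  ring

/-- The general skew-adjoint scalar operator of degree 2. -/
theorem IsSkew.exists_eq_two {P : MatOp M} (hs : IsSkew P) (h : HasDegree 2 P) (i : Fin 2) :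
    ∃ A : DiffPoly M, IsHomogeneousDP 1 A ∧
      P i i = Polynomial.C (2 * A) * Polynomial.X + Polynomial.C (DegPoisson.totalD A) := by
  have h2 := h.eq_two i i
  obtain ⟨e2, e0⟩ := skew_coeff_relations (a3 := 0) (a2 := (P i i).coeff 2)
    (a1 := (P i i).coeff 1) (a0 := (P i i).coeff 0) (by
      rw [Polynomial.C_0, zero_mul, zero_add]; exact h2) (hs i i)
  have e2' : (P i i).coeff 2 = 0 := two_mul_cancel (by rw [e2, totalD_zero, mul_zero, mul_zero])
  rw [e2', Polynomial.C_0, zero_mul, zero_add] at h2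
  obtain ⟨A, hA, eA⟩ := exists_two_mul_eq ((h i i 1).1 (by lia))
  refine ⟨A, hA, ?_⟩
  rw [eA]
  conv_lhs => rw [h2]
  refine congrArg (fun F => _ + Polynomial.C F) (two_mul_cancel ?_)
  rw [e0, e2', ← eA]
  simp only [totalD_mul, totalD_ofNat, totalD_zero]
  ring

end LowDegree

/-! ### Infinitesimal deformations and trivial deformations -/

section Cocycles

open MvPolynomial

variable {M : CoordBox}

theorem opAct_lieDer (ξ : VecField M) (P : MatOp M) (i j : Fin 2) (b : DiffPoly M) :
    opAct (lieDer ξ P i j) b = opDer ξ (P i j) b - evol (fun l => opAct (P l j) b) (ξ i)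
      - (opAct (P i 0) (adjLin 0 (ξ j) b) + opAct (P i 1) (adjLin 1 (ξ j) b)) := by
  have h1 := congrFun (matAct_lieDer ξ P (Pi.single j b)) i
  have hc : covLie ξ (Pi.single j b) =
      Pi.single j (evol ξ b) + fun k => adjLin k (ξ j) b := by
    funext k
    rw [covLie, Pi.add_apply, Finset.sum_eq_single j (fun m _ hm => by
      rw [Pi.single_eq_of_ne hm, adjAct_zero_right])
      (fun h => absurd (Finset.mem_univ j) h), Pi.single_eq_same]
    refine congrArg (· + _) ?_
    by_cases hk : k = j
    · subst hk; simp
    · simp [Pi.single_eq_of_ne hk, evol_zero]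
  rw [hc, matAct_add_right, matAct_single, matAct_single, matAct_single] at h1
  refine h1.trans ?_
  simp only [Pi.sub_apply, Pi.add_apply, vbracket_apply, opDer_eq, matAct, Fin.sum_univ_two]
  ring

theorem jacobiForm_swap (P Q : MatOp M) (a b c : Fin 2 → DiffPoly M) :
    jacobiForm P Q a b c = jacobiForm Q P a b c := by
  simp only [jacobiForm]
  abel

theorem opAct_smul_right (c : ℝ) (p : DiffOp M) (b : DiffPoly M) :
    opAct p (c • b) = c • opAct p b := by
  simp only [opAct, Polynomial.sum_def, iterate_totalD_smul, mul_smul_comm, Finset.smul_sum]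

theorem matAct_add (P Q : MatOp M) (b : Fin 2 → DiffPoly M) :
    matAct (P + Q) b = matAct P b + matAct Q b := by
  funext i
  simp only [matAct, Pi.add_apply, opAct_add, Finset.sum_add_distrib]

theorem matAct_smul (c : ℝ) (P : MatOp M) (b : Fin 2 → DiffPoly M) :
    matAct (c • P) b = c • matAct P b := by
  funext i
  simp only [matAct, Pi.smul_apply, opAct_smul, Finset.smul_sum]

theorem opDer_smul (η : VecField M) (c : ℝ) (p : DiffOp M) (b : DiffPoly M) :
    opDer η (c • p) b = c • opDer η p b := by
  simp only [opDer_eq, opAct_smul, evol_smul, smul_sub]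

theorem opDer_smul_left (c : ℝ) (η : VecField M) (p : DiffOp M) (b : DiffPoly M) :
    opDer (c • η) p b = c • opDer η p b := by
  simp only [opDer_eq, opAct_smul_right, evol_smul_left, smul_sub]

theorem schoutenForm_add_left (P P' Q : MatOp M) (a b c : Fin 2 → DiffPoly M) :
    schoutenForm (P + P') Q a b c = schoutenForm P Q a b c + schoutenForm P' Q a b c := by
  rw [schoutenForm, schoutenForm, schoutenForm, ← map_add]
  simp only [Pi.add_apply, opDer_add, mul_add, Finset.sum_add_distrib]

theorem schoutenForm_add_right (P Q Q' : MatOp M) (a b c : Fin 2 → DiffPoly M) :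
    schoutenForm P (Q + Q') a b c = schoutenForm P Q a b c + schoutenForm P Q' a b c := by
  rw [schoutenForm, schoutenForm, schoutenForm, ← map_add]
  simp only [matAct_add, opDer_add_left, mul_add, Finset.sum_add_distrib]

theorem schoutenForm_smul_left (r : ℝ) (P Q : MatOp M) (a b c : Fin 2 → DiffPoly M) :
    schoutenForm (r • P) Q a b c = r • schoutenForm P Q a b c := by
  rw [schoutenForm, schoutenForm, ← map_smul]
  simp only [Pi.smul_apply, opDer_smul, ← Finset.smul_sum, mul_smul_comm]

theorem schoutenForm_smul_right (r : ℝ) (P Q : MatOp M) (a b c : Fin 2 → DiffPoly M) :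
    schoutenForm P (r • Q) a b c = r • schoutenForm P Q a b c := by
  rw [schoutenForm, schoutenForm, ← map_smul]
  simp only [matAct_smul, opDer_smul_left, ← Finset.smul_sum, mul_smul_comm]

theorem jacobiForm_add_left (P P' Q : MatOp M) (a b c : Fin 2 → DiffPoly M) :
    jacobiForm (P + P') Q a b c = jacobiForm P Q a b c + jacobiForm P' Q a b c := by
  simp only [jacobiForm, schoutenForm_add_left, schoutenForm_add_right]
  abel

theorem jacobiForm_smul_left (r : ℝ) (P Q : MatOp M) (a b c : Fin 2 → DiffPoly M) :
    jacobiForm (r • P) Q a b c = r • jacobiForm P Q a b c := by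
  simp only [jacobiForm, schoutenForm_smul_left, schoutenForm_smul_right, smul_add]

theorem jacobiForm_add_right (P Q Q' : MatOp M) (a b c : Fin 2 → DiffPoly M) :
    jacobiForm P (Q + Q') a b c = jacobiForm P Q a b c + jacobiForm P Q' a b c := by
  rw [jacobiForm_swap, jacobiForm_add_left, jacobiForm_swap Q, jacobiForm_swap Q']

theorem MatOp.ext_opAct {P Q : MatOp M} (h : ∀ i j b, opAct (P i j) b = opAct (Q i j) b) :
    P = Q := by
  funext i j
  exact opAct_injective fun b => h i j b

theorem lieDer_add_left (ξ η : VecField M) (P : MatOp M) :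
    lieDer (ξ + η) P = lieDer ξ P + lieDer η P := MatOp.ext_opAct fun i j b => by
  simp only [Pi.add_apply, opAct_add, opAct_lieDer, opDer_add_left, evol_add, adjLin_add,
    opAct_add_right]
  ring

theorem lieDer_add (ξ : VecField M) (P Q : MatOp M) :
    lieDer ξ (P + Q) = lieDer ξ P + lieDer ξ Q := MatOp.ext_opAct fun i j b => by
  have h : (fun l => opAct (P l j) b + opAct (Q l j) b) =
      (fun l => opAct (P l j) b) + fun l => opAct (Q l j) b := rfl
  simp only [Pi.add_apply, opAct_add, opAct_lieDer, opDer_add, h, evol_add_left]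
  ring

theorem lieDer_zero_left (P : MatOp M) : lieDer 0 P = 0 := by
  have := lieDer_add_left (0 : VecField M) 0 P
  rwa [add_zero, left_eq_add] at this

theorem IsSkew.add {P Q : MatOp M} (hP : IsSkew P) (hQ : IsSkew Q) : IsSkew (P + Q) := by
  rw [isSkew_iff] at *
  intro a b
  have h : ∀ a b c : Fin 2 → DiffPoly M, dotp a (b + c) = dotp a b + dotp a c := fun a b c => by
    simp only [dotp, Pi.add_apply, mul_add, Finset.sum_add_distrib]
  rw [matAct_add, h, map_add, hP, hQ, matAct_add, h, map_add, neg_add]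

theorem IsSkew.smul {P : MatOp M} (hP : IsSkew P) (r : ℝ) : IsSkew (r • P) := by
  rw [isSkew_iff] at *
  intro a b
  have h : ∀ a b : Fin 2 → DiffPoly M, dotp a (r • b) = r • dotp a b := fun a b => by
    simp only [dotp, Pi.smul_apply, mul_smul_comm, Finset.smul_sum]
  rw [matAct_smul, h, map_smul, hP, matAct_smul, h, map_smul, smul_neg]

theorem HasDegree.add {d : ℕ} {P Q : MatOp M} (hP : HasDegree d P) (hQ : HasDegree d Q) :
    HasDegree d (P + Q) :=
  hasDegree_iff.2 fun i j => (hasDegree_iff.1 hP i j).add (hasDegree_iff.1 hQ i j)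

theorem HasDegree.smul {d : ℕ} {P : MatOp M} (hP : HasDegree d P) (r : ℝ) :
    HasDegree d (r • P) :=
  hasDegree_iff.2 fun i j b => by
    have h : ∀ F : DiffPoly M, eulerDer (r • F) = r • eulerDer F := fun F => by
      rw [Algebra.smul_def, Algebra.smul_def, eulerDer_mul, algebraMap_eq_C, eulerDer_C, mul_zero,
        add_zero]
    simp only [Pi.smul_apply, opAct_smul, h, hasDegree_iff.1 hP i j b, smul_add, mul_smul_comm]

/-- Bivectors of degree `d` that commute with the undeformed structure. -/
structure IsCocycle (d : ℕ) (P : MatOp M) : Prop where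
  isSkew : IsSkew P
  hasDegree : HasDegree d P
  jacobi : ∀ a b c, jacobiForm P (poisson0 M) a b c = 0

theorem IsCocycle.add {d : ℕ} {P Q : MatOp M} (hP : IsCocycle d P) (hQ : IsCocycle d Q) :
    IsCocycle d (P + Q) :=
  ⟨hP.isSkew.add hQ.isSkew, hP.hasDegree.add hQ.hasDegree, fun a b c => by
    rw [jacobiForm_add_left, hP.jacobi, hQ.jacobi, add_zero]⟩

theorem eq_zero_of_add_self {V : Type*} [AddCommGroup V] [Module ℝ V] {x : V} (h : x + x = 0) :
    x = 0 := by
  rw [← two_smul ℝ] at h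
  exact (smul_eq_zero_iff_right two_ne_zero).1 h

theorem jacobiForm_poisson0 (a b c : Fin 2 → DiffPoly M) :
    jacobiForm (poisson0 M) (poisson0 M) a b c = 0 := by
  have := (sum_schouten_eq_zero_iff {()} (fun _ => poisson0 M) (fun _ => poisson0 M)).1
    (sum_schouten_eq_zero (fun _ => isSkew_poisson0) (fun _ => isSkew_poisson0) fun i b c => by
      have e0 := bracketTerm_poisson0_poisson0 (M := M) i b c
      simp only [Finset.sum_singleton]
      exact ⟨by linear_combination 2 * e0.1, by linear_combination 2 * e0.2⟩) a b c
  simpa only [Finset.sum_singleton] using this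

/-- Lie derivatives of the undeformed structure are cocycles. -/
theorem isCocycle_lieDer {n : ℕ} {ξ : VecField M} (hξ : ∀ i, IsHomogeneousDP n (ξ i)) :
    IsCocycle (n + 1) (lieDer ξ (poisson0 M)) := by
  refine ⟨isSkew_poisson0.lieDer ξ, hasDegree_poisson0.lieDer hξ, fun a b c => ?_⟩
  have := jacobiForm_lieDer_add isSkew_poisson0 isSkew_poisson0 jacobiForm_poisson0 ξ a b c
  rw [jacobiForm_swap (poisson0 M)] at this
  exact eq_zero_of_add_self this

theorem IsCocycle.add_lieDer {n : ℕ} {P : MatOp M} (hP : IsCocycle (n + 1) P) {ξ : VecField M}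
    (hξ : ∀ i, IsHomogeneousDP n (ξ i)) : IsCocycle (n + 1) (P + lieDer ξ (poisson0 M)) :=
  hP.add (isCocycle_lieDer hξ)

end Cocycles

/-! ### Extraction of coefficients -/

section Extraction

open MvPolynomial

variable {M : CoordBox}

/-- Evaluation of the jet variables at functions on the domain. -/
def jetEval (x : Fin 2 × ℕ → Coeff M) : DiffPoly M →+* Coeff M := eval₂Hom (RingHom.id _) x

/-- Rules for the evaluation of jet variables. -/
theorem jetEval_rules (x : Fin 2 × ℕ → Coeff M) :
    (∀ F G, jetEval x (F + G) = jetEval x F + jetEval x G) ∧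
    (∀ F G, jetEval x (F - G) = jetEval x F - jetEval x G) ∧
    (∀ F G, jetEval x (F * G) = jetEval x F * jetEval x G) ∧
    (∀ F, jetEval x (-F) = -jetEval x F) ∧
    (∀ F (n : ℕ), jetEval x (F ^ n) = jetEval x F ^ n) ∧
    jetEval x 0 = 0 ∧ jetEval x 1 = 1 ∧
    (∀ f, jetEval x (C f) = f) ∧ (∀ v, jetEval x (X v) = x v) :=
  ⟨map_add _, map_sub _, map_mul _, map_neg _, map_pow _, map_zero _, map_one _,
    eval₂Hom_C _ _, eval₂Hom_X' _ _⟩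

theorem jetEval_ofNat (x : Fin 2 × ℕ → Coeff M) (n : ℕ) [n.AtLeastTwo] :
    jetEval x ofNat(n) = ofNat(n) := map_ofNat _ n

/-- Setting the listed jet variables to `1` and the others to `0`. For a homogeneous differential
polynomial this adds up the coefficients of the monomials in the listed variables.

The cocycle condition for operators of degree at most 3 is evaluated below on the test function
`X (0, 10)`, whose derivatives do not occur in the coefficients of the operators; thus the jet
variable `(0, 10 + m)` in a list selects the terms with `m` derivatives on the test function. -/
def jetPoint (s : List (Fin 2 × ℕ)) (v : Fin 2 × ℕ) : Coeff M := if v ∈ s then 1 else 0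

/-- Arithmetic needed to decide which jet variables are listed. -/
theorem jetPoint_rules :
    (∀ v : Fin 2 × ℕ, jetPoint [] v = (0 : Coeff M)) ∧
    (∀ (i : Fin 2) (k : ℕ) (s : List (Fin 2 × ℕ)), jetPoint ((i, k) :: s) (i, k) = (1 : Coeff M)) ∧
    (∀ (k l : ℕ) (s : List (Fin 2 × ℕ)),
      jetPoint ((0, k) :: s) (1, l) = (jetPoint s (1, l) : Coeff M)) ∧
    (∀ (k l : ℕ) (s : List (Fin 2 × ℕ)),
      jetPoint ((1, k) :: s) (0, l) = (jetPoint s (0, l) : Coeff M)) := by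
  refine ⟨fun v => if_neg (by simp), fun i k s => if_pos (by simp), fun k l s => ?_,
    fun k l s => ?_⟩ <;> simp [jetPoint]

theorem jetPoint_ne {k l : ℕ} (h : (l == k) = false) (i : Fin 2) (s : List (Fin 2 × ℕ)) :
    jetPoint ((i, k) :: s) (i, l) = (jetPoint s (i, l) : Coeff M) := by
  simp [jetPoint, ne_of_beq_false h]

/-- The components of the cocycle condition. -/
theorem IsCocycle.component {d : ℕ} {P : MatOp M} (h : IsCocycle d P) (i j k : Fin 2)
    (b c : DiffPoly M) :
    bracketTerm P (poisson0 M) i j k b c + bracketTerm (poisson0 M) P i j k b c = 0 :=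
  bracketTerm_add_eq_zero h.isSkew isSkew_poisson0 h.jacobi i j k b c

end Extraction

/-! ### Normalization of the first diagonal entry -/

section FirstEntry

open MvPolynomial

variable {M : CoordBox}

theorem Coeff.exists_natCast_mul_eq {n : ℕ} (hn : n ≠ 0) (g : Coeff M) :
    ∃ x : Coeff M, (n : Coeff M) * x = g :=
  ⟨(n : ℝ)⁻¹ • g, by
    rw [← map_natCast (algebraMap ℝ (Coeff M)), ← Algebra.smul_def, smul_smul,
      mul_inv_cancel₀ (Nat.cast_ne_zero.2 hn), one_smul]⟩

/-- Solvability of the linear equations `∂x/∂u¹ + n x/u¹ = g`, by the integrating factor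
`(u¹)ⁿ`. These are the equations for the gauge transformations. -/
theorem exists_pderivCoeff_add_mul_eq (n : ℕ) (g : Coeff M) :
    ∃ x : Coeff M, pderivCoeff 0 x + n * invU1 M * x = g := by
  obtain ⟨W, hW⟩ := exists_pderivCoeff_zero_eq (coordU1 M ^ n * g)
  refine ⟨invU1 M ^ n * W, ?_⟩
  have h1 : invU1 M ^ n * coordU1 M ^ n = 1 := by
    rw [← mul_pow, mul_comm, coordU1_mul_invU1, one_pow]
  have h2 : pderivCoeff 0 (invU1 M ^ n) = -(n * invU1 M * invU1 M ^ n) := by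
    rcases n with _ | n
    · simp only [coeff_rules, Nat.cast_zero, zero_mul, neg_zero, pow_zero]
    · simp only [coeff_rules, Nat.add_sub_cancel]
      ring
  rw [pderivCoeff_mul, h2, hW]
  linear_combination g * h1

theorem isHomogeneousDP_one (f0 f1 : Coeff M) :
    IsHomogeneousDP 1 (C f0 * X (0, 0) + C f1 * X (1, 0)) := by
  rw [isHomogeneousDP_iff]
  simp only [eulerDer_rules]
  push_cast
  ring

theorem isHomogeneousDP_two (f0 f1 f2 f3 f4 : Coeff M) :
    IsHomogeneousDP 2 (C f0 * X (0, 1) + C f1 * X (1, 1) + C f2 * X (0, 0) ^ 2 +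
        C f3 * X (0, 0) * X (1, 0) + C f4 * X (1, 0) ^ 2) := by
  rw [isHomogeneousDP_iff]
  simp only [eulerDer_rules]
  push_cast
  ring

/-- A first-order infinitesimal deformation can be gauged to one with `P¹¹ = 0`. The `u²_x` part
of `P¹¹` is removed by a vector field along `u¹`; its `u¹_x` part vanishes by the cocycle
condition. -/
theorem IsCocycle.exists_lieDer_zero_zero_of_two {P : MatOp M} (h : IsCocycle 2 P) :
    ∃ ξ : VecField M, (∀ i, IsHomogeneousDP 1 (ξ i)) ∧ (P + lieDer ξ (poisson0 M)) 0 0 = 0 := by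
  obtain ⟨A, hA, h00⟩ := h.isSkew.exists_eq_two h.hasDegree 0
  obtain ⟨f0, f1, rfl⟩ := hA.exists_eq_one
  obtain ⟨x, hx⟩ := exists_pderivCoeff_add_mul_eq 1 f1
  let ξ : VecField M := ![C x * X (1, 0), 0]
  have hξ : ∀ i, IsHomogeneousDP 1 (ξ i) := by
    intro i
    match i with
    | 0 =>
      have := isHomogeneousDP_one 0 x
      rwa [C_0, zero_mul, zero_add] at this
    | 1 => exact isWeightedHomogeneous_zero _ _ _
  have h' := h.add_lieDer (n := 1) hξ
  refine ⟨ξ, hξ, ?_⟩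
  obtain ⟨A', hA', h00'⟩ := h'.isSkew.exists_eq_two h'.hasDegree 0
  obtain ⟨g0, g1, rfl⟩ := hA'.exists_eq_one
  have hadd : opAct ((P + lieDer ξ (poisson0 M)) 0 0) (X (0, 10)) =
      opAct (P 0 0) (X (0, 10)) + opAct (lieDer ξ (poisson0 M) 0 0) (X (0, 10)) := by
    rw [Pi.add_apply, Pi.add_apply, opAct_add]
  have e := h'.component 0 0 0 (X (0, 10)) 1
  have hξ0 : ξ 0 = C x * X (1, 0) := rfl
  rw [h00', h00, opAct_lieDer] at hadd
  simp only [bracketTerm, poisson0_entries, h00', operator_rules, opAct_zero_right, totalD_rules,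
    evol_rules, adjLin_rules, coeff_rules, totalD_ofNat, evol_ofNat, adjLin_ofNat, zero_mul,
    mul_zero, add_zero, zero_add, Nat.reduceAdd, Nat.reduceSub, Nat.cast_ofNat, pow_one, sub_zero,
    neg_zero, mul_one] at e
  simp only [hξ0, poisson0_entries, operator_rules, opAct_zero_right, totalD_rules, evol_rules,
    adjLin_rules, coeff_rules, totalD_ofNat, evol_ofNat, adjLin_ofNat, zero_mul, mul_zero,
    add_zero, zero_add, Nat.reduceAdd, Nat.reduceSub, Nat.cast_ofNat, pow_one, sub_zero, neg_zero,
    mul_one] at hadd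
  clear_value ξ
  have e1 := congrArg (jetEval (jetPoint [(0, 13)])) e
  simp only [jetEval_rules, jetEval_ofNat, jetPoint_rules, jetPoint_ne, Nat.reduceBEq, zero_mul,
    mul_zero, add_zero, zero_add, sub_zero, neg_zero, mul_one, one_mul] at e1
  have e2 := congrArg (jetEval (jetPoint [(1, 0), (0, 11)])) hadd
  simp only [jetEval_rules, jetEval_ofNat, jetPoint_rules, jetPoint_ne, Nat.reduceBEq, zero_mul,
    mul_zero, add_zero, zero_add, sub_zero, neg_zero, mul_one, one_mul] at e2
  have hg0 : g0 = 0 := Coeff.natCast_mul_eq_zero two_ne_zero (by push_cast; linear_combination -e1)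
  have hg1 : g1 = 0 := Coeff.natCast_mul_eq_zero two_ne_zero (by
    push_cast at hx ⊢; linear_combination e2 - 2 * hx)
  rw [h00', hg0, hg1]
  simp only [coeff_rules, zero_mul, mul_zero, add_zero, totalD_zero, Polynomial.C_0]

/-- The effect of a gauge transformation along `u¹` on those coefficients of a skew-adjoint `P¹¹`
of degree 3 that it can be used to remove. -/
theorem lieDer_zero_zero_coeffs {P P' : MatOp M} {ξ : VecField M}
    {f f' f0 f1 f2 f3 f4 g0 g1 g2 g3 g4 x0 x1 x2 x3 x4 : Coeff M}
    (hP : P 0 0 = Polynomial.C (2 * C f) * Polynomial.X ^ 3 +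
      Polynomial.C (3 * totalD (C f)) * Polynomial.X ^ 2 +
      Polynomial.C (2 * (C f0 * X (0, 1) + C f1 * X (1, 1) + C f2 * X (0, 0) ^ 2 +
          C f3 * X (0, 0) * X (1, 0) + C f4 * X (1, 0) ^ 2) +
        3 * totalD (totalD (C f))) * Polynomial.X +
      Polynomial.C (totalD (C f0 * X (0, 1) + C f1 * X (1, 1) + C f2 * X (0, 0) ^ 2 +
          C f3 * X (0, 0) * X (1, 0) + C f4 * X (1, 0) ^ 2) + totalD (totalD (totalD (C f)))))
    (hP' : P' 0 0 = Polynomial.C (2 * C f') * Polynomial.X ^ 3 +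
      Polynomial.C (3 * totalD (C f')) * Polynomial.X ^ 2 +
      Polynomial.C (2 * (C g0 * X (0, 1) + C g1 * X (1, 1) + C g2 * X (0, 0) ^ 2 +
          C g3 * X (0, 0) * X (1, 0) + C g4 * X (1, 0) ^ 2) +
        3 * totalD (totalD (C f'))) * Polynomial.X +
      Polynomial.C (totalD (C g0 * X (0, 1) + C g1 * X (1, 1) + C g2 * X (0, 0) ^ 2 +
          C g3 * X (0, 0) * X (1, 0) + C g4 * X (1, 0) ^ 2) + totalD (totalD (totalD (C f')))))
    (hξ0 : ξ 0 = C x0 * X (0, 1) + C x1 * X (1, 1) + C x2 * X (0, 0) ^ 2 +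
        C x3 * X (0, 0) * X (1, 0) + C x4 * X (1, 0) ^ 2)
    (h : P' = P + lieDer ξ (poisson0 M)) :
    2 * f' = 2 * f - 2 * x0 ∧
    2 * g0 + 3 * pderivCoeff 0 f' =
      2 * f0 + 3 * pderivCoeff 0 f - 5 * pderivCoeff 0 x0 + 4 * x2 ∧
    2 * g1 + 3 * pderivCoeff 1 f' = 2 * f1 + 3 * pderivCoeff 1 f - 2 * x1 * invU1 M
      - 2 * pderivCoeff 0 x1 - 3 * pderivCoeff 1 x0 + 2 * x3 ∧
    2 * g4 + 3 * pderivCoeff 1 (pderivCoeff 1 f') = 2 * f4 - 2 * pderivCoeff 0 x4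
      - 4 * invU1 M * x4 + 2 * invU1 M * pderivCoeff 1 x1 + 3 * pderivCoeff 1 (pderivCoeff 1 f)
      - 3 * pderivCoeff 1 (pderivCoeff 1 x0) + 2 * pderivCoeff 1 x3 := by
  have e : opAct (P' 0 0) (X (0, 10)) =
      opAct (P 0 0) (X (0, 10)) + opAct (lieDer ξ (poisson0 M) 0 0) (X (0, 10)) := by
    rw [h, Pi.add_apply, Pi.add_apply, opAct_add]
  rw [hP, hP', opAct_lieDer] at e
  simp only [hξ0, poisson0_entries, operator_rules, opAct_zero_right, totalD_rules, evol_rules,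
    adjLin_rules, coeff_rules, totalD_ofNat, evol_ofNat, adjLin_ofNat, zero_mul, mul_zero,
    add_zero, zero_add, Nat.reduceAdd, Nat.reduceSub, Nat.cast_ofNat, pow_one, sub_zero, neg_zero,
    mul_one] at e
  have e3 := congrArg (jetEval (jetPoint [(0, 13)])) e
  have e4 := congrArg (jetEval (jetPoint [(0, 1), (0, 11)])) e
  have e5 := congrArg (jetEval (jetPoint [(1, 1), (0, 11)])) e
  have e6 := congrArg (jetEval (jetPoint [(1, 0), (0, 11)])) e
  simp only [jetEval_rules, jetEval_ofNat, jetPoint_rules, jetPoint_ne, Nat.reduceBEq, zero_mul,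
    mul_zero, add_zero, zero_add, sub_zero, neg_zero, mul_one, one_mul] at e3 e4 e5 e6
  exact ⟨by linear_combination e3, by linear_combination e4, by linear_combination e5,
    by linear_combination e6⟩

/-- A second-order infinitesimal deformation can be gauged to one with `P¹¹ = 0`. Of the six
coefficients of `P¹¹`, four are removed by a vector field along `u¹`; those of `(u¹_x)²` and
`u¹_x u²_x` then vanish by the cocycle condition. -/
theorem IsCocycle.exists_lieDer_zero_zero_of_three {P : MatOp M} (h : IsCocycle 3 P) :
    ∃ ξ : VecField M, (∀ i, IsHomogeneousDP 2 (ξ i)) ∧ (P + lieDer ξ (poisson0 M)) 0 0 = 0 := by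
  obtain ⟨f, A, hA, h00⟩ := h.isSkew.exists_eq_three h.hasDegree 0
  obtain ⟨f0, f1, f2, f3, f4, rfl⟩ := hA.exists_eq_two
  obtain ⟨x2, hx2⟩ := Coeff.exists_natCast_mul_eq two_ne_zero (pderivCoeff 0 f - f0)
  obtain ⟨x4, hx4⟩ := exists_pderivCoeff_add_mul_eq 2 (f4 + pderivCoeff 1 (-f1))
  let ξ : VecField M := ![C f * X (0, 1) + C 0 * X (1, 1) + C x2 * X (0, 0) ^ 2 +
    C (-f1) * X (0, 0) * X (1, 0) + C x4 * X (1, 0) ^ 2, 0]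
  have hξ : ∀ i, IsHomogeneousDP 2 (ξ i) := by
    intro i
    match i with
    | 0 => exact isHomogeneousDP_two f 0 x2 (-f1) x4
    | 1 => exact isWeightedHomogeneous_zero _ _ _
  have h' := h.add_lieDer (n := 2) hξ
  refine ⟨ξ, hξ, ?_⟩
  obtain ⟨f', A', hA', h00'⟩ := h'.isSkew.exists_eq_three h'.hasDegree 0
  obtain ⟨g0, g1, g2, g3, g4, rfl⟩ := hA'.exists_eq_two
  obtain ⟨r1, r2, r3, r4⟩ := lieDer_zero_zero_coeffs h00 h00' rfl rfl
  have e := h'.component 0 0 0 (X (0, 10)) 1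
  clear_value ξ
  have hf : f' = 0 := Coeff.natCast_mul_eq_zero two_ne_zero (by push_cast; linear_combination r1)
  subst hf
  simp only [coeff_rules, mul_zero, add_zero, sub_zero, zero_mul] at r2 r3 r4
  push_cast at hx2 hx4
  have hg0 : g0 = 0 := Coeff.natCast_mul_eq_zero two_ne_zero (by
    push_cast; linear_combination r2 + 2 * hx2)
  have hg1 : g1 = 0 := Coeff.natCast_mul_eq_zero two_ne_zero (by push_cast; linear_combination r3)
  have hg4 : g4 = 0 := Coeff.natCast_mul_eq_zero two_ne_zero (by
    simp only [coeff_rules] at hx4; push_cast; linear_combination r4 - 2 * hx4)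
  subst hg0 hg1 hg4
  simp only [C_0, zero_mul, mul_zero, zero_add, add_zero, totalD_zero, Polynomial.C_0] at h00'
  simp only [bracketTerm, poisson0_entries, h00', operator_rules, opAct_zero_right, totalD_rules,
    evol_rules, adjLin_rules, coeff_rules, totalD_ofNat, evol_ofNat, adjLin_ofNat, zero_mul,
    mul_zero, add_zero, zero_add, Nat.reduceAdd, Nat.reduceSub, Nat.cast_ofNat, pow_one, sub_zero,
    neg_zero, mul_one] at e
  have e7 := congrArg (jetEval (jetPoint [(0, 0), (0, 13)])) e
  have e8 := congrArg (jetEval (jetPoint [(0, 0), (1, 0), (0, 13)])) e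
  simp only [jetEval_rules, jetEval_ofNat, jetPoint_rules, jetPoint_ne, Nat.reduceBEq, zero_mul,
    mul_zero, add_zero, zero_add, sub_zero, neg_zero, mul_one, one_mul] at e7 e8
  ring_nf at e7 e8
  have hg2 : g2 = 0 := Coeff.natCast_mul_eq_zero four_ne_zero (by
    push_cast; linear_combination -e7)
  have hg3 : g3 = 0 := Coeff.natCast_mul_eq_zero two_ne_zero (by
    push_cast; linear_combination e7 - e8)
  rw [h00', hg2, hg3]
  simp only [C_0, zero_mul, mul_zero, add_zero, totalD_zero, Polynomial.C_0]

end FirstEntry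

/-! ### Normalization of the off-diagonal entries -/

section OffDiagonal

open MvPolynomial

variable {M : CoordBox}

/-- Vector fields along `u²` do not affect `P¹¹`. -/
theorem lieDer_zero_zero_eq_zero {ξ : VecField M} (hξ : ξ 0 = 0) :
    lieDer ξ (poisson0 M) 0 0 = 0 := by
  refine opAct_injective fun b => ?_
  rw [opAct_lieDer]
  simp only [hξ, poisson0_entries, operator_rules, opAct_zero_right, totalD_rules, evol_rules,
    adjLin_rules, coeff_rules, totalD_ofNat, evol_ofNat, adjLin_ofNat, zero_mul, mul_zero,
    add_zero, zero_add, Nat.reduceAdd, Nat.reduceSub, Nat.cast_ofNat, pow_one, sub_zero, neg_zero,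
    mul_one]

theorem add_lieDer_zero_zero {P : MatOp M} (h00 : P 0 0 = 0) {ξ : VecField M} (hξ : ξ 0 = 0) :
    (P + lieDer ξ (poisson0 M)) 0 0 = 0 := by
  rw [Pi.add_apply, Pi.add_apply, h00, lieDer_zero_zero_eq_zero hξ, add_zero]

/-- A function satisfying `∂g/∂u¹ = -n g/u¹` is a function of `u²` divided by `(u¹)ⁿ`. -/
theorem exists_eq_mul_invU1_pow (n : ℕ) {g : Coeff M} (h : pderivCoeff 0 g + n * invU1 M * g = 0) :
    ∃ k : Coeff M, pderivCoeff 0 k = 0 ∧ g = k * invU1 M ^ n := by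
  have h1 : coordU1 M ^ n * invU1 M ^ n = 1 := by
    rw [← mul_pow, coordU1_mul_invU1, one_pow]
  have h2 : pderivCoeff 0 (invU1 M ^ n) = -(n * invU1 M * invU1 M ^ n) := by
    rcases n with _ | n
    · simp only [coeff_rules, Nat.cast_zero, zero_mul, neg_zero, pow_zero]
    · simp only [coeff_rules, Nat.add_sub_cancel]
      ring
  refine ⟨coordU1 M ^ n * g, ?_, by linear_combination -g * h1⟩
  have h3 : coordU1 M ^ n * pderivCoeff 0 (invU1 M ^ n) +
      invU1 M ^ n * pderivCoeff 0 (coordU1 M ^ n) = 0 := by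
    rw [← pderivCoeff_mul, h1]
    simp only [coeff_rules]
  have h4 : pderivCoeff 0 (coordU1 M ^ n) = n * invU1 M * coordU1 M ^ n := by
    linear_combination coordU1 M ^ n * h3 - (coordU1 M ^ n) ^ 2 * h2 -
      pderivCoeff 0 (coordU1 M ^ n) * h1 + n * invU1 M * coordU1 M ^ n * h1
  rw [pderivCoeff_mul]
  linear_combination coordU1 M ^ n * h + g * h4

theorem eq_zero_of_invU1_mul {f : Coeff M} (h : invU1 M * f = 0) : f = 0 := by
  linear_combination coordU1 M * h - f * coordU1_mul_invU1

/-- The effect of a gauge transformation along `u²` on those coefficients of `P²¹`, in degree 2,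
that it can be used to remove. -/
theorem lieDer_one_zero_coeffs_of_two {P P' : MatOp M} {ξ : VecField M}
    {qy qx0 qx1 q0 q1 q2 q3 q4 ry rx0 rx1 r0 r1 r2 r3 r4 y0 y1 : Coeff M}
    (hP : P 1 0 = Polynomial.C (C qy) * Polynomial.X ^ 2 +
      Polynomial.C (C qx0 * X (0, 0) + C qx1 * X (1, 0)) * Polynomial.X +
      Polynomial.C (C q0 * X (0, 1) + C q1 * X (1, 1) + C q2 * X (0, 0) ^ 2 +
          C q3 * X (0, 0) * X (1, 0) + C q4 * X (1, 0) ^ 2))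
    (hP' : P' 1 0 = Polynomial.C (C ry) * Polynomial.X ^ 2 +
      Polynomial.C (C rx0 * X (0, 0) + C rx1 * X (1, 0)) * Polynomial.X +
      Polynomial.C (C r0 * X (0, 1) + C r1 * X (1, 1) + C r2 * X (0, 0) ^ 2 +
          C r3 * X (0, 0) * X (1, 0) + C r4 * X (1, 0) ^ 2))
    (hξ0 : ξ 0 = 0) (hξ1 : ξ 1 = C y0 * X (0, 0) + C y1 * X (1, 0))
        (h : P' = P + lieDer ξ (poisson0 M)) :
    ry = qy - y0 ∧ rx1 = qx1 - (pderivCoeff 0 y1 + invU1 M * y1) := by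
  have e : opAct (P' 1 0) (X (0, 10)) =
      opAct (P 1 0) (X (0, 10)) + opAct (lieDer ξ (poisson0 M) 1 0) (X (0, 10)) := by
    rw [h, Pi.add_apply, Pi.add_apply, opAct_add]
  rw [hP, hP', opAct_lieDer] at e
  simp only [hξ0, hξ1, poisson0_entries, operator_rules, opAct_zero_right, totalD_rules,
    evol_rules, adjLin_rules, coeff_rules, totalD_ofNat, evol_ofNat, adjLin_ofNat, zero_mul,
    mul_zero, add_zero, zero_add, Nat.reduceAdd, Nat.reduceSub, Nat.cast_ofNat, pow_one, sub_zero,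
    neg_zero, mul_one] at e
  have e1 := congrArg (jetEval (jetPoint [(0, 12)])) e
  have e2 := congrArg (jetEval (jetPoint [(1, 0), (0, 11)])) e
  simp only [jetEval_rules, jetEval_ofNat, jetPoint_rules, jetPoint_ne, Nat.reduceBEq, zero_mul,
    mul_zero, add_zero, zero_add, sub_zero, neg_zero, mul_one, one_mul] at e1 e2
  exact ⟨by linear_combination e1, by linear_combination e2⟩

/-- The effect of a gauge transformation along `u²` on those coefficients of `P²¹`, in degree 3,
that it can be used to remove. -/
theorem lieDer_one_zero_coeffs_of_three {P P' : MatOp M} {ξ : VecField M}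
    {qz qy0 qy1 qx0 qx1 qx2 qx3 qx4 q0 q1 q2 q3 q4 q5 q6 q7 q8 q9
      rz ry0 ry1 rx0 rx1 rx2 rx3 rx4 r0 r1 r2 r3 r4 r5 r6 r7 r8 r9
      y0 y1 y2 y3 y4 : Coeff M}
    (hP : P 1 0 = Polynomial.C (C qz) * Polynomial.X ^ 3 +
      Polynomial.C (C qy0 * X (0, 0) + C qy1 * X (1, 0)) * Polynomial.X ^ 2 +
      Polynomial.C (C qx0 * X (0, 1) + C qx1 * X (1, 1) + C qx2 * X (0, 0) ^ 2 +
          C qx3 * X (0, 0) * X (1, 0) + C qx4 * X (1, 0) ^ 2) * Polynomial.X +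
      Polynomial.C (C q0 * X (0, 2) + C q1 * X (1, 2) + C q2 * X (0, 0) * X (0, 1) +
          C q3 * X (0, 0) * X (1, 1) + C q4 * X (1, 0) * X (0, 1) + C q5 * X (1, 0) * X (1, 1) +
              C q6 * X (0, 0) ^ 3 + C q7 * X (0, 0) ^ 2 * X (1, 0) +
                  C q8 * X (0, 0) * X (1, 0) ^ 2 + C q9 * X (1, 0) ^ 3))
    (hP' : P' 1 0 = Polynomial.C (C rz) * Polynomial.X ^ 3 +
      Polynomial.C (C ry0 * X (0, 0) + C ry1 * X (1, 0)) * Polynomial.X ^ 2 +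
      Polynomial.C (C rx0 * X (0, 1) + C rx1 * X (1, 1) + C rx2 * X (0, 0) ^ 2 +
          C rx3 * X (0, 0) * X (1, 0) + C rx4 * X (1, 0) ^ 2) * Polynomial.X +
      Polynomial.C (C r0 * X (0, 2) + C r1 * X (1, 2) + C r2 * X (0, 0) * X (0, 1) +
          C r3 * X (0, 0) * X (1, 1) + C r4 * X (1, 0) * X (0, 1) + C r5 * X (1, 0) * X (1, 1) +
              C r6 * X (0, 0) ^ 3 + C r7 * X (0, 0) ^ 2 * X (1, 0) +
                  C r8 * X (0, 0) * X (1, 0) ^ 2 + C r9 * X (1, 0) ^ 3))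
    (hξ0 : ξ 0 = 0) (hξ1 : ξ 1 = C y0 * X (0, 1) + C y1 * X (1, 1) + C y2 * X (0, 0) ^ 2 +
        C y3 * X (0, 0) * X (1, 0) + C y4 * X (1, 0) ^ 2)
    (h : P' = P + lieDer ξ (poisson0 M)) :
    rz = qz - y0 ∧ ry0 = qy0 - 2 * y2 ∧ ry1 = qy1 - invU1 M * y1 - y3 ∧
      rx1 = qx1 - (pderivCoeff 0 y1 + 2 * invU1 M * y1) ∧
      rx4 = qx4 - (pderivCoeff 0 y4 + 2 * invU1 M * y4) := by
  have e : opAct (P' 1 0) (X (0, 10)) =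
      opAct (P 1 0) (X (0, 10)) + opAct (lieDer ξ (poisson0 M) 1 0) (X (0, 10)) := by
    rw [h, Pi.add_apply, Pi.add_apply, opAct_add]
  rw [hP, hP', opAct_lieDer] at e
  simp only [hξ0, hξ1, poisson0_entries, operator_rules, opAct_zero_right, totalD_rules,
    evol_rules, adjLin_rules, coeff_rules, totalD_ofNat, evol_ofNat, adjLin_ofNat, zero_mul,
    mul_zero, add_zero, zero_add, Nat.reduceAdd, Nat.reduceSub, Nat.cast_ofNat, pow_one, sub_zero,
    neg_zero, mul_one] at e
  have e1 := congrArg (jetEval (jetPoint [(0, 13)])) e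
  have e2 := congrArg (jetEval (jetPoint [(0, 0), (0, 12)])) e
  have e3 := congrArg (jetEval (jetPoint [(1, 0), (0, 12)])) e
  have e4 := congrArg (jetEval (jetPoint [(1, 1), (0, 11)])) e
  have e5 := congrArg (jetEval (jetPoint [(1, 0), (0, 11)])) e
  simp only [jetEval_rules, jetEval_ofNat, jetPoint_rules, jetPoint_ne, Nat.reduceBEq, zero_mul,
    mul_zero, add_zero, zero_add, sub_zero, neg_zero, mul_one, one_mul] at e1 e2 e3 e4 e5
  exact ⟨by linear_combination e1, by linear_combination e2, by linear_combination e3,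
    by linear_combination e4, by linear_combination e5⟩

/-- The cocycle condition determines a partially normalized `P²¹`. With `∂ = d_x / u¹`, the solution
is `(g ∂²u² + k (∂u²)²) / u¹`, where `g`, `k` are functions of `u²`. -/
theorem IsCocycle.one_zero_eq_of_two {P : MatOp M} (h : IsCocycle 2 P) (h00 : P 0 0 = 0)
    {q q0 q1 q2 q3 q4 : Coeff M}
    (h10 : P 1 0 = Polynomial.C (C q * X (0, 0)) * Polynomial.X +
      Polynomial.C (C q0 * X (0, 1) + C q1 * X (1, 1) + C q2 * X (0, 0) ^ 2 +
          C q3 * X (0, 0) * X (1, 0) + C q4 * X (1, 0) ^ 2)) :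
    ∃ g k : Coeff M, pderivCoeff 0 g = 0 ∧ pderivCoeff 0 k = 0 ∧
      P 1 0 = Polynomial.C (C (g * invU1 M ^ 3) * (X (1, 1) - C (invU1 M) * X (0, 0) * X (1, 0)) +
        C (k * invU1 M ^ 3) * X (1, 0) ^ 2) := by
  have e := h.component 1 0 0 (X (0, 10)) 1
  simp only [bracketTerm, poisson0_entries, h00, h10, operator_rules, opAct_zero_right,
    totalD_rules, evol_rules, adjLin_rules, coeff_rules, totalD_ofNat, evol_ofNat, adjLin_ofNat,
    zero_mul, mul_zero, add_zero, zero_add, Nat.reduceAdd, Nat.reduceSub, Nat.cast_ofNat, pow_one,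
    sub_zero, neg_zero, mul_one] at e
  have e1 := congrArg (jetEval (jetPoint [(0, 13)])) e
  have e2 := congrArg (jetEval (jetPoint [(0, 0), (0, 12)])) e
  have e3 := congrArg (jetEval (jetPoint [(1, 0), (0, 12)])) e
  have e4 := congrArg (jetEval (jetPoint [(0, 1), (0, 11)])) e
  have e5 := congrArg (jetEval (jetPoint [(1, 1), (0, 11)])) e
  have e6 := congrArg (jetEval (jetPoint [(1, 0), (0, 11)])) e
  simp only [jetEval_rules, jetEval_ofNat, jetPoint_rules, jetPoint_ne, Nat.reduceBEq, zero_mul,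
    mul_zero, add_zero, zero_add, sub_zero, neg_zero, mul_one, one_mul] at e1 e2 e3 e4 e5 e6
  have h0 : q0 = 0 := by linear_combination -e1
  subst h0
  simp only [coeff_rules] at e4
  have hq : q = 0 := eq_zero_of_invU1_mul (by linear_combination -e4)
  subst hq
  have h2 : q2 = 0 := Coeff.natCast_mul_eq_zero two_ne_zero (by push_cast; linear_combination -e2)
  have h3 : q3 = -(invU1 M * q1) := by linear_combination -e3
  subst h2 h3
  obtain ⟨g, hg, rfl⟩ := exists_eq_mul_invU1_pow 3 (g := q1) (by push_cast; linear_combination -e5)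
  obtain ⟨k, hk, rfl⟩ := exists_eq_mul_invU1_pow 3 (g := q4) (by push_cast; linear_combination -e6)
  refine ⟨g, k, hg, hk, ?_⟩
  rw [h10, C_0, zero_mul, Polynomial.C_0, zero_mul, zero_add]
  refine congrArg Polynomial.C ?_
  simp only [coeff_rules]
  ring

/-- The cocycle condition determines a partially normalized `P²¹`. With `∂ = d_x / u¹`, the solution
is `(g ∂³u² + k (∂u²) (∂²u²) + m (∂u²)³) / u¹`, where `g`, `k`, `m` are functions of `u²`. -/
theorem IsCocycle.one_zero_eq_of_three {P : MatOp M} (h : IsCocycle 3 P) (h00 : P 0 0 = 0)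
    {x0 x2 x3 q0 q1 q2 q3 q4 q5 q6 q7 q8 q9 : Coeff M}
    (h10 : P 1 0 = Polynomial.C (C x0 * X (0, 1) + C x2 * X (0, 0) ^ 2 +
        C x3 * X (0, 0) * X (1, 0)) * Polynomial.X +
      Polynomial.C (C q0 * X (0, 2) + C q1 * X (1, 2) + C q2 * X (0, 0) * X (0, 1) +
          C q3 * X (0, 0) * X (1, 1) + C q4 * X (1, 0) * X (0, 1) + C q5 * X (1, 0) * X (1, 1) +
              C q6 * X (0, 0) ^ 3 + C q7 * X (0, 0) ^ 2 * X (1, 0) +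
                  C q8 * X (0, 0) * X (1, 0) ^ 2 + C q9 * X (1, 0) ^ 3)) :
    ∃ g k m : Coeff M, pderivCoeff 0 g = 0 ∧ pderivCoeff 0 k = 0 ∧ pderivCoeff 0 m = 0 ∧
      P 1 0 = Polynomial.C (C (g * invU1 M ^ 4) * (X (1, 2) - 3 * C (invU1 M) * X (0, 0) * X (1, 1)
          - C (invU1 M) * X (0, 1) * X (1, 0) + 3 * C (invU1 M) ^ 2 * X (0, 0) ^ 2 * X (1, 0)) +
        C (k * invU1 M ^ 4) * (X (1, 0) * X (1, 1) - C (invU1 M) * X (0, 0) * X (1, 0) ^ 2) +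
        C (m * invU1 M ^ 4) * X (1, 0) ^ 3) := by
  have e := h.component 1 0 0 (X (0, 10)) 1
  simp only [bracketTerm, poisson0_entries, h00, h10, operator_rules, opAct_zero_right,
    totalD_rules, evol_rules, adjLin_rules, coeff_rules, totalD_ofNat, evol_ofNat, adjLin_ofNat,
    zero_mul, mul_zero, add_zero, zero_add, Nat.reduceAdd, Nat.reduceSub, Nat.cast_ofNat, pow_one,
    sub_zero, neg_zero, mul_one] at e
  have e1 := congrArg (jetEval (jetPoint [(0, 14)])) e
  have e2 := congrArg (jetEval (jetPoint [(0, 0), (0, 13)])) e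
  have e3 := congrArg (jetEval (jetPoint [(1, 0), (0, 13)])) e
  have e4 := congrArg (jetEval (jetPoint [(0, 1), (0, 12)])) e
  have e5 := congrArg (jetEval (jetPoint [(0, 0), (0, 12)])) e
  have e6 := congrArg (jetEval (jetPoint [(0, 0), (0, 1), (0, 11)])) e
  have e7 := congrArg (jetEval (jetPoint [(1, 1), (0, 12)])) e
  have e8 := congrArg (jetEval (jetPoint [(0, 0), (1, 0), (0, 12)])) e
  have e9 := congrArg (jetEval (jetPoint [(1, 0), (0, 12)])) e
  have e10 := congrArg (jetEval (jetPoint [(1, 2), (0, 11)])) e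
  have e11 := congrArg (jetEval (jetPoint [(1, 0), (0, 11)])) e
  have e12 := congrArg (jetEval (jetPoint [(1, 0), (1, 1), (0, 11)])) e
  have e13 := congrArg (jetEval (jetPoint [(1, 0), (0, 1), (0, 11)])) e
  have e14 := congrArg (jetEval (jetPoint [(0, 0), (0, 11)])) e
  simp only [jetEval_rules, jetEval_ofNat, jetPoint_rules, jetPoint_ne, Nat.reduceBEq, zero_mul,
    mul_zero, add_zero, zero_add, sub_zero, neg_zero, mul_one,
        one_mul] at e1 e2 e3 e4 e5 e6 e7 e8 e9 e10 e11 e12 e13 e14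
  have h0 : q0 = 0 := by linear_combination -e1
  have h2 : q2 = 0 := by linear_combination -e2
  subst h0 h2
  have hx0 : x0 = 0 := eq_zero_of_invU1_mul (by linear_combination -e4)
  subst hx0
  simp only [coeff_rules] at e6 e14
  have hx2 : x2 = 0 := eq_zero_of_invU1_mul (Coeff.natCast_mul_eq_zero two_ne_zero (by
    push_cast; linear_combination e14 - e6))
  subst hx2
  have h6 : q6 = 0 := Coeff.natCast_mul_eq_zero three_ne_zero (by
    push_cast; linear_combination -e5)
  subst h6
  have h4 : q4 = -(invU1 M * q1) := by linear_combination -e3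
  have h3 : q3 = -(3 * invU1 M * q1) := by linear_combination -e7
  have h8 : q8 = -(invU1 M * q5) := by linear_combination -e9
  subst h4 h3 h8
  have hx3 : x3 = 0 := eq_zero_of_invU1_mul (by
    simp only [coeff_rules] at e13
    linear_combination -e13 + e11 - invU1 M * e10)
  subst hx3
  have h7 : q7 = 3 * invU1 M ^ 2 * q1 := sub_eq_zero.1 <|
    Coeff.natCast_mul_eq_zero two_ne_zero (by push_cast; linear_combination -e8)
  subst h7
  obtain ⟨g, hg, rfl⟩ := exists_eq_mul_invU1_pow 4 (g := q1) (by push_cast; linear_combination -e10)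
  obtain ⟨k, hk, rfl⟩ := exists_eq_mul_invU1_pow 4 (g := q5) (by
    push_cast; linear_combination e11 - e12)
  obtain ⟨m, hm, rfl⟩ := exists_eq_mul_invU1_pow 4 (g := q9) (by push_cast; linear_combination -e11)
  refine ⟨g, k, m, hg, hk, hm, ?_⟩
  simp only [C_0, zero_mul, zero_add, add_zero, Polynomial.C_0] at h10
  rw [h10]
  refine congrArg Polynomial.C ?_
  simp only [coeff_rules, C_ofNat]
  ring

theorem HasDegree.exists_eq_two {P : MatOp M} (h : HasDegree 2 P) (i j : Fin 2) :
    ∃ qy qx0 qx1 q0 q1 q2 q3 q4 : Coeff M, P i j = Polynomial.C (C qy) * Polynomial.X ^ 2 +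
      Polynomial.C (C qx0 * X (0, 0) + C qx1 * X (1, 0)) * Polynomial.X +
      Polynomial.C (C q0 * X (0, 1) + C q1 * X (1, 1) + C q2 * X (0, 0) ^ 2 +
          C q3 * X (0, 0) * X (1, 0) + C q4 * X (1, 0) ^ 2) := by
  have e := h.eq_two i j
  obtain ⟨qy, h2⟩ := isHomogeneousDP_zero_iff.1 ((h i j 2).1 le_rfl)
  obtain ⟨qx0, qx1, h1⟩ := ((h i j 1).1 one_le_two).exists_eq_one
  obtain ⟨q0, q1, q2, q3, q4, h0⟩ := ((h i j 0).1 zero_le_two).exists_eq_two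
  rw [h2, h1, h0] at e
  exact ⟨_, _, _, _, _, _, _, _, e⟩

theorem HasDegree.exists_eq_three {P : MatOp M} (h : HasDegree 3 P) (i j : Fin 2) :
    ∃ qz qy0 qy1 qx0 qx1 qx2 qx3 qx4 q0 q1 q2 q3 q4 q5 q6 q7 q8 q9 : Coeff M, P i j =
        Polynomial.C (C qz) * Polynomial.X ^ 3 +
      Polynomial.C (C qy0 * X (0, 0) + C qy1 * X (1, 0)) * Polynomial.X ^ 2 +
      Polynomial.C (C qx0 * X (0, 1) + C qx1 * X (1, 1) + C qx2 * X (0, 0) ^ 2 +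
          C qx3 * X (0, 0) * X (1, 0) + C qx4 * X (1, 0) ^ 2) * Polynomial.X +
      Polynomial.C (C q0 * X (0, 2) + C q1 * X (1, 2) + C q2 * X (0, 0) * X (0, 1) +
          C q3 * X (0, 0) * X (1, 1) + C q4 * X (1, 0) * X (0, 1) + C q5 * X (1, 0) * X (1, 1) +
              C q6 * X (0, 0) ^ 3 + C q7 * X (0, 0) ^ 2 * X (1, 0) +
                  C q8 * X (0, 0) * X (1, 0) ^ 2 + C q9 * X (1, 0) ^ 3) := by
  have e := h.eq_three i j
  obtain ⟨qz, h3⟩ := isHomogeneousDP_zero_iff.1 ((h i j 3).1 le_rfl)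
  obtain ⟨qy0, qy1, h2⟩ := ((h i j 2).1 (by lia)).exists_eq_one
  obtain ⟨qx0, qx1, qx2, qx3, qx4, h1⟩ := ((h i j 1).1 (by lia)).exists_eq_two
  obtain ⟨q0, q1, q2, q3, q4, q5, q6, q7, q8, q9, h0⟩ := ((h i j 0).1 (by lia)).exists_eq_three
  rw [h3, h2, h1, h0] at e
  exact ⟨_, _, _, _, _, _, _, _, _, _, _, _, _, _, _, _, _, _, e⟩

/-- Normalization of `P²¹` by a vector field along `u²`, in degree 2. -/
theorem IsCocycle.exists_lieDer_one_zero_of_two {P : MatOp M} (h : IsCocycle 2 P)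
    (h00 : P 0 0 = 0) :
    ∃ ξ : VecField M, (∀ i, IsHomogeneousDP 1 (ξ i)) ∧ (P + lieDer ξ (poisson0 M)) 0 0 = 0 ∧
      ∃ g k : Coeff M, pderivCoeff 0 g = 0 ∧ pderivCoeff 0 k = 0 ∧
        (P + lieDer ξ (poisson0 M)) 1 0 =
          Polynomial.C (C (g * invU1 M ^ 3) * (X (1, 1) - C (invU1 M) * X (0, 0) * X (1, 0)) +
            C (k * invU1 M ^ 3) * X (1, 0) ^ 2) := by
  obtain ⟨qy, qx0, qx1, q0, q1, q2, q3, q4, h10⟩ := h.hasDegree.exists_eq_two 1 0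
  obtain ⟨y1, hy1⟩ := exists_pderivCoeff_add_mul_eq 1 qx1
  let ξ : VecField M := ![0, C qy * X (0, 0) + C y1 * X (1, 0)]
  have hξ : ∀ i, IsHomogeneousDP 1 (ξ i) := by
    intro i
    match i with
    | 0 => exact isWeightedHomogeneous_zero _ _ _
    | 1 => exact isHomogeneousDP_one qy y1
  have h' := h.add_lieDer (n := 1) hξ
  have h00' := add_lieDer_zero_zero h00 (ξ := ξ) rfl
  obtain ⟨ry, rx0, rx1, r0, r1, r2, r3, r4, h10'⟩ := h'.hasDegree.exists_eq_two 1 0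
  obtain ⟨e1, e2⟩ := lieDer_one_zero_coeffs_of_two h10 h10' rfl rfl rfl
  have hy : ry = 0 := by rw [e1, sub_self]
  have hx : rx1 = 0 := by
    rw [e2, ← hy1]
    push_cast
    ring
  subst hy hx
  simp only [C_0, Polynomial.C_0, zero_mul, zero_add, add_zero] at h10'
  exact ⟨ξ, hξ, h00', h'.one_zero_eq_of_two h00' h10'⟩

/-- Normalization of `P²¹` by a vector field along `u²`, in degree 3. -/
theorem IsCocycle.exists_lieDer_one_zero_of_three {P : MatOp M} (h : IsCocycle 3 P)
    (h00 : P 0 0 = 0) :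
    ∃ ξ : VecField M, (∀ i, IsHomogeneousDP 2 (ξ i)) ∧ (P + lieDer ξ (poisson0 M)) 0 0 = 0 ∧
      ∃ g k m : Coeff M, pderivCoeff 0 g = 0 ∧ pderivCoeff 0 k = 0 ∧ pderivCoeff 0 m = 0 ∧
        (P + lieDer ξ (poisson0 M)) 1 0 =
          Polynomial.C (C (g * invU1 M ^ 4) * (X (1, 2)
              - 3 * C (invU1 M) * X (0, 0) * X (1, 1) - C (invU1 M) * X (0, 1) * X (1, 0)
              + 3 * C (invU1 M) ^ 2 * X (0, 0) ^ 2 * X (1, 0)) +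
            C (k * invU1 M ^ 4) * (X (1, 0) * X (1, 1) - C (invU1 M) * X (0, 0) * X (1, 0) ^ 2) +
            C (m * invU1 M ^ 4) * X (1, 0) ^ 3) := by
  obtain ⟨qz, qy0, qy1, qx0, qx1, qx2, qx3, qx4, q0, q1, q2, q3, q4, q5, q6, q7, q8, q9,
      h10⟩ := h.hasDegree.exists_eq_three 1 0
  obtain ⟨y1, hy1⟩ := exists_pderivCoeff_add_mul_eq 2 qx1
  obtain ⟨y4, hy4⟩ := exists_pderivCoeff_add_mul_eq 2 qx4
  obtain ⟨y2, hy2⟩ := Coeff.exists_natCast_mul_eq two_ne_zero qy0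
  let ξ : VecField M := ![0, C qz * X (0, 1) + C y1 * X (1, 1) + C y2 * X (0, 0) ^ 2 +
    C (qy1 - invU1 M * y1) * X (0, 0) * X (1, 0) + C y4 * X (1, 0) ^ 2]
  have hξ : ∀ i, IsHomogeneousDP 2 (ξ i) := by
    intro i
    match i with
    | 0 => exact isWeightedHomogeneous_zero _ _ _
    | 1 => exact isHomogeneousDP_two qz y1 y2 _ y4
  have h' := h.add_lieDer (n := 2) hξ
  have h00' := add_lieDer_zero_zero h00 (ξ := ξ) rfl
  obtain ⟨rz, ry0, ry1, rx0, rx1, rx2, rx3, rx4, r0, r1, r2, r3, r4, r5, r6, r7, r8, r9,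
      h10'⟩ := h'.hasDegree.exists_eq_three 1 0
  obtain ⟨e1, e2, e3, e4, e5⟩ := lieDer_one_zero_coeffs_of_three h10 h10' rfl rfl rfl
  push_cast at hy1 hy2 hy4
  have hz : rz = 0 := by rw [e1, sub_self]
  have hr0 : ry0 = 0 := by rw [e2, hy2, sub_self]
  have hr1 : ry1 = 0 := by rw [e3, sub_self]
  have hs1 : rx1 = 0 := by rw [e4, hy1, sub_self]
  have hs4 : rx4 = 0 := by rw [e5, hy4, sub_self]
  subst hz hr0 hr1 hs1 hs4
  simp only [C_0, Polynomial.C_0, zero_mul, zero_add, add_zero] at h10'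
  exact ⟨ξ, hξ, h00', h'.one_zero_eq_of_three h00' h10'⟩

end OffDiagonal

/-! ### Reduction of infinitesimal deformations to normal form -/

section Reduction

open MvPolynomial

variable {M : CoordBox}

theorem IsSkew.zero_one_eq {P : MatOp M} (h : IsSkew P) {a : DiffPoly M}
    (h10 : P 1 0 = Polynomial.C a) : P 0 1 = Polynomial.C (-a) := by
  refine opAct_injective fun b => ?_
  have h1 := h 0 1
  rw [h10] at h1
  have e : adjAct (Polynomial.C a) b = -opAct (P 0 1) b := by rw [adjAct, h1, opAct_neg]
  simp only [adjAct_rules, operator_rules] at e ⊢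
  linear_combination e

theorem eq_zero_of_invU1_pow_mul (n : ℕ) {f : Coeff M} (h : invU1 M ^ n * f = 0) : f = 0 := by
  have h1 : coordU1 M ^ n * invU1 M ^ n = 1 := by
    rw [← mul_pow, coordU1_mul_invU1, one_pow]
  linear_combination coordU1 M ^ n * h - f * h1

theorem pderivCoeff_mul_invU1_pow_four {g : Coeff M} (hg : pderivCoeff 0 g = 0) :
    pderivCoeff 0 (g * invU1 M ^ 4) = -(4 * invU1 M * (g * invU1 M ^ 4)) := by
  simp only [coeff_rules, hg]
  push_cast
  ring

/-- The remaining components of the cocycle condition force `g = 0` and determine `P²²` up to a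
function of `u²`. -/
theorem IsCocycle.eq_normalForm1 {P : MatOp M} (h : IsCocycle 2 P) (h00 : P 0 0 = 0)
    {g s : Coeff M} (hg : pderivCoeff 0 g = 0) (hs : pderivCoeff 0 s = 0)
    (h10 : P 1 0 = Polynomial.C (C (g * invU1 M ^ 3) *
        (X (1, 1) - C (invU1 M) * X (0, 0) * X (1, 0)) + C (s * invU1 M ^ 3) * X (1, 0) ^ 2)) :
    ∃ ρ : Coeff M, pderivCoeff 0 ρ = 0 ∧ P = normalForm1 (12 * ρ) s := by
  have h01 := h.isSkew.zero_one_eq h10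
  obtain ⟨A, hA, h11⟩ := h.isSkew.exists_eq_two h.hasDegree 1
  obtain ⟨f0, f1, rfl⟩ := hA.exists_eq_one
  have e := h.component 1 0 1 (X (0, 10)) 1
  simp only [bracketTerm, poisson0_entries, h00, h01, h10, h11, hg, hs, operator_rules,
    opAct_zero_right, totalD_rules, evol_rules, adjLin_rules, coeff_rules, totalD_ofNat,
    evol_ofNat, adjLin_ofNat, zero_mul, mul_zero, add_zero, zero_add, Nat.reduceAdd, Nat.reduceSub,
    Nat.cast_ofNat, pow_one, sub_zero, neg_zero, mul_one] at e
  have e1 := congrArg (jetEval (jetPoint [(0, 13)])) e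
  have e2 := congrArg (jetEval (jetPoint [(1, 0), (0, 12)])) e
  have e3 := congrArg (jetEval (jetPoint [(1, 0), (0, 11)])) e
  simp only [jetEval_rules, jetEval_ofNat, jetPoint_rules, jetPoint_ne, Nat.reduceBEq, zero_mul,
    mul_zero, add_zero, zero_add, sub_zero, neg_zero, mul_one, one_mul] at e1 e2 e3
  have h0 : f0 = 0 := by linear_combination -e1
  subst h0
  simp only [coeff_rules] at e2
  obtain ⟨q, hq, rfl⟩ := exists_eq_mul_invU1_pow 3 (g := f1) (by push_cast; linear_combination -e2)
  simp only [coeff_rules, hq, Nat.cast_ofNat, pderivCoeff_ofNat] at e3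
  have hg0 : g = 0 := eq_zero_of_invU1_pow_mul 5 (by push_cast at e3; linear_combination e3)
  obtain ⟨ρ, hρ⟩ := Coeff.exists_natCast_mul_eq (n := 6) (by norm_num) q
  have hρ0 : pderivCoeff 0 ρ = 0 := Coeff.natCast_mul_eq_zero (n := 6) (by norm_num) (by
    rw [← hq, ← hρ]
    push_cast
    rw [pderivCoeff_ofNat_mul])
  refine ⟨ρ, hρ0, ?_⟩
  push_cast at hρ
  subst hg0 hρ
  obtain ⟨n00, n01, n10, n11⟩ := normalForm1_entries ρ s
  have hfst : P 1 0 = normalForm1 (12 * ρ) s 1 0 := by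
    rw [h10, n10]
    simp only [coeff_rules, zero_mul, zero_add]
  have hlast : P 1 1 = normalForm1 (12 * ρ) s 1 1 := by
    rw [h11, n11]
    refine congrArg₂ (fun F G => Polynomial.C F * Polynomial.X + Polynomial.C (totalD G)) ?_ ?_
    · simp only [coeff_rules, C_ofNat, zero_mul, zero_add]
      ring
    · simp only [coeff_rules, C_ofNat, zero_mul, zero_add]
  have hsnd : P 0 1 = normalForm1 (12 * ρ) s 0 1 := by
    rw [h01, n01]
    simp only [coeff_rules, zero_mul, zero_add]
  funext i j
  fin_cases i <;> fin_cases j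
  exacts [h00.trans n00.symm, hsnd, hfst, hlast]

set_option maxHeartbeats 1000000 in
/-- The remaining components of the cocycle condition leave only the cubic term of `P²¹`, and two
functions of `u²` in `P²²`. -/
theorem IsCocycle.one_one_eq_of_three {P : MatOp M} (h : IsCocycle 3 P)
    {g k m : Coeff M} (hg : pderivCoeff 0 g = 0) (hk : pderivCoeff 0 k = 0)
    (hm : pderivCoeff 0 m = 0)
    (h10 : P 1 0 = Polynomial.C (C (g * invU1 M ^ 4) * (X (1, 2)
          - 3 * C (invU1 M) * X (0, 0) * X (1, 1) - C (invU1 M) * X (0, 1) * X (1, 0)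
          + 3 * C (invU1 M) ^ 2 * X (0, 0) ^ 2 * X (1, 0)) +
        C (k * invU1 M ^ 4) * (X (1, 0) * X (1, 1) - C (invU1 M) * X (0, 0) * X (1, 0) ^ 2) +
        C (m * invU1 M ^ 4) * X (1, 0) ^ 3)) :
    g = 0 ∧ k = 0 ∧ ∃ π τ : Coeff M, pderivCoeff 0 π = 0 ∧ pderivCoeff 0 τ = 0 ∧
      P 1 1 = Polynomial.C (2 * (C (π * invU1 M ^ 4) *
          (X (1, 1) - C (invU1 M) * X (0, 0) * X (1, 0)) + C (τ * invU1 M ^ 4) * X (1, 0) ^ 2)) *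
            Polynomial.X +
        Polynomial.C (totalD (C (π * invU1 M ^ 4) *
          (X (1, 1) - C (invU1 M) * X (0, 0) * X (1, 0)) +
          C (τ * invU1 M ^ 4) * X (1, 0) ^ 2)) := by
  have h01 := h.isSkew.zero_one_eq h10
  obtain ⟨f, A, hA, h11⟩ := h.isSkew.exists_eq_three h.hasDegree 1
  obtain ⟨f0, f1, f2, f3, f4, rfl⟩ := hA.exists_eq_two
  have hG := pderivCoeff_mul_invU1_pow_four hg
  have hK := pderivCoeff_mul_invU1_pow_four hk
  have hM := pderivCoeff_mul_invU1_pow_four hm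
  -- It suffices to solve for the coefficients, which the cocycle condition makes homogeneous in
  -- `u¹`: as functions of `u¹` they are multiples of `(u¹)⁻⁴`.
  suffices hs : g * invU1 M ^ 4 = 0 ∧ k * invU1 M ^ 4 = 0 ∧ f = 0 ∧ f0 = 0 ∧ f2 = 0 ∧
      f3 = -(invU1 M * f1) ∧ pderivCoeff 0 f1 + 4 * invU1 M * f1 = 0 ∧
      pderivCoeff 0 f4 + 4 * invU1 M * f4 = 0 by
    obtain ⟨hG0, hK0, rfl, rfl, rfl, rfl, h1, h4⟩ := hs
    obtain ⟨π, hπ, rfl⟩ := exists_eq_mul_invU1_pow 4 (g := f1) (by exact_mod_cast h1)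
    obtain ⟨τ, hτ, rfl⟩ := exists_eq_mul_invU1_pow 4 (g := f4) (by exact_mod_cast h4)
    refine ⟨eq_zero_of_invU1_pow_mul 4 (by rw [mul_comm, hG0]),
      eq_zero_of_invU1_pow_mul 4 (by rw [mul_comm, hK0]), π, τ, hπ, hτ, ?_⟩
    simp only [C_0, totalD_zero, mul_zero, zero_mul, add_zero, zero_add, Polynomial.C_0] at h11
    rw [h11]
    refine congrArg₂ (fun F G => Polynomial.C (2 * F) * Polynomial.X + Polynomial.C (totalD G))
      ?_ ?_
    all_goals
      simp only [coeff_rules]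
      ring
  generalize g * invU1 M ^ 4 = G at *
  generalize k * invU1 M ^ 4 = K at *
  generalize m * invU1 M ^ 4 = N at *
  have e := h.component 1 0 1 (X (0, 10)) 1
  have e' := h.component 1 1 1 (X (0, 10)) 1
  simp only [bracketTerm, poisson0_entries, h01, h10, h11, hG, hK, hM, operator_rules,
    opAct_zero_right, totalD_rules, evol_rules, adjLin_rules, coeff_rules, totalD_ofNat,
    evol_ofNat, adjLin_ofNat, zero_mul, mul_zero, add_zero, zero_add, Nat.reduceAdd, Nat.reduceSub,
    Nat.cast_ofNat, pow_one, sub_zero, neg_zero, mul_one] at e e'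
  have e1 := congrArg (jetEval (jetPoint [(1, 0), (0, 10)])) e
  have e2 := congrArg (jetEval (jetPoint [(1, 0), (1, 1), (0, 10)])) e
  have e3 := congrArg (jetEval (jetPoint [(1, 0), (1, 2), (0, 10)])) e
  have e4 := congrArg (jetEval (jetPoint [(0, 14)])) e
  have e5 := congrArg (jetEval (jetPoint [(0, 1), (0, 12)])) e
  have e6 := congrArg (jetEval (jetPoint [(0, 2), (0, 11)])) e
  have e7 := congrArg (jetEval (jetPoint [(1, 2), (0, 11)])) e
  have e8 := congrArg (jetEval (jetPoint [(1, 1), (0, 12)])) e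
  have e9 := congrArg (jetEval (jetPoint [(1, 0), (1, 1), (0, 11)])) e
  have e10 := congrArg (jetEval (jetPoint [(1, 0), (0, 11)])) e
  have e11 := congrArg (jetEval (jetPoint [(1, 0), (0, 13)])) e'
  simp only [jetEval_rules, jetEval_ofNat, jetPoint_rules, jetPoint_ne, Nat.reduceBEq, zero_mul,
    mul_zero, add_zero, zero_add, sub_zero, neg_zero, mul_one,
        one_mul] at e1 e2 e3 e4 e5 e6 e7 e8 e9 e10 e11
  ring_nf at e1 e2 e3 e4 e5 e6 e7 e8 e9 e10 e11
  have hf0 : f0 = 0 := eq_zero_of_invU1_mul (Coeff.natCast_mul_eq_zero two_ne_zero (by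
    push_cast; linear_combination e11))
  have hK : K = 0 := eq_zero_of_invU1_pow_mul 2 (Coeff.natCast_mul_eq_zero three_ne_zero (by
    push_cast; linear_combination e2 - e3))
  have hG : G = 0 := eq_zero_of_invU1_pow_mul 2 (Coeff.natCast_mul_eq_zero three_ne_zero (by
    push_cast; linear_combination e3 - e1))
  subst hf0 hK hG
  have h1 : pderivCoeff 0 f = -(2 * (invU1 M * f)) := by linear_combination -e4
  simp only [coeff_rules, h1, pderivCoeff_ofNat] at e5 e6
  have hf : f = 0 := eq_zero_of_invU1_pow_mul 2 (Coeff.natCast_mul_eq_zero four_ne_zero (by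
    push_cast; linear_combination e6))
  subst hf
  have hf2 : f2 = 0 := Coeff.natCast_mul_eq_zero two_ne_zero (by
    push_cast; linear_combination -e5)
  simp only [coeff_rules] at e7 e8 e9 e10
  have h3 : pderivCoeff 0 f1 + 4 * invU1 M * f1 = 0 := by linear_combination -e7
  have h4 : pderivCoeff 1 (pderivCoeff 0 f1 + 4 * invU1 M * f1) = 0 := by
    rw [h3]
    simp only [coeff_rules]
  simp only [coeff_rules, pderivCoeff_ofNat] at h4
  refine ⟨rfl, rfl, rfl, rfl, hf2, by linear_combination e7 - e8, h3, ?_⟩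
  exact Coeff.natCast_mul_eq_zero two_ne_zero (by push_cast; linear_combination e10 - e9 - h4)

/-- The gauge transformation removing the cubic term of the off-diagonal entry. -/
theorem lieDer_quadratic_fst {m : Coeff M} (hm : pderivCoeff 0 m = 0) {ξ : VecField M}
    (hξ0 : ξ 0 = C (m * invU1 M ^ 2) * X (1, 0) ^ 2) (hξ1 : ξ 1 = 0) :
    lieDer ξ (poisson0 M) 0 0 = 0 ∧
    lieDer ξ (poisson0 M) 1 0 = Polynomial.C (C (m * invU1 M ^ 4) * X (1, 0) ^ 3) ∧
    lieDer ξ (poisson0 M) 1 1 = 0 := by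
  refine ⟨?_, ?_, ?_⟩
  all_goals
    refine opAct_injective fun b => ?_
    rw [opAct_lieDer]
    simp only [hξ0, hξ1, poisson0_entries, hm, operator_rules, opAct_zero_right, totalD_rules,
      evol_rules, adjLin_rules, coeff_rules, totalD_ofNat, evol_ofNat, adjLin_ofNat, zero_mul,
      mul_zero, add_zero, zero_add, Nat.reduceAdd, Nat.reduceSub, Nat.cast_ofNat, pow_one,
      sub_zero, neg_zero, mul_one]
    try ring

/-- The gauge transformation removing the quadratic term of the last diagonal entry. -/
theorem lieDer_quadratic_snd {t : Coeff M} (ht : pderivCoeff 0 t = 0) {ξ : VecField M}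
    (hξ0 : ξ 0 = 0)
    (hξ1 : ξ 1 = C (t * invU1 M ^ 2) * (X (1, 1) - C (invU1 M) * X (0, 0) * X (1, 0))) :
    lieDer ξ (poisson0 M) 0 0 = 0 ∧ lieDer ξ (poisson0 M) 1 0 = 0 ∧
    lieDer ξ (poisson0 M) 1 1 =
      Polynomial.C (-(2 * C (t * invU1 M ^ 4) * X (1, 0) ^ 2)) * Polynomial.X +
      Polynomial.C (-totalD (C (t * invU1 M ^ 4) * X (1, 0) ^ 2)) := by
  refine ⟨?_, ?_, ?_⟩
  all_goals
    refine opAct_injective fun b => ?_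
    rw [opAct_lieDer]
    simp only [hξ0, hξ1, poisson0_entries, ht, operator_rules, opAct_zero_right, totalD_rules,
      evol_rules, adjLin_rules, coeff_rules, totalD_ofNat, evol_ofNat, adjLin_ofNat, zero_mul,
      mul_zero, add_zero, zero_add, Nat.reduceAdd, Nat.reduceSub, Nat.cast_ofNat, pow_one,
      sub_zero, neg_zero, mul_one]
    try ring

/-- Infinitesimal deformations of first order are trivial up to the first normal form. -/
theorem IsCocycle.exists_eq_normalForm1 {P : MatOp M} (h : IsCocycle 2 P) :
    ∃ ξ : VecField M, (∀ i, IsHomogeneousDP 1 (ξ i)) ∧ ∃ ρ s : Coeff M,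
      pderivCoeff 0 ρ = 0 ∧ pderivCoeff 0 s = 0 ∧
        P + lieDer ξ (poisson0 M) = normalForm1 (12 * ρ) s := by
  obtain ⟨ξ, hξ, h0⟩ := h.exists_lieDer_zero_zero_of_two
  have h1 := h.add_lieDer (n := 1) hξ
  obtain ⟨η, hη, h00, g, s, hg, hs, h10⟩ := h1.exists_lieDer_one_zero_of_two h0
  obtain ⟨ρ, hρ, e⟩ := (h1.add_lieDer (n := 1) hη).eq_normalForm1 h00 hg hs h10
  exact ⟨ξ + η, fun i => (hξ i).add (hη i), ρ, s, hρ, hs, by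
    rw [lieDer_add_left, ← add_assoc, e]⟩

/-- Infinitesimal deformations of second order are trivial up to one functional parameter in the
last diagonal entry. -/
theorem IsCocycle.exists_eq_diagonal {P : MatOp M} (h : IsCocycle 3 P) :
    ∃ ξ : VecField M, (∀ i, IsHomogeneousDP 2 (ξ i)) ∧ ∃ π : Coeff M, pderivCoeff 0 π = 0 ∧
      (P + lieDer ξ (poisson0 M)) 0 0 = 0 ∧ (P + lieDer ξ (poisson0 M)) 0 1 = 0 ∧
      (P + lieDer ξ (poisson0 M)) 1 0 = 0 ∧
      (P + lieDer ξ (poisson0 M)) 1 1 =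
        Polynomial.C (2 * (C (π * invU1 M ^ 4) *
          (X (1, 1) - C (invU1 M) * X (0, 0) * X (1, 0)))) * Polynomial.X +
        Polynomial.C (totalD (C (π * invU1 M ^ 4) *
          (X (1, 1) - C (invU1 M) * X (0, 0) * X (1, 0)))) := by
  obtain ⟨ξ, hξ, h0⟩ := h.exists_lieDer_zero_zero_of_three
  have h1 := h.add_lieDer (n := 2) hξ
  obtain ⟨η, hη, h00, g, k, m, hg, hk, hm, h10⟩ := h1.exists_lieDer_one_zero_of_three h0
  have h2 := h1.add_lieDer (n := 2) hη
  obtain ⟨rfl, rfl, π, τ, hπ, hτ, h11⟩ := h2.one_one_eq_of_three hg hk hm h10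
  -- `ζ` cancels the cubic term of `P²¹`, `θ` the quadratic term of `P²²`.
  let ζ : VecField M := ![C (-m * invU1 M ^ 2) * X (1, 0) ^ 2, 0]
  let θ : VecField M :=
    ![0, C (τ * invU1 M ^ 2) * (X (1, 1) - C (invU1 M) * X (0, 0) * X (1, 0))]
  have hζ : ∀ i, IsHomogeneousDP 2 (ζ i) := by
    intro i
    match i with
    | 0 =>
      have := isHomogeneousDP_two 0 0 0 0 (-m * invU1 M ^ 2)
      simp only [C_0, zero_mul, zero_add] at this
      exact this
    | 1 => exact isWeightedHomogeneous_zero _ _ _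
  have hθ : ∀ i, IsHomogeneousDP 2 (θ i) := by
    intro i
    match i with
    | 0 => exact isWeightedHomogeneous_zero _ _ _
    | 1 =>
      have e := isHomogeneousDP_two 0 (τ * invU1 M ^ 2) 0 (-(τ * invU1 M ^ 2 * invU1 M)) 0
      have e' : C (τ * invU1 M ^ 2) * (X (1, 1) - C (invU1 M) * X (0, 0) * X (1, 0)) =
          C 0 * X (0, 1) + C (τ * invU1 M ^ 2) * X (1, 1) + C 0 * X (0, 0) ^ 2 +
            C (-(τ * invU1 M ^ 2 * invU1 M)) * X (0, 0) * X (1, 0) +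
            (C 0 * X (1, 0) ^ 2 : DiffPoly M) := by
        simp only [coeff_rules]
        ring
      rwa [← e'] at e
  have hm' : pderivCoeff 0 (-m) = 0 := by simp only [coeff_rules, hm, neg_zero]
  obtain ⟨z00, z10, z11⟩ := lieDer_quadratic_fst hm' (ξ := ζ) rfl rfl
  obtain ⟨t00, t10, t11⟩ := lieDer_quadratic_snd hτ (ξ := θ) rfl rfl
  have h3 := (h2.add_lieDer (n := 2) hζ).add_lieDer (n := 2) hθ
  have hsum : P + lieDer (ξ + η + ζ + θ) (poisson0 M) =
      P + lieDer ξ (poisson0 M) + lieDer η (poisson0 M) + lieDer ζ (poisson0 M) +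
        lieDer θ (poisson0 M) := by
    simp only [lieDer_add_left]
    abel
  have k10 : (P + lieDer ξ (poisson0 M) + lieDer η (poisson0 M) + lieDer ζ (poisson0 M) +
      lieDer θ (poisson0 M)) 1 0 = Polynomial.C 0 := by
    rw [Pi.add_apply, Pi.add_apply, Pi.add_apply, Pi.add_apply, h10, z10, t10, add_zero, ← map_add]
    refine congrArg Polynomial.C ?_
    simp only [coeff_rules]
    ring
  refine ⟨ξ + η + ζ + θ, fun i => (((hξ i).add (hη i)).add (hζ i)).add (hθ i), π, hπ, ?_⟩
  rw [hsum]
  refine ⟨?_, ?_, ?_, ?_⟩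
  · rw [Pi.add_apply, Pi.add_apply, Pi.add_apply, Pi.add_apply, h00, z00, t00, add_zero, add_zero]
  · rw [h3.isSkew.zero_one_eq k10, neg_zero, Polynomial.C_0]
  · rw [k10, Polynomial.C_0]
  · rw [Pi.add_apply, Pi.add_apply, Pi.add_apply, Pi.add_apply, h11, z11, t11, add_zero, totalD_add]
    simp only [Polynomial.C_add, Polynomial.C_neg, mul_add]
    rw [mul_assoc 2 (C (τ * invU1 M ^ 4)) (X (1, 0) ^ 2)]
    ring

/-- The parameter `p` enters the second normal form linearly, through a skew-adjoint operator in the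
last diagonal entry. -/
theorem normalForm2_add_diagonal (ρ s : Coeff M) {π : Coeff M} {Q : MatOp M}
    (hπ : pderivCoeff 0 π = 0) (h00 : Q 0 0 = 0)
    (h01 : Q 0 1 = 0) (h10 : Q 1 0 = 0)
    (h11 : Q 1 1 = Polynomial.C (2 * (C (π * invU1 M ^ 4) *
          (X (1, 1) - C (invU1 M) * X (0, 0) * X (1, 0)))) * Polynomial.X +
        Polynomial.C (totalD (C (π * invU1 M ^ 4) *
          (X (1, 1) - C (invU1 M) * X (0, 0) * X (1, 0))))) :
    normalForm2 (12 * ρ) s (2 * 0) + Q = normalForm2 (12 * ρ) s (2 * π) := by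
  obtain ⟨a00, a01, a10, a11⟩ := normalForm2_entries ρ s 0 rfl rfl rfl rfl rfl rfl rfl rfl rfl rfl
    rfl rfl rfl rfl rfl
  obtain ⟨b00, b01, b10, b11⟩ := normalForm2_entries ρ s π rfl rfl rfl rfl rfl rfl rfl rfl rfl rfl
    rfl rfl rfl rfl rfl
  have e : (normalForm2 (12 * ρ) s (2 * 0) + Q) 1 1 = normalForm2 (12 * ρ) s (2 * π) 1 1 := by
    rw [Pi.add_apply, Pi.add_apply, h11, a11, b11]
    refine opAct_injective fun b => ?_
    simp only [hπ, operator_rules, opAct_zero_right, totalD_rules, evol_rules, adjLin_rules,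
      coeff_rules, totalD_ofNat, evol_ofNat, adjLin_ofNat, zero_mul, mul_zero, add_zero, zero_add,
      Nat.reduceAdd, Nat.reduceSub, Nat.cast_ofNat, pow_one, sub_zero, neg_zero, mul_one]
    ring
  funext i j
  match i, j with
  | 0, 0 => rw [Pi.add_apply, Pi.add_apply, h00, a00, b00, add_zero]
  | 0, 1 => rw [Pi.add_apply, Pi.add_apply, h01, add_zero]; exact a01.trans b01.symm
  | 1, 0 => rw [Pi.add_apply, Pi.add_apply, h10, add_zero]; exact a10.trans b10.symm
  | 1, 1 => exact e

end Reduction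

/-! ### Miura transformations of low order -/

section Miura

open MvPolynomial

variable {M : CoordBox}

theorem lieDer_zero_right (ξ : VecField M) : lieDer ξ (0 : MatOp M) = 0 := by
  have := lieDer_add ξ (0 : MatOp M) 0
  rwa [add_zero, left_eq_add] at this

theorem lieSeries_zero {ξ : ℕ → VecField M} (h0 : ξ 0 = 0) (P : ℕ → MatOp M) :
    lieSeries ξ P 0 = 0 := by
  simp only [lieSeries, Finset.Nat.antidiagonal_zero, Finset.sum_singleton, h0, lieDer_zero_left]

theorem lieSeries_one {ξ : ℕ → VecField M} (h0 : ξ 0 = 0) (P : ℕ → MatOp M) :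
    lieSeries ξ P 1 = lieDer (ξ 1) (P 0) := by
  rw [lieSeries, Finset.Nat.sum_antidiagonal_eq_sum_range_succ (fun a b => lieDer (ξ a) (P b))]
  simp only [Finset.sum_range_succ, Finset.sum_range_zero, h0, lieDer_zero_left, zero_add,
    Nat.sub_self]

theorem lieSeries_two {ξ : ℕ → VecField M} (h0 : ξ 0 = 0) (P : ℕ → MatOp M) :
    lieSeries ξ P 2 = lieDer (ξ 1) (P 1) + lieDer (ξ 2) (P 0) := by
  rw [lieSeries, Finset.Nat.sum_antidiagonal_eq_sum_range_succ (fun a b => lieDer (ξ a) (P b))]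
  simp only [Finset.sum_range_succ, Finset.sum_range_zero, h0, lieDer_zero_left, zero_add,
    Nat.sub_self, Nat.add_one_sub_one]

theorem miura_zero (ξ : ℕ → VecField M) (P : ℕ → MatOp M) : miura ξ P 0 = P 0 := by
  simp [miura]

theorem miura_one {ξ : ℕ → VecField M} (h0 : ξ 0 = 0) (P : ℕ → MatOp M) :
    miura ξ P 1 = P 1 + lieDer (ξ 1) (P 0) := by
  simp [miura, Finset.sum_range_succ, lieSeries_one h0]

theorem miura_two {ξ : ℕ → VecField M} (h0 : ξ 0 = 0) (P : ℕ → MatOp M) :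
    miura ξ P 2 = P 2 + lieDer (ξ 1) (P 1) +
      (2 : ℝ)⁻¹ • lieDer (ξ 1) (lieDer (ξ 1) (P 0)) + lieDer (ξ 2) (P 0) := by
  simp only [miura, Finset.sum_range_succ, Finset.sum_range_zero, Function.iterate_succ,
    Function.iterate_zero, Function.comp_apply, id_eq, lieSeries_two h0, lieSeries_one h0,
    lieSeries_zero h0, lieDer_zero_right, Nat.factorial, Nat.cast_one, inv_one, one_smul, zero_add,
    add_zero, mul_one, Nat.reduceAdd]
  abel

/-- The generator `ε ξ₁ + ε² ξ₂`. -/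
def generator (ξ₁ ξ₂ : VecField M) : ℕ → VecField M
  | 1 => ξ₁
  | 2 => ξ₂
  | _ => 0

theorem isMiuraGenerator_generator {ξ₁ ξ₂ : VecField M} (h₁ : ∀ i, IsHomogeneousDP 1 (ξ₁ i))
    (h₂ : ∀ i, IsHomogeneousDP 2 (ξ₂ i)) : IsMiuraGenerator (generator ξ₁ ξ₂) := by
  refine ⟨rfl, fun n i => ?_⟩
  match n with
  | 0 => exact isWeightedHomogeneous_zero _ _ _
  | 1 => exact h₁ i
  | 2 => exact h₂ i
  | n + 3 => exact isWeightedHomogeneous_zero _ _ _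

/-! ### The equations for deformations of low order -/

theorem IsDeformation.sum_jacobiForm {k n : ℕ} {P : ℕ → MatOp M} (h : IsDeformation k P)
    (hn : n ≤ k) (a b c : Fin 2 → DiffPoly M) :
    ∑ m ∈ Finset.range (n + 1), jacobiForm (P m) (P (n - m)) a b c = 0 := by
  rw [← Finset.Nat.sum_antidiagonal_eq_sum_range_succ (fun m l => jacobiForm (P m) (P l) a b c)]
  exact (sum_schouten_eq_zero_iff _ (fun a : ℕ × ℕ => P a.1) (fun a => P a.2)).1
    (h.jacobi n hn) a b c

theorem IsDeformation.isCocycle_one {k : ℕ} {P : ℕ → MatOp M} (h : IsDeformation k P)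
    (hk : 1 ≤ k) : IsCocycle 2 (P 1) := by
  refine ⟨h.isSkew 1, h.hasDegree 1, fun a b c => ?_⟩
  have e := h.sum_jacobiForm hk a b c
  simp only [Finset.sum_range_succ, Finset.sum_range_zero, zero_add, Nat.sub_zero, Nat.sub_self,
    h.zero, jacobiForm_swap (poisson0 M)] at e
  exact eq_zero_of_add_self e

theorem IsDeformation.jacobiForm_two {k : ℕ} {P : ℕ → MatOp M} (h : IsDeformation k P)
    (hk : 2 ≤ k) (a b c : Fin 2 → DiffPoly M) :
    jacobiForm (P 1) (P 1) a b c + (2 : ℝ) • jacobiForm (P 2) (poisson0 M) a b c = 0 := by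
  have e := h.sum_jacobiForm hk a b c
  simp only [Finset.sum_range_succ, Finset.sum_range_zero, zero_add, Nat.sub_zero, Nat.sub_self,
    Nat.add_one_sub_one, h.zero, jacobiForm_swap (poisson0 M)] at e
  linear_combination (norm := module) e

/-- The second-order equation is preserved by Miura transformations of first order. -/
theorem IsDeformation.jacobiForm_miura_two {k : ℕ} {P : ℕ → MatOp M} (h : IsDeformation k P)
    (hk : 2 ≤ k) {ξ : VecField M} (hξ : ∀ i, IsHomogeneousDP 1 (ξ i)) (a b c : Fin 2 → DiffPoly M) :
    jacobiForm (P 1 + lieDer ξ (poisson0 M)) (P 1 + lieDer ξ (poisson0 M)) a b c +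
      (2 : ℝ) • jacobiForm (P 2 + lieDer ξ (P 1) +
        (2 : ℝ)⁻¹ • lieDer ξ (lieDer ξ (poisson0 M))) (poisson0 M) a b c = 0 := by
  have h1 := h.isCocycle_one (one_le_two.trans hk)
  have hL := isCocycle_lieDer hξ
  have e1 := jacobiForm_lieDer_add h1.isSkew isSkew_poisson0 h1.jacobi ξ a b c
  have e2 := jacobiForm_lieDer_add hL.isSkew isSkew_poisson0 hL.jacobi ξ a b c
  simp only [jacobiForm_add_left, jacobiForm_add_right, jacobiForm_smul_left]
  rw [jacobiForm_swap (lieDer ξ (poisson0 M)) (P 1)]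
  linear_combination (norm := module) h.jacobiForm_two hk a b c + (2 : ℝ) • e1 + e2

/-- Reduction of the second-order term: it differs from the second normal form with `p = 0` by an
infinitesimal deformation. -/
theorem IsDeformation.exists_miura_two {k : ℕ} {P : ℕ → MatOp M} (h : IsDeformation k P)
    (hk : 2 ≤ k) {ξ : VecField M} (hξ : ∀ i, IsHomogeneousDP 1 (ξ i)) {ρ s : Coeff M}
    (hρ : pderivCoeff 0 ρ = 0) (hs : pderivCoeff 0 s = 0)
    (e : P 1 + lieDer ξ (poisson0 M) = normalForm1 (12 * ρ) s) :
    ∃ η : VecField M, (∀ i, IsHomogeneousDP 2 (η i)) ∧ ∃ π : Coeff M, pderivCoeff 0 π = 0 ∧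
      P 2 + lieDer ξ (P 1) + (2 : ℝ)⁻¹ • lieDer ξ (lieDer ξ (poisson0 M)) +
        lieDer η (poisson0 M) = normalForm2 (12 * ρ) s (2 * π) := by
  have hρ' : pderivCoeff 0 (12 * ρ) = 0 := by rw [pderivCoeff_ofNat_mul, hρ, mul_zero]
  have h0 : pderivCoeff 0 (0 : Coeff M) = 0 := by simp only [coeff_rules]
  have hN := isDeformation_normalForm2 (isFunOfU2_iff.2 hρ') (isFunOfU2_iff.2 hs)
    (isFunOfU2_iff.2 (by rw [mul_zero, h0] : pderivCoeff 0 (2 * 0 : Coeff M) = 0))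
  have hNs := hN.isSkew 2
  have hNd := hN.hasDegree 2
  have hNj := hN.jacobiForm_two le_rfl
  simp only [series] at hNs hNd hNj
  have hL := isCocycle_lieDer hξ
  have h1 := h.isCocycle_one (one_le_two.trans hk)
  have hQ : IsCocycle 3 (P 2 + lieDer ξ (P 1) + (2 : ℝ)⁻¹ • lieDer ξ (lieDer ξ (poisson0 M)) +
      (-1 : ℝ) • normalForm2 (12 * ρ) s (2 * 0)) := by
    refine ⟨(((h.isSkew 2).add (h1.isSkew.lieDer ξ)).add ((hL.isSkew.lieDer ξ).smul _)).add
      (hNs.smul _), (((h.hasDegree 2).add (h1.hasDegree.lieDer hξ)).add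
      ((hL.hasDegree.lieDer hξ).smul _)).add (hNd.smul _), fun a b c => ?_⟩
    have e2 := h.jacobiForm_miura_two hk hξ a b c
    rw [e] at e2
    rw [jacobiForm_add_left, jacobiForm_smul_left]
    linear_combination (norm := module) (2 : ℝ)⁻¹ • e2 - (2 : ℝ)⁻¹ • hNj a b c
  obtain ⟨η, hη, π, hπ, h00, h01, h10, h11⟩ := hQ.exists_eq_diagonal
  refine ⟨η, hη, π, hπ, ?_⟩
  rw [← normalForm2_add_diagonal ρ s hπ h00 h01 h10 h11]
  module

end Miura

end DegPoisson

end

theorem theorem5 (M : DegPoisson.CoordBox) :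
    -- (1) first-order deformations
    (∀ P : ℕ → DegPoisson.MatOp M, DegPoisson.IsDeformation 1 P →
      ∃ ξ : ℕ → DegPoisson.VecField M, DegPoisson.IsMiuraGenerator ξ ∧
        ∃ r s : DegPoisson.Coeff M, DegPoisson.IsFunOfU2 r ∧ DegPoisson.IsFunOfU2 s ∧
          DegPoisson.miura ξ P 0 = DegPoisson.poisson0 M ∧
          DegPoisson.miura ξ P 1 = DegPoisson.normalForm1 r s) ∧
    (∀ r s : DegPoisson.Coeff M, DegPoisson.IsFunOfU2 r → DegPoisson.IsFunOfU2 s →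
      DegPoisson.IsDeformation 1
        (DegPoisson.series (DegPoisson.poisson0 M) (DegPoisson.normalForm1 r s) 0)) ∧
    -- (2) second-order deformations
    (∀ P : ℕ → DegPoisson.MatOp M, DegPoisson.IsDeformation 2 P →
      ∃ ξ : ℕ → DegPoisson.VecField M, DegPoisson.IsMiuraGenerator ξ ∧
        ∃ r s p : DegPoisson.Coeff M,
          DegPoisson.IsFunOfU2 r ∧ DegPoisson.IsFunOfU2 s ∧ DegPoisson.IsFunOfU2 p ∧
          DegPoisson.miura ξ P 0 = DegPoisson.poisson0 M ∧
          DegPoisson.miura ξ P 1 = DegPoisson.normalForm1 r s ∧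
          DegPoisson.miura ξ P 2 = DegPoisson.normalForm2 r s p) ∧
    (∀ r s p : DegPoisson.Coeff M,
      DegPoisson.IsFunOfU2 r → DegPoisson.IsFunOfU2 s → DegPoisson.IsFunOfU2 p →
      DegPoisson.IsDeformation 2
        (DegPoisson.series (DegPoisson.poisson0 M) (DegPoisson.normalForm1 r s)
          (DegPoisson.normalForm2 r s p))) := by
  refine ⟨fun P h => ?_, fun r s hr hs => DegPoisson.isDeformation_normalForm1 hr hs,
    fun P h => ?_, fun r s p hr hs hp => DegPoisson.isDeformation_normalForm2 hr hs hp⟩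
  · obtain ⟨ξ, hξ, ρ, s, hρ, hs, e⟩ := (h.isCocycle_one le_rfl).exists_eq_normalForm1
    refine ⟨DegPoisson.generator ξ 0, DegPoisson.isMiuraGenerator_generator hξ
      (fun _ => MvPolynomial.isWeightedHomogeneous_zero _ _ _), 12 * ρ, s,
      DegPoisson.isFunOfU2_iff.2 ?_, DegPoisson.isFunOfU2_iff.2 hs, ?_, ?_⟩
    · rw [DegPoisson.pderivCoeff_ofNat_mul, hρ, mul_zero]
    · rw [DegPoisson.miura_zero, h.zero]
    · rw [DegPoisson.miura_one rfl, h.zero]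
      exact e
  · obtain ⟨ξ, hξ, ρ, s, hρ, hs, e⟩ := (h.isCocycle_one one_le_two).exists_eq_normalForm1
    obtain ⟨η, hη, π, hπ, e'⟩ := h.exists_miura_two le_rfl hξ hρ hs e
    refine ⟨DegPoisson.generator ξ η, DegPoisson.isMiuraGenerator_generator hξ hη, 12 * ρ, s, 2 * π,
      DegPoisson.isFunOfU2_iff.2 ?_, DegPoisson.isFunOfU2_iff.2 hs, DegPoisson.isFunOfU2_iff.2 ?_,
      ?_, ?_, ?_⟩
    · rw [DegPoisson.pderivCoeff_ofNat_mul, hρ, mul_zero]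
    · rw [DegPoisson.pderivCoeff_ofNat_mul, hπ, mul_zero]
    · rw [DegPoisson.miura_zero, h.zero]
    · rw [DegPoisson.miura_one rfl, h.zero]
      exact e
    · rw [DegPoisson.miura_two rfl, h.zero]
      exact e'
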